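/- Let $d=2$, $\omega>0$ and $\lambda>0$, and let $H_0^\omega=-\frac12\Delta_{\vec x}-\frac12\Delta_{\vec y}+\frac{\omega^2y^2}{2}-\omega$ on $L^2(\mathbb R^4)$, $\vec x,\vec y\in\mathbb R^2$. Then there are bounded operators $G^\lambda_\omega=(H_0^\omega+\lambda)^{-1}$ on $L^2(\mathbb R^4)$ and $\mathcal G^\lambda_\omega:L^2(\mathbb R^2)\to L^2(\mathbb R^4)$ such that $G^\lambda_\omega$ is the integral operator with kernel $$G^\lambda_\omega(\vec x,\vec y;\vec x',\vec y')=\frac{\omega}{2\pi^2}\int_0^1 d\nu\,\frac{\nu^{\lambda/\omega-1}}{(1-\nu^2)\ln\frac1\nu}\exp\Big\{-\frac\omega2\,\frac{1-\nu}{1+\nu}(y^2+y'^2)-\frac{\omega}{2\ln\frac1\nu}(\vec x-\vec x')^2-\frac{\omega\nu}{1-\nu^2}(\vec y-\vec y')^2\Big\}$$ and $\mathcal G^\lambda_\omega$ is given by $$(\mathcal G^\lambda_\omega f)(\vec x,\vec y)=\int_{\mathbb R^2}d\vec x'\,G^\lambda_\omega(\vec x,\vec y;\vec x',\vec x')\,f(\vec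 x').$$ For every integer $k\ge 0$ with $k<\lambda$ and every real $p>\frac{2}{k+1}$, the operator $$T^k_\omega=(\mathcal G^\lambda_\omega)^*\,(G^\lambda_\omega)^k\,\mathcal G^\lambda_\omega:\ L^2(\mathbb R^2)\to L^2(\mathbb R^2)$$ belongs to the Schatten class $\mathscr B_p$, i.e. it is compact and its singular values $\mu_n$, repeated according to multiplicity, satisfy $\sum_n\mu_n^p<\infty$. -/

import Mathlib

open MeasureTheory

noncomputable section

namespace ZeroRange

/-- The physical space `ℝ²`, with the Euclidean norm. -/
abbrev Plane : Type := EuclideanSpace ℝ (Fin 2)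

/-- The two-particle configuration space `ℝ² × ℝ² = ℝ⁴`; its `volume` is Lebesgue measure. -/
abbrev Config : Type := Plane × Plane

/-- The complex Hilbert space `L²(ℝ²)`. -/
abbrev L2Plane : Type := Lp ℂ 2 (volume : Measure Plane)

/-- The complex Hilbert space `L²(ℝ⁴)`. -/
abbrev L2Config : Type := Lp ℂ 2 (volume : Measure Config)

/-- The free Hamiltonian `H₀ = -½ Δ_x - ½ Δ_y + ω² |y|² / 2 - ω d / 2` for `d = 2`, as a
differential expression (used below on smooth compactly supported functions only). -/
def freeHamiltonian (ω : ℝ) (φ : Config → ℂ) (z : Config) : ℂ :=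
  -(1 / 2 : ℂ) * Laplacian.laplacian (fun x : Plane => φ (x, z.2)) z.1
    - (1 / 2 : ℂ) * Laplacian.laplacian (fun y : Plane => φ (z.1, y)) z.2
    + ((ω ^ 2 * ‖z.2‖ ^ 2 / 2 - ω : ℝ) : ℂ) * φ z

/-- `G = (H₀ + λ)⁻¹`: for every `f ∈ L²(ℝ⁴)`, the function `G f ∈ L²(ℝ⁴)` solves
`(H₀ + λ) (G f) = f` in the sense of distributions. For `λ > 0` the `L²` solution is unique, as
`H₀` is nonnegative and essentially self-adjoint on the smooth compactly supported functions. -/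
def IsFreeResolvent (ω lam : ℝ) (G : L2Config →L[ℂ] L2Config) : Prop :=
  ∀ (f : L2Config) (φ : Config → ℂ), ContDiff ℝ ((⊤ : ℕ∞) : WithTop ℕ∞) φ → HasCompactSupport φ →
    ∫ z, G f z * (freeHamiltonian ω φ z + (lam : ℂ) * φ z) = ∫ z, f z * φ z

/-- The Green function `G^λ_ω(x, y; x', y')` of `H₀ + λ` for `d = 2`, with `z = (x, y)` and
`w = (x', y')`. The integral converges for `z ≠ w`. -/
def greenKernel (ω lam : ℝ) (z w : Config) : ℝ :=
  ω / (2 * Real.pi ^ 2) * ∫ ν in Set.Ioo (0 : ℝ) 1,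
    ν ^ (lam / ω - 1) / ((1 - ν ^ 2) * Real.log (1 / ν)) *
      Real.exp (-(ω / 2) * ((1 - ν) / (1 + ν)) * (‖z.2‖ ^ 2 + ‖w.2‖ ^ 2)
        - ω / (2 * Real.log (1 / ν)) * ‖z.1 - w.1‖ ^ 2
        - ω * ν / (1 - ν ^ 2) * ‖z.2 - w.2‖ ^ 2)

/-- The kernel `G^λ_ω(x, y; x', x')` of the potential of a charge on the plane `x = y`. -/
def potentialKernel (ω lam : ℝ) (z : Config) (x' : Plane) : ℝ :=
  greenKernel ω lam z (x', x')

/-- `A` is the integral operator with kernel `K`: for every `f ∈ L²`, for almost every `z` the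
integral `∫ K(z, w) f(w) dw` converges absolutely and equals `(A f)(z)`. -/
def IsIntegralOperator {X Y : Type*} [MeasureSpace X] [MeasureSpace Y] (K : Y → X → ℝ)
    (A : Lp ℂ 2 (volume : Measure X) →L[ℂ] Lp ℂ 2 (volume : Measure Y)) : Prop :=
  ∀ f : Lp ℂ 2 (volume : Measure X), ∀ᵐ z : Y,
    Integrable (fun w : X => (K z w : ℂ) * f w) ∧ A f z = ∫ w : X, (K z w : ℂ) * f w

/-- The multiplicity of `σ > 0` as a singular value of `A`: the dimension of the eigenspace of
`A* A` for the eigenvalue `σ²` (finite for compact `A`; zero if `σ` is not a singular value). -/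
def singularMultiplicity {H K : Type*}
    [NormedAddCommGroup H] [InnerProductSpace ℂ H] [CompleteSpace H]
    [NormedAddCommGroup K] [InnerProductSpace ℂ K] [CompleteSpace K]
    (A : H →L[ℂ] K) (σ : ℝ) : ℕ :=
  Module.finrank ℂ (Module.End.eigenspace
    ((ContinuousLinearMap.adjoint A ∘L A : H →L[ℂ] H) : H →ₗ[ℂ] H) ((σ ^ 2 : ℝ) : ℂ))

/-- The Schatten class `B_p(H, K)`, `0 < p < ∞`: compact operators whose singular values, repeated
according to multiplicity, have a finite sum of `p`-th powers. -/
def IsSchatten {H K : Type*}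
    [NormedAddCommGroup H] [InnerProductSpace ℂ H] [CompleteSpace H]
    [NormedAddCommGroup K] [InnerProductSpace ℂ K] [CompleteSpace K]
    (p : ℝ) (A : H →L[ℂ] K) : Prop :=
  IsCompactOperator A ∧
    ∑' σ : {σ : ℝ // 0 < σ},
      (singularMultiplicity A σ : ENNReal) * ENNReal.ofReal ((σ : ℝ) ^ p) < ⊤

end ZeroRange

end

/-!
The resolvent is the Laplace transform `G = ∫₀^∞ exp (-λ t) exp (-t H₀) dt` of the heat semigroup,
whose kernel is explicit (the Gaussian heat kernel in `x` times the Mehler kernel in `y`); the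
substitution `ν = exp (-ω t)` gives the stated Green function. Restricting its second argument to
the plane `x = y` gives the potential operator `Pot`, so
`G ^ k Pot = ∫₀^∞ (t ^ k / k!) exp (-λ t) R_t dt`, where `R_t` is the restricted heat operator.

The singular values of `T = Pot* G ^ k Pot` are dominated by its Gelfand numbers, the least norms
of `T` on subspaces of given codimension. Cut the time integral at `t = δ`. By Schur's test the part
with `t < δ` has norm `O(δ ^ (k + 1 / 2))`. The part with `t > δ` factors through `R_δ`, and
`R_δ* R_δ` is a constant times a Mehler kernel: a semigroup element, hence a power of a
Hilbert–Schmidt operator of explicit norm, whose Gelfand numbers are small. Choosing `δ` according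
to the codimension gives the decay rate of the singular values.
-/

namespace ZeroRange

/-! ### Gelfand numbers and Schatten classes -/

section GelfandNumbers

variable {𝕜 H K L : Type*} [RCLike 𝕜]
  [SeminormedAddCommGroup H] [NormedSpace 𝕜 H]
  [SeminormedAddCommGroup K] [NormedSpace 𝕜 K]
  [SeminormedAddCommGroup L] [NormedSpace 𝕜 L]

/-- The `(n + 1)`-st Gelfand number of `A` is at most `ε`: the restriction of `A` to some subspace
cut out by `n` continuous linear equations is bounded by `ε`. -/
def GelfandLE (A : H →L[𝕜] K) (n : ℕ) (ε : ℝ) : Prop :=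
  ∃ l : H →L[𝕜] (Fin n → 𝕜), ∀ x, l x = 0 → ‖A x‖ ≤ ε * ‖x‖

theorem gelfandLE_add {A : H →L[𝕜] K} {n m : ℕ} {ε : ℝ}
    (l₁ : H →L[𝕜] (Fin n → 𝕜)) (l₂ : H →L[𝕜] (Fin m → 𝕜))
    (h : ∀ x, l₁ x = 0 → l₂ x = 0 → ‖A x‖ ≤ ε * ‖x‖) : GelfandLE A (n + m) ε := by
  refine ⟨ContinuousLinearMap.pi fun i => Fin.addCases
    (fun j => (ContinuousLinearMap.proj j).comp l₁) (fun j => (ContinuousLinearMap.proj j).comp l₂)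
    i, fun x hx => h x ?_ ?_⟩
  · ext j
    simpa using congrFun hx (Fin.castAdd m j)
  · ext j
    simpa using congrFun hx (Fin.natAdd n j)

theorem GelfandLE.mono {A : H →L[𝕜] K} {n m : ℕ} {ε η : ℝ} (h : GelfandLE A n ε)
    (hnm : n ≤ m) (hε : ε ≤ η) : GelfandLE A m η := by
  obtain ⟨l, hl⟩ := h
  obtain ⟨d, rfl⟩ := Nat.exists_eq_add_of_le hnm
  exact gelfandLE_add l 0 fun x hx _ => (hl x hx).trans (by gcongr)

theorem gelfandLE_opNorm (A : H →L[𝕜] K) : GelfandLE A 0 ‖A‖ :=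
  ⟨0, fun x _ => A.le_opNorm x⟩

theorem GelfandLE.add_of_opNorm_le {A B : H →L[𝕜] K} {n : ℕ} {ε η : ℝ} (h : GelfandLE A n ε)
    (hB : ‖B‖ ≤ η) : GelfandLE (A + B) n (ε + η) := by
  obtain ⟨l, hl⟩ := h
  refine ⟨l, fun x hx => ?_⟩
  calc ‖(A + B) x‖ ≤ ‖A x‖ + ‖B x‖ := norm_add_le _ _
    _ ≤ ε * ‖x‖ + η * ‖x‖ := add_le_add (hl x hx) (B.le_of_opNorm_le hB x)
    _ = (ε + η) * ‖x‖ := by ring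

theorem GelfandLE.of_norm_apply_le {A : H →L[𝕜] K} {B : H →L[𝕜] L} {n : ℕ} {ε c : ℝ}
    (h : GelfandLE B n ε) (hc : 0 ≤ c) (hAB : ∀ x, ‖A x‖ ≤ c * ‖B x‖) :
    GelfandLE A n (c * ε) := by
  obtain ⟨l, hl⟩ := h
  refine ⟨l, fun x hx => (hAB x).trans ?_⟩
  rw [mul_assoc]
  exact mul_le_mul_of_nonneg_left (hl x hx) hc

theorem GelfandLE.comp {A : K →L[𝕜] L} {B : H →L[𝕜] K} {n m : ℕ} {ε η : ℝ} (hε : 0 ≤ ε)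
    (hA : GelfandLE A n ε) (hB : GelfandLE B m η) : GelfandLE (A ∘L B) (n + m) (ε * η) := by
  obtain ⟨a, ha⟩ := hA
  obtain ⟨b, hb⟩ := hB
  refine gelfandLE_add (a ∘L B) b fun x hax hbx => ?_
  calc ‖A (B x)‖ ≤ ε * ‖B x‖ := ha _ hax
    _ ≤ ε * (η * ‖x‖) := by gcongr; exact hb x hbx
    _ = ε * η * ‖x‖ := by ring

theorem GelfandLE.pow {A : H →L[𝕜] H} {n : ℕ} {ε : ℝ} (hε : 0 ≤ ε)
    (hA : GelfandLE A n ε) (m : ℕ) : GelfandLE (A ^ m) (m * n) (ε ^ m) := by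
  induction m with
  | zero => exact ⟨0, fun x _ => by simp⟩
  | succ m ih =>
    rw [pow_succ, pow_succ, Nat.succ_mul]
    exact ih.comp (pow_nonneg hε m) hA

end GelfandNumbers

section Hilbert

variable {𝕜 H K : Type*} [RCLike 𝕜]
  [NormedAddCommGroup H] [InnerProductSpace 𝕜 H]
  [NormedAddCommGroup K] [InnerProductSpace 𝕜 K]

theorem norm_adjoint_apply_sq_le [CompleteSpace H] [CompleteSpace K] (A : H →L[𝕜] K) (y : K) :
    ‖ContinuousLinearMap.adjoint A y‖ ^ 2 ≤ ‖y‖ * ‖A (ContinuousLinearMap.adjoint A y)‖ := by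
  rw [← inner_self_eq_norm_sq (𝕜 := 𝕜), ContinuousLinearMap.adjoint_inner_left]
  exact (RCLike.re_le_norm _).trans (norm_inner_le_norm _ _)

theorem GelfandLE.adjoint_comp [CompleteSpace H] [CompleteSpace K] {A B : H →L[𝕜] K}
    {n m : ℕ} {ε η : ℝ} (hε : 0 ≤ ε) (hη : 0 ≤ η) (hA : GelfandLE A n ε) (hB : GelfandLE B m η) :
    GelfandLE (ContinuousLinearMap.adjoint A ∘L B) (n + m) (ε * η) := by
  obtain ⟨a, ha⟩ := hA
  obtain ⟨b, hb⟩ := hB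
  set T := ContinuousLinearMap.adjoint A ∘L B
  refine gelfandLE_add (a ∘L T) b fun x haTx hbx => ?_
  rcases (norm_nonneg (T x)).eq_or_lt with hTx | hTx
  · rw [← hTx]
    positivity
  · refine le_of_mul_le_mul_right (?_ : ‖T x‖ * ‖T x‖ ≤ (ε * η * ‖x‖) * ‖T x‖) hTx
    calc ‖T x‖ * ‖T x‖ = ‖T x‖ ^ 2 := by ring
      _ ≤ ‖B x‖ * ‖A (T x)‖ := norm_adjoint_apply_sq_le A (B x)
      _ ≤ (η * ‖x‖) * (ε * ‖T x‖) := by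
          gcongr
          · exact hb x hbx
          · exact ha (T x) haTx
      _ = (ε * η * ‖x‖) * ‖T x‖ := by ring

theorem orthonormal_cons {n : ℕ} {v : Fin n → H} (hv : Orthonormal 𝕜 v) {x : H} (hx : ‖x‖ = 1)
    (hvx : ∀ i, inner 𝕜 (v i) x = 0) : Orthonormal 𝕜 (Fin.cons x v : Fin (n + 1) → H) := by
  refine ⟨Fin.cases hx hv.1, fun i j => ?_⟩
  refine Fin.cases ?_ (fun i => ?_) i <;> refine Fin.cases ?_ (fun j => ?_) j
  · exact fun h => (h rfl).elim
  · exact fun _ => inner_eq_zero_symm.1 (hvx j)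
  · exact fun _ => hvx i
  · exact fun hij => hv.2 fun h => hij (congrArg Fin.succ h)

theorem exists_orthonormal_lt_norm_of_not_gelfandLE {A : H →L[𝕜] K} {ε : ℝ} {n : ℕ}
    (h : ∀ m < n, ¬GelfandLE A m ε) :
    ∃ v : Fin n → H, Orthonormal 𝕜 v ∧ ∀ i, ε < ‖A (v i)‖ := by
  induction n with
  | zero => exact ⟨Fin.elim0, by simp [Orthonormal], fun i => i.elim0⟩
  | succ n ih =>
    obtain ⟨v, hv, hvA⟩ := ih fun m hm => h m (hm.trans n.lt_succ_self)
    obtain ⟨x, hvx, hx⟩ : ∃ x, (∀ i, inner 𝕜 (v i) x = 0) ∧ ε * ‖x‖ < ‖A x‖ := by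
      by_contra! hA
      exact h n n.lt_succ_self ⟨ContinuousLinearMap.pi fun i => innerSL 𝕜 (v i),
        fun x hx => hA x fun i => by simpa using congrFun hx i⟩
    have hx0 : x ≠ 0 := by
      rintro rfl
      simp at hx
    refine ⟨Fin.cons (((‖x‖⁻¹ : ℝ) : 𝕜) • x) v,
      orthonormal_cons hv ?_ fun i => by rw [inner_smul_right, hvx, mul_zero],
      Fin.cases ?_ hvA⟩
    · simp [norm_smul, hx0]
    · simp only [Fin.cons_zero, map_smul, norm_smul, RCLike.norm_ofReal, abs_inv, abs_norm]
      rwa [inv_mul_eq_div, lt_div_iff₀ (norm_pos_iff.2 hx0)]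

theorem gelfandLE_of_hilbertSchmidt {A : H →L[𝕜] K} {S ε : ℝ} (hε : 0 < ε)
    (hS : ∀ (n : ℕ) (v : Fin n → H), Orthonormal 𝕜 v → ∑ i, ‖A (v i)‖ ^ 2 ≤ S) :
    GelfandLE A ⌊S / ε ^ 2⌋₊ ε := by
  by_contra hA
  set N := ⌊S / ε ^ 2⌋₊
  obtain ⟨v, hv, hvA⟩ := exists_orthonormal_lt_norm_of_not_gelfandLE (n := N + 1)
    fun m hm hAm => hA (hAm.mono (Nat.lt_succ_iff.1 hm) le_rfl)
  have hN : ((N + 1 : ℕ) : ℝ) * ε ^ 2 ≤ S := by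
    calc ((N + 1 : ℕ) : ℝ) * ε ^ 2 = ∑ _i : Fin (N + 1), ε ^ 2 := by simp
      _ ≤ ∑ i, ‖A (v i)‖ ^ 2 := by
          gcongr with i
          exact (hvA i).le
      _ ≤ S := hS _ v hv
  exact N.lt_succ_self.not_ge (Nat.le_floor ((le_div_iff₀ (by positivity)).2 hN))

theorem finiteDimensional_orthogonal_ker {n : ℕ} (l : H →L[𝕜] (Fin n → 𝕜)) :
    FiniteDimensional 𝕜 (l : H →ₗ[𝕜] (Fin n → 𝕜)).kerᗮ := by
  refine Module.Finite.of_injective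
    ((l : H →ₗ[𝕜] (Fin n → 𝕜)).domRestrict (l : H →ₗ[𝕜] (Fin n → 𝕜)).kerᗮ) ?_
  rw [← LinearMap.ker_eq_bot, LinearMap.ker_eq_bot']
  rintro ⟨x, hx⟩ hlx
  have hx' : x ∈ (l : H →ₗ[𝕜] (Fin n → 𝕜)).ker ⊓ (l : H →ₗ[𝕜] (Fin n → 𝕜)).kerᗮ := ⟨hlx, hx⟩
  rw [Submodule.inf_orthogonal_eq_bot, Submodule.mem_bot] at hx'
  exact Subtype.ext hx'

theorem GelfandLE.exists_isCompactOperator_norm_sub_le [CompleteSpace H] {A : H →L[𝕜] K} {n : ℕ}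
    {ε : ℝ} (hε : 0 ≤ ε) (h : GelfandLE A n ε) :
    ∃ B : H →L[𝕜] K, IsCompactOperator B ∧ ‖A - B‖ ≤ ε := by
  obtain ⟨l, hl⟩ := h
  set U : Submodule 𝕜 H := (l : H →ₗ[𝕜] (Fin n → 𝕜)).ker
  have : CompleteSpace U := (ContinuousLinearMap.isClosed_ker l).completeSpace_coe
  have : FiniteDimensional 𝕜 Uᗮ := finiteDimensional_orthogonal_ker l
  refine ⟨A ∘L Uᗮ.starProjection, ?_, ContinuousLinearMap.opNorm_le_bound _ hε fun x => ?_⟩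
  · exact (isCompactOperator_of_locallyCompactSpace_dom Uᗮ.orthogonalProjectionOnto).clm_comp
      (A ∘L Uᗮ.subtypeL)
  · have hUx : x - Uᗮ.starProjection x = U.starProjection x :=
      (eq_sub_of_add_eq (Submodule.starProjection_add_starProjection_orthogonal (K := U) x)).symm
    calc ‖(A - A ∘L Uᗮ.starProjection) x‖ = ‖A (U.starProjection x)‖ := by
          rw [← hUx, map_sub, sub_apply, ContinuousLinearMap.comp_apply]
      _ ≤ ε * ‖U.starProjection x‖ := hl _ (U.starProjection_apply_mem x)
      _ ≤ ε * ‖x‖ := by gcongr; exact U.norm_starProjection_apply_le x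

theorem isCompactOperator_of_gelfandLE [CompleteSpace H] [CompleteSpace K] {A : H →L[𝕜] K}
    (h : ∀ ε > 0, ∃ n, GelfandLE A n ε) : IsCompactOperator A := by
  have hA : A ∈ closure {B : H →L[𝕜] K | IsCompactOperator B} := by
    refine Metric.mem_closure_iff.2 fun ε hε => ?_
    obtain ⟨n, hn⟩ := h (ε / 2) (half_pos hε)
    obtain ⟨B, hB, hAB⟩ := hn.exists_isCompactOperator_norm_sub_le (half_pos hε).le
    exact ⟨B, hB, (dist_eq_norm A B).trans_lt (hAB.trans_lt (half_lt_self hε))⟩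
  rwa [isClosed_setOfPred_isCompactOperator.closure_eq] at hA

theorem norm_sq_apply_sum_of_eigenvectors [CompleteSpace H] [CompleteSpace K] {ι : Type*}
    [Fintype ι] {A : H →L[𝕜] K} {w : ι → H} (hw : Orthonormal 𝕜 w) {s : ι → ℝ}
    (hs : ∀ i, ContinuousLinearMap.adjoint A (A (w i)) = (s i : 𝕜) • w i) (c : ι → 𝕜) :
    ‖A (∑ i, c i • w i)‖ ^ 2 = ∑ i, s i * ‖c i‖ ^ 2 := by
  have hT : ContinuousLinearMap.adjoint A (A (∑ i, c i • w i)) = ∑ i, (s i * c i) • w i := by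
    simp only [map_sum, map_smul, hs, smul_smul, mul_comm]
  rw [← inner_self_eq_norm_sq (𝕜 := 𝕜), ← ContinuousLinearMap.adjoint_inner_right, hT,
    hw.inner_sum, map_sum]
  refine Finset.sum_congr rfl fun i _ => ?_
  rw [mul_left_comm, RCLike.conj_mul, ← RCLike.ofReal_pow, ← RCLike.ofReal_mul, RCLike.ofReal_re]

theorem GelfandLE.card_eigenvectors_le [CompleteSpace H] [CompleteSpace K] {ι : Type*} [Fintype ι]
    {A : H →L[𝕜] K} {n : ℕ} {ε : ℝ} (hA : GelfandLE A n ε) {w : ι → H} (hw : Orthonormal 𝕜 w)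
    {s : ι → ℝ} (hs : ∀ i, ContinuousLinearMap.adjoint A (A (w i)) = (s i : 𝕜) • w i)
    (hεs : ∀ i, ε ^ 2 < s i) : Fintype.card ι ≤ n := by
  obtain ⟨l, hl⟩ := hA
  by_contra! hlt
  have hker := LinearMap.ker_ne_bot_of_finrank_lt
    (f := (l : H →ₗ[𝕜] (Fin n → 𝕜)) ∘ₗ Fintype.linearCombination 𝕜 w) (by simpa using hlt)
  obtain ⟨c, hc, hc0⟩ := Submodule.exists_mem_ne_zero_of_ne_bot hker
  set x := ∑ i, c i • w i with hx
  have hlx : l x = 0 := by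
    simpa [hx, Fintype.linearCombination_apply] using hc
  have hnorm : ‖x‖ ^ 2 = ∑ i, ‖c i‖ ^ 2 := by
    rw [← inner_self_eq_norm_sq (𝕜 := 𝕜), hx, hw.inner_sum, map_sum]
    refine Finset.sum_congr rfl fun i _ => ?_
    rw [RCLike.conj_mul, ← RCLike.ofReal_pow, RCLike.ofReal_re]
  obtain ⟨i, hi⟩ := Function.ne_iff.1 hc0
  have hlower : ε ^ 2 * ‖x‖ ^ 2 < ‖A x‖ ^ 2 := by
    rw [norm_sq_apply_sum_of_eigenvectors hw hs, hnorm, Finset.mul_sum]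
    refine Finset.sum_lt_sum (fun j _ => by gcongr; exact (hεs j).le) ⟨i, Finset.mem_univ _, ?_⟩
    have : 0 < ‖c i‖ := norm_pos_iff.2 hi
    gcongr
    exact hεs i
  rw [← mul_pow] at hlower
  exact hlower.not_ge (pow_le_pow_left₀ (norm_nonneg _) (hl x hlx) 2)

theorem exists_orthonormal_fin_finrank (E : Submodule 𝕜 H) :
    ∃ v : Fin (Module.finrank 𝕜 E) → E, Orthonormal 𝕜 v := by
  by_cases h : FiniteDimensional 𝕜 E
  · exact ⟨stdOrthonormalBasis 𝕜 E, (stdOrthonormalBasis 𝕜 E).orthonormal⟩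
  · rw [Module.finrank_of_not_finite h]
    exact ⟨Fin.elim0, by simp [Orthonormal]⟩

end Hilbert

section Schatten

open scoped ENNReal

variable {H K : Type*}
  [NormedAddCommGroup H] [InnerProductSpace ℂ H] [CompleteSpace H]
  [NormedAddCommGroup K] [InnerProductSpace ℂ K] [CompleteSpace K]

theorem exists_orthonormal_sigma_singularMultiplicity (A : H →L[ℂ] K)
    (F : Finset {σ : ℝ // 0 < σ}) :
    ∃ w : (Σ σ : F, Fin (singularMultiplicity A σ.1)) → H, Orthonormal ℂ w ∧
      ∀ i, ContinuousLinearMap.adjoint A (A (w i)) =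
        ((((i.1.1 : {σ : ℝ // 0 < σ}) : ℝ) ^ 2 : ℝ) : ℂ) • w i := by
  set T : H →L[ℂ] H := ContinuousLinearMap.adjoint A ∘L A
  have hsymm : (T : H →ₗ[ℂ] H).IsSymmetric := fun x y => by
    simp [T, ContinuousLinearMap.adjoint_inner_left, ContinuousLinearMap.adjoint_inner_right]
  let eigenvalue : F → ℂ := fun σ => (((σ : {σ : ℝ // 0 < σ}) : ℝ) ^ 2 : ℝ)
  have hinj : Function.Injective eigenvalue := fun σ τ hστ =>
    Subtype.ext (Subtype.ext
      ((pow_left_inj₀ σ.1.2.le τ.1.2.le two_ne_zero).1 (Complex.ofReal_injective hστ)))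
  choose v hv using fun σ : F =>
    exists_orthonormal_fin_finrank (Module.End.eigenspace (T : H →ₗ[ℂ] H) (eigenvalue σ))
  exact ⟨fun i => (v i.1 i.2 : H),
    (hsymm.orthogonalFamily_eigenspaces.comp hinj).orthonormal_sigma_orthonormal hv,
    fun i => Module.End.mem_eigenspace_iff.1 (v i.1 i.2).2⟩

theorem GelfandLE.sum_singularMultiplicity_le {A : H →L[ℂ] K} {n : ℕ} {ε : ℝ} (hε : 0 ≤ ε)
    (hA : GelfandLE A n ε) (F : Finset {σ : ℝ // 0 < σ}) (hF : ∀ σ ∈ F, ε < σ) :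
    ∑ σ ∈ F, singularMultiplicity A σ ≤ n := by
  obtain ⟨w, hw, hAw⟩ := exists_orthonormal_sigma_singularMultiplicity A F
  have hcard := hA.card_eigenvectors_le hw hAw fun i =>
    pow_lt_pow_left₀ (hF i.1 i.1.2) hε two_ne_zero
  rwa [Fintype.card_sigma, Finset.sum_congr rfl fun _ _ => Fintype.card_fin _,
    Finset.sum_coe_sort F fun σ => singularMultiplicity A σ] at hcard

theorem GelfandLE.tsum_singularMultiplicity_le {A : H →L[ℂ] K} {n : ℕ} {ε : ℝ} (hε : 0 ≤ ε)
    (hA : GelfandLE A n ε) :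
    ∑' σ : {σ : ℝ // 0 < σ},
      (if ε < (σ : ℝ) then (singularMultiplicity A σ : ℝ≥0∞) else 0) ≤ n := by
  rw [ENNReal.tsum_eq_iSup_sum]
  refine iSup_le fun F => ?_
  rw [← Finset.sum_filter]
  exact_mod_cast hA.sum_singularMultiplicity_le hε (F.filter fun σ => ε < (σ : ℝ)) (by simp)

theorem singularMultiplicity_eq_zero_of_opNorm_lt {A : H →L[ℂ] K} {σ : ℝ} (hσ : ‖A‖ < σ) :
    singularMultiplicity A σ = 0 := by
  have hpos : 0 < σ := (norm_nonneg A).trans_lt hσ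
  simpa using (gelfandLE_opNorm A).sum_singularMultiplicity_le (norm_nonneg A) {⟨σ, hpos⟩}
    (by simpa using hσ)

theorem singularMultiplicity_mul_rpow_le_tsum {A : H →L[ℂ] K} {a p : ℝ} (hp : 0 ≤ p)
    (ha : 1 ≤ a) (hA : ‖A‖ ≤ a) {σ : ℝ} (hσ : 0 < σ) :
    (singularMultiplicity A σ : ℝ≥0∞) * ENNReal.ofReal (σ ^ p) ≤
      ∑' j : ℕ, ENNReal.ofReal ((a * (1 / 2) ^ j) ^ p) *
        (if (1 / 2 : ℝ) ^ (j + 1) < σ then (singularMultiplicity A σ : ℝ≥0∞) else 0) := by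
  rcases lt_or_ge a σ with haσ | hσa
  · simp [singularMultiplicity_eq_zero_of_opNorm_lt (hA.trans_lt haσ)]
  have ha0 : 0 < a := one_pos.trans_le ha
  obtain ⟨j, hlt, hle⟩ := exists_nat_pow_near_of_lt_one (x := σ / a) (y := (1 / 2 : ℝ))
    (div_pos hσ ha0) ((div_le_one ha0).2 hσa) (by norm_num) (by norm_num)
  rw [lt_div_iff₀ ha0] at hlt
  rw [div_le_iff₀' ha0] at hle
  refine le_trans ?_ (ENNReal.le_tsum j)
  rw [if_pos ((le_mul_of_one_le_right (by positivity) ha).trans_lt hlt), mul_comm]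
  gcongr

theorem tsum_dyadic_rpow_lt_top {a p q C : ℝ} (ha : 0 < a) (hqp : q < p) {n : ℕ → ℕ}
    (hn : ∀ j, (n j : ℝ) ≤ C * ((1 / 2 : ℝ) ^ (j + 1)) ^ (-q)) :
    ∑' j : ℕ, ENNReal.ofReal ((a * (1 / 2) ^ j) ^ p) * n j < ∞ := by
  have hhalf : (0 : ℝ) < 1 / 2 := by norm_num
  have hterm : ∀ j : ℕ, (a * (1 / 2 : ℝ) ^ j) ^ p * (C * ((1 / 2 : ℝ) ^ (j + 1)) ^ (-q)) =
      a ^ p * C * (1 / 2) ^ (-q) * ((1 / 2 : ℝ) ^ (p - q)) ^ j := fun j => by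
    have hexp : ((1 : ℝ) / 2) ^ ((j : ℝ) * p) * (1 / 2) ^ (((j + 1 : ℕ) : ℝ) * -q) =
        (1 / 2) ^ (-q) * (1 / 2) ^ ((p - q) * (j : ℝ)) := by
      rw [← Real.rpow_add hhalf, ← Real.rpow_add hhalf]
      push_cast
      ring_nf
    rw [Real.mul_rpow ha.le (by positivity)]
    simp only [← Real.rpow_natCast, ← Real.rpow_mul hhalf.le]
    linear_combination (a ^ p * C) * hexp
  calc ∑' j : ℕ, ENNReal.ofReal ((a * (1 / 2) ^ j) ^ p) * n j
      ≤ ∑' j : ℕ, ENNReal.ofReal (a ^ p * C * (1 / 2) ^ (-q) * ((1 / 2) ^ (p - q)) ^ j) := by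
        gcongr with j
        rw [← ENNReal.ofReal_natCast, ← ENNReal.ofReal_mul (by positivity), ← hterm]
        gcongr
        exact hn j
    _ < ∞ := Summable.tsum_ofReal_lt_top <| (summable_geometric_of_lt_one (by positivity)
        (Real.rpow_lt_one hhalf.le (by norm_num) (sub_pos.2 hqp))).mul_left _

theorem isSchatten_of_gelfandLE {A : H →L[ℂ] K} {p q C : ℝ} (hp : 0 ≤ p) (hqp : q < p)
    (h : ∀ ε : ℝ, 0 < ε → ε ≤ 1 → ∃ n : ℕ, GelfandLE A n ε ∧ (n : ℝ) ≤ C * ε ^ (-q)) :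
    IsSchatten p A := by
  refine ⟨isCompactOperator_of_gelfandLE fun ε hε => ?_, ?_⟩
  · obtain ⟨n, hn, -⟩ := h (min ε 1) (by positivity) (min_le_right _ _)
    exact ⟨n, hn.mono le_rfl (min_le_left _ _)⟩
  choose n hn hnC using fun j : ℕ =>
    h ((1 / 2) ^ (j + 1)) (by positivity) (pow_le_one₀ (by norm_num) (by norm_num))
  set a : ℝ := max ‖A‖ 1
  calc ∑' σ : {σ : ℝ // 0 < σ},
        (singularMultiplicity A σ : ℝ≥0∞) * ENNReal.ofReal ((σ : ℝ) ^ p)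
      ≤ ∑' σ : {σ : ℝ // 0 < σ}, ∑' j : ℕ, ENNReal.ofReal ((a * (1 / 2) ^ j) ^ p) *
        (if (1 / 2 : ℝ) ^ (j + 1) < σ then (singularMultiplicity A σ : ℝ≥0∞) else 0) :=
        ENNReal.tsum_le_tsum fun σ => singularMultiplicity_mul_rpow_le_tsum hp
          (le_max_right _ _) (le_max_left _ _) σ.2
    _ = ∑' j : ℕ, ENNReal.ofReal ((a * (1 / 2) ^ j) ^ p) * ∑' σ : {σ : ℝ // 0 < σ},
        (if (1 / 2 : ℝ) ^ (j + 1) < σ then (singularMultiplicity A σ : ℝ≥0∞) else 0) := by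
        rw [ENNReal.tsum_comm]
        simp_rw [ENNReal.tsum_mul_left]
    _ ≤ ∑' j : ℕ, ENNReal.ofReal ((a * (1 / 2) ^ j) ^ p) * n j := by
        gcongr with j
        exact (hn j).tsum_singularMultiplicity_le (by positivity)
    _ < ∞ := tsum_dyadic_rpow_lt_top (by positivity) hqp hnC

end Schatten

/-! ### Integral operators with nonnegative kernels -/

section SquareIntegrable

open scoped ENNReal

variable {X E : Type*} [MeasurableSpace X] [NormedAddCommGroup E] {μ : Measure X}

theorem eLpNorm_two_sq (f : X → E) : eLpNorm f 2 μ ^ 2 = ∫⁻ x, ‖f x‖ₑ ^ 2 ∂μ := by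
  simpa only [NNReal.coe_ofNat, ENNReal.coe_ofNat, ENNReal.rpow_ofNat] using
    eLpNorm_nnreal_pow_eq_lintegral (μ := μ) (f := f) (p := 2) two_ne_zero

theorem memLp_two_iff_lintegral_enorm_sq_lt_top {f : X → E} (hf : AEStronglyMeasurable f μ) :
    MemLp f 2 μ ↔ ∫⁻ x, ‖f x‖ₑ ^ 2 ∂μ < ∞ := by
  rw [← eLpNorm_two_sq, ENNReal.pow_lt_top_iff, or_iff_left two_ne_zero]
  exact ⟨fun h => h.eLpNorm_lt_top, fun h => ⟨hf, h⟩⟩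

theorem ofReal_norm_sq_Lp_two (f : Lp E 2 μ) :
    ENNReal.ofReal (‖f‖ ^ 2) = ∫⁻ x, ‖f x‖ₑ ^ 2 ∂μ := by
  rw [← eLpNorm_two_sq, ← Lp.enorm_def, ENNReal.ofReal_pow (norm_nonneg _), ofReal_norm]

theorem norm_Lp_two_le_mul {Y F : Type*} [MeasurableSpace Y] [NormedAddCommGroup F]
    {ν : Measure Y} {f : Lp E 2 μ} {g : Lp F 2 ν} {C : NNReal}
    (h : ∫⁻ y, ‖g y‖ₑ ^ 2 ∂ν ≤ C ^ 2 * ∫⁻ x, ‖f x‖ₑ ^ 2 ∂μ) : ‖g‖ ≤ C * ‖f‖ := by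
  rw [← ofReal_norm_sq_Lp_two, ← ofReal_norm_sq_Lp_two, ← ENNReal.ofReal_coe_nnreal,
    ← ENNReal.ofReal_pow C.coe_nonneg, ← ENNReal.ofReal_mul (by positivity), ← mul_pow,
    ENNReal.ofReal_le_ofReal_iff (by positivity)] at h
  exact (pow_le_pow_iff_left₀ (norm_nonneg _) (by positivity) two_ne_zero).1 h

theorem sq_lintegral_le_of_sq_le_mul {f a b : X → ℝ≥0∞}
    (ha : AEMeasurable a μ) (hb : AEMeasurable b μ) (h : ∀ᵐ x ∂μ, f x ^ 2 ≤ a x * b x) :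
    (∫⁻ x, f x ∂μ) ^ 2 ≤ (∫⁻ x, a x ∂μ) * ∫⁻ x, b x ∂μ := by
  have sqrt_sq (c : ℝ≥0∞) : (c ^ (1 / 2 : ℝ)) ^ 2 = c := by
    rw [← ENNReal.rpow_natCast, ← ENNReal.rpow_mul]
    norm_num
  have hcs : ∫⁻ x, f x ∂μ ≤ (∫⁻ x, a x ∂μ) ^ (1 / 2 : ℝ) * (∫⁻ x, b x ∂μ) ^ (1 / 2 : ℝ) := by
    refine le_trans (lintegral_mono_ae (h.mono fun x hx => ?_))
      (ENNReal.lintegral_mul_norm_pow_le ha hb (p := 1 / 2) (q := 1 / 2)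
        (by norm_num) (by norm_num) (by norm_num))
    refine (ENNReal.pow_le_pow_left_iff two_ne_zero).1 ?_
    rwa [mul_pow, sqrt_sq, sqrt_sq]
  calc (∫⁻ x, f x ∂μ) ^ 2
      ≤ ((∫⁻ x, a x ∂μ) ^ (1 / 2 : ℝ) * (∫⁻ x, b x ∂μ) ^ (1 / 2 : ℝ)) ^ 2 := by gcongr
    _ = (∫⁻ x, a x ∂μ) * ∫⁻ x, b x ∂μ := by rw [mul_pow, sqrt_sq, sqrt_sq]

end SquareIntegrable

section Kernels

open scoped ENNReal NNReal ComplexConjugate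

/-- The complex Hilbert space `L²(X)`. -/
abbrev L2 (X : Type*) [MeasureSpace X] : Type _ := Lp ℂ 2 (volume : Measure X)

variable {X Y Z : Type*} [MeasureSpace X] [MeasureSpace Y] [MeasureSpace Z]

theorem measurable_L2 (f : L2 X) : Measurable f := (Lp.stronglyMeasurable f).measurable

theorem lintegral_enorm_sq_L2_lt_top (f : L2 X) : ∫⁻ x, ‖f x‖ₑ ^ 2 < ∞ :=
  (memLp_two_iff_lintegral_enorm_sq_lt_top (Lp.aestronglyMeasurable f)).1 (Lp.memLp f)

/-- The nonnegative kernel `k` acts on nonnegative functions as an operator from `L²(X)` to `L²(Y)`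
of norm at most `C`. -/
structure IsL2Kernel (k : Y → X → ℝ≥0∞) (C : ℝ≥0) : Prop where
  measurable : Measurable (Function.uncurry k)
  lintegral_sq_le : ∀ g : X → ℝ≥0∞, Measurable g →
    ∫⁻ z, (∫⁻ x, k z x * g x) ^ 2 ≤ C ^ 2 * ∫⁻ x, g x ^ 2

/-- `A` is the integral operator with the nonnegative kernel `k`. The values of `k` are extended
nonnegative reals, so that compositions of kernels are Lebesgue integrals which always exist. -/
def IsKernelOp (k : Y → X → ℝ≥0∞) (A : L2 X →L[ℂ] L2 Y) : Prop :=
  IsIntegralOperator (fun z x => (k z x).toReal) A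

theorem isL2Kernel_of_schur [SFinite (volume : Measure X)] [SFinite (volume : Measure Y)]
    {k k₁ k₂ : Y → X → ℝ≥0∞} {C C₁ C₂ : ℝ≥0} (hk : Measurable (Function.uncurry k))
    (hk₁ : Measurable (Function.uncurry k₁)) (hk₂ : Measurable (Function.uncurry k₂))
    (hk₁₂ : ∀ z x, k z x ^ 2 ≤ k₁ z x * k₂ z x) (hC₁ : ∀ z, ∫⁻ x, k₁ z x ≤ C₁)
    (hC₂ : ∀ x, ∫⁻ z, k₂ z x ≤ C₂) (hC : C₁ * C₂ ≤ C ^ 2) : IsL2Kernel k C := by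
  refine ⟨hk, fun g hg => ?_⟩
  have hk₂g : Measurable (Function.uncurry fun z x => k₂ z x * g x ^ 2) :=
    hk₂.mul ((hg.comp measurable_snd).pow_const 2)
  calc ∫⁻ z, (∫⁻ x, k z x * g x) ^ 2
      ≤ ∫⁻ z, C₁ * ∫⁻ x, k₂ z x * g x ^ 2 := by
        refine lintegral_mono fun z => ?_
        refine (sq_lintegral_le_of_sq_le_mul (a := fun x => k₁ z x)
          (b := fun x => k₂ z x * g x ^ 2) hk₁.of_uncurry_left.aemeasurable
          hk₂g.of_uncurry_left.aemeasurable (.of_forall fun x => ?_)).trans ?_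
        · rw [mul_pow, ← mul_assoc]
          gcongr
          exact hk₁₂ z x
        · gcongr
          exact hC₁ z
    _ = C₁ * ∫⁻ x, (∫⁻ z, k₂ z x) * g x ^ 2 := by
        rw [lintegral_const_mul _ hk₂g.lintegral_prod_right,
          lintegral_lintegral_swap hk₂g.aemeasurable]
        congr 1
        exact lintegral_congr fun x => lintegral_mul_const _ hk₂.of_uncurry_right
    _ ≤ C₁ * ∫⁻ x, C₂ * g x ^ 2 := by
        gcongr with x
        exact hC₂ x
    _ = (C₁ * C₂ : ℝ≥0) * ∫⁻ x, g x ^ 2 := by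
        rw [lintegral_const_mul _ (hg.pow_const 2), ENNReal.coe_mul, mul_assoc]
    _ ≤ C ^ 2 * ∫⁻ x, g x ^ 2 := by
        gcongr
        exact_mod_cast hC

theorem isL2Kernel_of_lintegral_le [SFinite (volume : Measure X)] [SFinite (volume : Measure Y)]
    {k : Y → X → ℝ≥0∞} {C C₁ C₂ : ℝ≥0} (hk : Measurable (Function.uncurry k))
    (hC₁ : ∀ z, ∫⁻ x, k z x ≤ C₁) (hC₂ : ∀ x, ∫⁻ z, k z x ≤ C₂) (hC : C₁ * C₂ ≤ C ^ 2) :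
    IsL2Kernel k C :=
  isL2Kernel_of_schur hk hk hk (fun _ _ => (sq _).le) hC₁ hC₂ hC

theorem enorm_toReal_mul_le (a : ℝ≥0∞) (b : ℂ) : ‖((a.toReal : ℝ) : ℂ) * b‖ₑ ≤ a * ‖b‖ₑ := by
  rw [enorm_mul]
  gcongr
  rw [← ofReal_norm, Complex.norm_real, Real.norm_of_nonneg ENNReal.toReal_nonneg]
  exact ENNReal.ofReal_toReal_le

theorem measurable_toReal_mul {k : Y → X → ℝ≥0∞} (hk : Measurable (Function.uncurry k))
    {f : X → ℂ} (hf : Measurable f) :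
    Measurable (Function.uncurry fun z x => (((k z x).toReal : ℝ) : ℂ) * f x) :=
  (Complex.measurable_ofReal.comp hk.ennreal_toReal).mul (hf.comp measurable_snd)

theorem measurable_lintegral_mul [SFinite (volume : Measure X)] {k : Y → X → ℝ≥0∞}
    (hk : Measurable (Function.uncurry k)) {g : X → ℝ≥0∞} (hg : Measurable g) :
    Measurable fun z => ∫⁻ x, k z x * g x :=
  (hk.mul (hg.comp measurable_snd)).lintegral_prod_right

theorem lintegral_lintegral_mul_mul [SFinite (volume : Measure X)] [SFinite (volume : Measure Y)]
    {k : Y → X → ℝ≥0∞} (hk : Measurable (Function.uncurry k)) {f : X → ℝ≥0∞} (hf : Measurable f)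
    {g : Y → ℝ≥0∞} (hg : Measurable g) :
    ∫⁻ x, (∫⁻ y, g y * k y x) * f x = ∫⁻ y, g y * ∫⁻ x, k y x * f x := by
  have hgkf : Measurable (Function.uncurry fun x y => g y * (k y x * f x)) :=
    (hg.comp measurable_snd).mul ((hk.comp measurable_swap).mul (hf.comp measurable_fst))
  calc ∫⁻ x, (∫⁻ y, g y * k y x) * f x = ∫⁻ x, ∫⁻ y, g y * (k y x * f x) := by
        refine lintegral_congr fun x => ?_
        rw [← lintegral_mul_const (f := fun y => g y * k y x) _ (hg.mul hk.of_uncurry_right)]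
        simp_rw [mul_assoc]
    _ = ∫⁻ y, ∫⁻ x, g y * (k y x * f x) := lintegral_lintegral_swap hgkf.aemeasurable
    _ = ∫⁻ y, g y * ∫⁻ x, k y x * f x :=
        lintegral_congr fun y => lintegral_const_mul _ (hk.of_uncurry_left.mul hf)

section Bilinear

variable [SFinite (volume : Measure X)] {k : Y → X → ℝ≥0∞} {f : X → ℂ} {g : Y → ℂ}

theorem integrable_mul_kernel_mul (hk : Measurable (Function.uncurry k)) (hf : Measurable f)
    (hg : Measurable g) (h : ∫⁻ y, ‖g y‖ₑ * ∫⁻ x, k y x * ‖f x‖ₑ < ∞) :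
    Integrable (Function.uncurry fun y x => g y * ((((k y x).toReal : ℝ) : ℂ) * f x))
      ((volume : Measure Y).prod (volume : Measure X)) := by
  have hmeas : Measurable (Function.uncurry fun y x =>
      g y * ((((k y x).toReal : ℝ) : ℂ) * f x)) :=
    (hg.comp measurable_fst).mul (measurable_toReal_mul hk hf)
  refine ⟨hmeas.aestronglyMeasurable, lt_of_le_of_lt ?_ h⟩
  rw [lintegral_prod _ hmeas.enorm.aemeasurable]
  refine lintegral_mono fun y => ?_
  rw [← lintegral_const_mul (f := fun x => k y x * ‖f x‖ₑ) _ (hk.of_uncurry_left.mul hf.enorm)]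
  refine lintegral_mono fun x => ?_
  simp only [Function.uncurry_apply_pair]
  rw [enorm_mul]
  gcongr
  exact enorm_toReal_mul_le _ _

theorem integrable_integral_mul_kernel_mul [SFinite (volume : Measure Y)]
    (hk : Measurable (Function.uncurry k)) (hf : Measurable f) (hg : Measurable g)
    (h : ∫⁻ y, ‖g y‖ₑ * ∫⁻ x, k y x * ‖f x‖ₑ < ∞) :
    Integrable fun x => (∫ y, g y * ((k y x).toReal : ℂ)) * f x := by
  refine (integrable_mul_kernel_mul hk hf hg h).integral_prod_right.congr (.of_forall fun x => ?_)
  simp only [Function.uncurry_apply_pair, ← integral_mul_const, mul_assoc]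

theorem integral_mul_integral_kernel_mul [SFinite (volume : Measure Y)]
    (hk : Measurable (Function.uncurry k)) (hf : Measurable f) (hg : Measurable g)
    (h : ∫⁻ y, ‖g y‖ₑ * ∫⁻ x, k y x * ‖f x‖ₑ < ∞) :
    ∫ y, g y * ∫ x, (((k y x).toReal : ℝ) : ℂ) * f x =
      ∫ x, (∫ y, g y * ((k y x).toReal : ℂ)) * f x := by
  simp only [← integral_const_mul, ← integral_mul_const]
  rw [integral_integral_swap (integrable_mul_kernel_mul hk hf hg h)]
  simp only [mul_assoc]

theorem integral_toReal_mul_toReal_mul_ae_eq [SFinite (volume : Measure Y)]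
    (hk : Measurable (Function.uncurry k)) (hf : Measurable f) {g : Y → ℝ≥0∞} (hg : Measurable g)
    (h : ∫⁻ y, g y * ∫⁻ x, k y x * ‖f x‖ₑ < ∞) :
    (fun x => (∫ y, ((g y).toReal : ℂ) * ((k y x).toReal : ℂ)) * f x) =ᵐ[volume]
      fun x => (((∫⁻ y, g y * k y x).toReal : ℝ) : ℂ) * f x := by
  rw [← lintegral_lintegral_mul_mul hk hf.enorm hg] at h
  have hgk : Measurable fun x => ∫⁻ y, g y * k y x :=
    ((hg.comp measurable_snd).mul (hk.comp measurable_swap)).lintegral_prod_right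
  filter_upwards [ae_lt_top (hgk.mul hf.enorm) h.ne] with x hx
  rcases eq_or_ne (f x) 0 with hfx | hfx
  · simp [hfx]
  have hfin : ∫⁻ y, g y * k y x < ∞ := ENNReal.lt_top_of_mul_ne_top_left hx.ne (by simpa using hfx)
  have hgkx : Measurable fun y => g y * k y x := hg.mul hk.of_uncurry_right
  rw [← integral_toReal hgkx.aemeasurable (ae_lt_top hgkx hfin.ne), ← integral_complex_ofReal]
  simp only [ENNReal.toReal_mul, Complex.ofReal_mul]

end Bilinear

namespace IsL2Kernel

variable {k : Y → X → ℝ≥0∞} {C : ℝ≥0}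

theorem comp [SFinite (volume : Measure X)] [SFinite (volume : Measure Y)]
    {k : Z → Y → ℝ≥0∞} {l : Y → X → ℝ≥0∞} {D : ℝ≥0} (hk : IsL2Kernel k C) (hl : IsL2Kernel l D) :
    IsL2Kernel (fun z x => ∫⁻ y, k z y * l y x) (C * D) where
  measurable := by
    refine Measurable.lintegral_prod_right (f := fun (p : Z × X) y => k p.1 y * l y p.2) ?_
    exact (hk.measurable.comp (measurable_fst.fst.prodMk measurable_snd)).mul
      (hl.measurable.comp (measurable_snd.prodMk measurable_fst.snd))
  lintegral_sq_le g hg := by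
    simp_rw [lintegral_lintegral_mul_mul hl.measurable hg hk.measurable.of_uncurry_left]
    calc ∫⁻ z, (∫⁻ y, k z y * ∫⁻ x, l y x * g x) ^ 2
        ≤ C ^ 2 * ∫⁻ y, (∫⁻ x, l y x * g x) ^ 2 :=
          hk.lintegral_sq_le _ (measurable_lintegral_mul hl.measurable hg)
      _ ≤ C ^ 2 * (D ^ 2 * ∫⁻ x, g x ^ 2) := by gcongr; exact hl.lintegral_sq_le g hg
      _ = (C * D : ℝ≥0) ^ 2 * ∫⁻ x, g x ^ 2 := by
          push_cast
          ring

theorem lintegral_sq_lt_top (hk : IsL2Kernel k C) {g : X → ℝ≥0∞} (hg : Measurable g)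
    (hg2 : ∫⁻ x, g x ^ 2 < ∞) : ∫⁻ z, (∫⁻ x, k z x * g x) ^ 2 < ∞ :=
  (hk.lintegral_sq_le g hg).trans_lt (ENNReal.mul_lt_top (by simp) hg2)

theorem ae_lintegral_lt_top [SFinite (volume : Measure X)] (hk : IsL2Kernel k C)
    {g : X → ℝ≥0∞} (hg : Measurable g) (hg2 : ∫⁻ x, g x ^ 2 < ∞) :
    ∀ᵐ z, ∫⁻ x, k z x * g x < ∞ := by
  filter_upwards [ae_lt_top ((measurable_lintegral_mul hk.measurable hg).pow_const 2)
    (hk.lintegral_sq_lt_top hg hg2).ne] with z hz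
  simpa [ENNReal.pow_lt_top_iff] using hz

theorem ae_integrable [SFinite (volume : Measure X)] (hk : IsL2Kernel k C) (f : L2 X) :
    ∀ᵐ z, Integrable fun x => (((k z x).toReal : ℝ) : ℂ) * f x := by
  filter_upwards [hk.ae_lintegral_lt_top (measurable_L2 f).enorm
    (lintegral_enorm_sq_L2_lt_top f)] with z hz
  exact ⟨(measurable_toReal_mul hk.measurable (measurable_L2 f)).of_uncurry_left
    |>.aestronglyMeasurable, (lintegral_mono fun x => enorm_toReal_mul_le _ _).trans_lt hz⟩

theorem lintegral_enorm_sq_le (hk : IsL2Kernel k C) {f : X → ℂ} (hf : Measurable f) :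
    ∫⁻ z, ‖∫ x, (((k z x).toReal : ℝ) : ℂ) * f x‖ₑ ^ 2 ≤ C ^ 2 * ∫⁻ x, ‖f x‖ₑ ^ 2 := by
  refine le_trans (lintegral_mono fun z => ?_) (hk.lintegral_sq_le _ hf.enorm)
  gcongr
  exact (enorm_integral_le_lintegral_enorm _).trans
    (lintegral_mono fun x => enorm_toReal_mul_le _ _)

theorem memLp_integral [SFinite (volume : Measure X)] (hk : IsL2Kernel k C) (f : L2 X) :
    MemLp (fun z => ∫ x, (((k z x).toReal : ℝ) : ℂ) * f x) 2 (volume : Measure Y) :=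
  (memLp_two_iff_lintegral_enorm_sq_lt_top (measurable_toReal_mul hk.measurable
    (measurable_L2 f)).stronglyMeasurable.integral_prod_right.aestronglyMeasurable).2 <|
    (hk.lintegral_enorm_sq_le (measurable_L2 f)).trans_lt
      (ENNReal.mul_lt_top (by simp) (lintegral_enorm_sq_L2_lt_top f))

theorem exists_isKernelOp [SFinite (volume : Measure X)] (hk : IsL2Kernel k C) :
    ∃ A : L2 X →L[ℂ] L2 Y, IsKernelOp k A := by
  let A : L2 X →ₗ[ℂ] L2 Y :=
    { toFun := fun f => (hk.memLp_integral f).toLp _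
      map_add' := fun f g => by
        apply Lp.ext
        filter_upwards [(hk.memLp_integral (f + g)).coeFn_toLp, (hk.memLp_integral f).coeFn_toLp,
          (hk.memLp_integral g).coeFn_toLp, hk.ae_integrable f, hk.ae_integrable g,
          Lp.coeFn_add ((hk.memLp_integral f).toLp _) ((hk.memLp_integral g).toLp _)]
          with z hfg hf hg hfi hgi hadd
        rw [hfg, hadd, Pi.add_apply, hf, hg, ← integral_add hfi hgi]
        refine integral_congr_ae ?_
        filter_upwards [Lp.coeFn_add f g] with x hx
        rw [hx, Pi.add_apply, mul_add]
      map_smul' := fun c f => by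
        apply Lp.ext
        filter_upwards [(hk.memLp_integral (c • f)).coeFn_toLp, (hk.memLp_integral f).coeFn_toLp,
          Lp.coeFn_smul c ((hk.memLp_integral f).toLp _)] with z hcf hf hsmul
        rw [RingHom.id_apply, hcf, hsmul, Pi.smul_apply, hf, smul_eq_mul, ← integral_const_mul]
        refine integral_congr_ae ?_
        filter_upwards [Lp.coeFn_smul c f] with x hx
        rw [hx, Pi.smul_apply, smul_eq_mul, mul_left_comm] }
  refine ⟨A.mkContinuous C fun f => norm_Lp_two_le_mul ?_, fun f => ?_⟩
  · refine (lintegral_congr_ae ?_).trans_le (hk.lintegral_enorm_sq_le (measurable_L2 f))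
    filter_upwards [(hk.memLp_integral f).coeFn_toLp] with z hz
    simp only [A, LinearMap.coe_mk, AddHom.coe_mk, hz]
  · filter_upwards [(hk.memLp_integral f).coeFn_toLp, hk.ae_integrable f] with z hz hint
    exact ⟨hint, hz⟩

theorem integral_mul_comm [SFinite (volume : Measure X)] [SFinite (volume : Measure Y)]
    (hk : IsL2Kernel k C) {f : X → ℂ} (hf : Measurable f) (hf2 : MemLp f 2)
    {g : Y → ℂ} (hg : Measurable g) (hg2 : MemLp g 2) :
    ∫ y, g y * ∫ x, (((k y x).toReal : ℝ) : ℂ) * f x =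
      ∫ x, (∫ y, g y * ((k y x).toReal : ℂ)) * f x := by
  refine integral_mul_integral_kernel_mul hk.measurable hf hg (lt_top_iff_ne_top.2 fun htop => ?_)
  have hcs := sq_lintegral_le_of_sq_le_mul (μ := (volume : Measure Y))
    (f := fun y => ‖g y‖ₑ * ∫⁻ x, k y x * ‖f x‖ₑ) (hg.enorm.pow_const 2).aemeasurable
    ((measurable_lintegral_mul hk.measurable hf.enorm).pow_const 2).aemeasurable
    (.of_forall fun y => (mul_pow _ _ _).le)
  rw [memLp_two_iff_lintegral_enorm_sq_lt_top hf.aestronglyMeasurable] at hf2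
  rw [memLp_two_iff_lintegral_enorm_sq_lt_top hg.aestronglyMeasurable] at hg2
  rw [htop] at hcs
  exact (hcs.trans_lt (ENNReal.mul_lt_top hg2 (hk.lintegral_sq_lt_top hf.enorm hf2))).ne
    (by simp)

end IsL2Kernel

theorem IsIntegralOperator.unique {K : Y → X → ℝ} {A B : L2 X →L[ℂ] L2 Y}
    (hA : IsIntegralOperator K A) (hB : IsIntegralOperator K B) : A = B := by
  ext1 f
  apply Lp.ext
  filter_upwards [hA f, hB f] with z hAz hBz
  rw [hAz.2, hBz.2]

theorem sum_enorm_sq_integral_orthonormal_le {κ : X → ℝ≥0∞} (hκ : Measurable κ) {ι : Type*}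
    [Fintype ι] {v : ι → L2 X} (hv : Orthonormal ℂ v) :
    ∑ i, ‖∫ x, ((κ x).toReal : ℂ) * v i x‖ₑ ^ 2 ≤ ∫⁻ x, κ x ^ 2 := by
  have hle : ∫⁻ x, ‖((κ x).toReal : ℂ)‖ₑ ^ 2 ≤ ∫⁻ x, κ x ^ 2 := by
    gcongr with x
    simpa using enorm_toReal_mul_le (κ x) 1
  rcases (le_top : ∫⁻ x, κ x ^ 2 ≤ ∞).eq_or_lt with htop | hfin
  · simp [htop]
  have hmem : MemLp (fun x => ((κ x).toReal : ℂ)) 2 (volume : Measure X) :=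
    (memLp_two_iff_lintegral_enorm_sq_lt_top (Complex.measurable_ofReal.comp
      hκ.ennreal_toReal).aestronglyMeasurable).2 (hle.trans_lt hfin)
  have hinner (i : ι) :
      ‖∫ x, ((κ x).toReal : ℂ) * v i x‖ = ‖inner ℂ (v i) (hmem.toLp _)‖ := by
    rw [norm_inner_symm, L2.inner_def]
    congr 1
    refine integral_congr_ae ?_
    filter_upwards [hmem.coeFn_toLp] with x hx
    rw [hx, RCLike.inner_apply, Complex.conj_ofReal, mul_comm]
  calc ∑ i, ‖∫ x, ((κ x).toReal : ℂ) * v i x‖ₑ ^ 2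
      = ENNReal.ofReal (∑ i, ‖inner ℂ (v i) (hmem.toLp _)‖ ^ 2) := by
        rw [ENNReal.ofReal_sum_of_nonneg fun i _ => by positivity]
        refine Finset.sum_congr rfl fun i _ => ?_
        rw [← hinner, ENNReal.ofReal_pow (norm_nonneg _), ofReal_norm]
    _ ≤ ENNReal.ofReal (‖hmem.toLp _‖ ^ 2) :=
        ENNReal.ofReal_le_ofReal (hv.sum_inner_products_le (hmem.toLp _) (s := Finset.univ))
    _ = ∫⁻ x, ‖((κ x).toReal : ℂ)‖ₑ ^ 2 := by
        rw [ofReal_norm_sq_Lp_two]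
        refine lintegral_congr_ae ?_
        filter_upwards [hmem.coeFn_toLp] with x hx
        rw [hx]
    _ ≤ ∫⁻ x, κ x ^ 2 := hle

namespace IsKernelOp

variable {k : Y → X → ℝ≥0∞} {C D : ℝ≥0} {A : L2 X →L[ℂ] L2 Y}

theorem opNorm_le (hA : IsKernelOp k A) (hk : IsL2Kernel k C) : ‖A‖ ≤ C := by
  refine A.opNorm_le_bound C.coe_nonneg fun f => norm_Lp_two_le_mul ?_
  refine (lintegral_congr_ae ?_).trans_le (hk.lintegral_enorm_sq_le (measurable_L2 f))
  filter_upwards [hA f] with z hz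
  rw [hz.2]

theorem add [SFinite (volume : Measure X)] {l : Y → X → ℝ≥0∞} {B : L2 X →L[ℂ] L2 Y}
    (hk : IsL2Kernel k C) (hl : IsL2Kernel l D) (hA : IsKernelOp k A) (hB : IsKernelOp l B) :
    IsKernelOp (fun z x => k z x + l z x) (A + B) := by
  intro f
  have hf := (measurable_L2 f).enorm
  filter_upwards [hA f, hB f, hk.ae_lintegral_lt_top hf (lintegral_enorm_sq_L2_lt_top f),
    hl.ae_lintegral_lt_top hf (lintegral_enorm_sq_L2_lt_top f), Lp.coeFn_add (A f) (B f)]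
    with z hAz hBz hkz hlz hadd
  have hsum : (fun x => (((k z x).toReal : ℝ) : ℂ) * f x + (((l z x).toReal : ℝ) : ℂ) * f x)
      =ᵐ[volume] fun x => (((k z x + l z x).toReal : ℝ) : ℂ) * f x := by
    filter_upwards [ae_lt_top (hk.measurable.of_uncurry_left.mul hf) hkz.ne,
      ae_lt_top (hl.measurable.of_uncurry_left.mul hf) hlz.ne] with x hkx hlx
    rcases eq_or_ne (f x) 0 with hfx | hfx
    · simp [hfx]
    have hfx' : ‖f x‖ₑ ≠ 0 := enorm_ne_zero.2 hfx
    rw [ENNReal.toReal_add (ENNReal.lt_top_of_mul_ne_top_left hkx.ne hfx').ne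
      (ENNReal.lt_top_of_mul_ne_top_left hlx.ne hfx').ne, Complex.ofReal_add, add_mul]
  refine ⟨(hAz.1.add hBz.1).congr hsum, ?_⟩
  rw [add_apply, hadd, Pi.add_apply, hAz.2, hBz.2, ← integral_congr_ae hsum,
    integral_add hAz.1 hBz.1]

theorem const_smul {c : ℝ} (hc : 0 ≤ c) (hA : IsKernelOp k A) :
    IsKernelOp (fun z x => ENNReal.ofReal c * k z x) ((c : ℂ) • A) := by
  intro f
  filter_upwards [hA f, Lp.coeFn_smul (c : ℂ) (A f)] with z hAz hsmul
  simp only [ENNReal.toReal_mul, ENNReal.toReal_ofReal hc, Complex.ofReal_mul, mul_assoc]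
  refine ⟨hAz.1.const_mul _, ?_⟩
  rw [smul_apply, hsmul, Pi.smul_apply, hAz.2, smul_eq_mul, integral_const_mul]

theorem comp [SFinite (volume : Measure X)] [SFinite (volume : Measure Y)]
    {k : Z → Y → ℝ≥0∞} {l : Y → X → ℝ≥0∞} {A : L2 Y →L[ℂ] L2 Z} {B : L2 X →L[ℂ] L2 Y}
    (hk : IsL2Kernel k C) (hl : IsL2Kernel l D) (hA : IsKernelOp k A) (hB : IsKernelOp l B) :
    IsKernelOp (fun z x => ∫⁻ y, k z y * l y x) (A ∘L B) := by
  intro f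
  have hf := measurable_L2 f
  filter_upwards [hA (B f), hk.ae_lintegral_lt_top (measurable_lintegral_mul hl.measurable hf.enorm)
    (hl.lintegral_sq_lt_top hf.enorm (lintegral_enorm_sq_L2_lt_top f))] with z hAz hfin
  have hkz : Measurable (k z) := hk.measurable.of_uncurry_left
  have hkzc : Measurable fun y => ((k z y).toReal : ℂ) :=
    Complex.measurable_ofReal.comp hkz.ennreal_toReal
  have hfin' : ∫⁻ y, ‖((k z y).toReal : ℂ)‖ₑ * ∫⁻ x, l y x * ‖f x‖ₑ < ∞ := by
    refine (lintegral_mono fun y => ?_).trans_lt hfin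
    gcongr
    simpa using enorm_toReal_mul_le (k z y) 1
  have hker := integral_toReal_mul_toReal_mul_ae_eq hl.measurable hf hkz hfin
  refine ⟨(integrable_integral_mul_kernel_mul hl.measurable hf hkzc hfin').congr hker, ?_⟩
  rw [ContinuousLinearMap.comp_apply, hAz.2, ← integral_congr_ae hker,
    ← integral_mul_integral_kernel_mul hl.measurable hf hkzc hfin']
  refine integral_congr_ae ?_
  filter_upwards [hB f] with y hy
  rw [hy.2]

theorem adjoint_eq [SFinite (volume : Measure X)] [SFinite (volume : Measure Y)]
    {B : L2 Y →L[ℂ] L2 X} (hk : IsL2Kernel k C)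
    (hA : IsKernelOp k A) (hB : IsKernelOp (fun x y => k y x) B) :
    ContinuousLinearMap.adjoint A = B := by
  symm
  rw [ContinuousLinearMap.eq_adjoint_iff]
  intro g f
  rw [L2.inner_def, L2.inner_def]
  calc ∫ x, inner ℂ (B g x) (f x)
      = ∫ x, (∫ y, conj (g y) * ((k y x).toReal : ℂ)) * f x := by
        refine integral_congr_ae ?_
        filter_upwards [hB g] with x hx
        rw [hx.2, RCLike.inner_apply, ← integral_conj]
        simp [mul_comm]
    _ = ∫ y, conj (g y) * ∫ x, (((k y x).toReal : ℝ) : ℂ) * f x :=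
        (hk.integral_mul_comm (measurable_L2 f) (Lp.memLp f)
          (Complex.continuous_conj.measurable.comp (measurable_L2 g)) (Lp.memLp g).star).symm
    _ = ∫ y, inner ℂ (g y) (A f y) := by
        refine integral_congr_ae ?_
        filter_upwards [hA f] with y hy
        rw [hy.2, RCLike.inner_apply, mul_comm]

theorem sum_norm_sq_le (hk : Measurable (Function.uncurry k)) (hA : IsKernelOp k A) {S : ℝ}
    (hS : 0 ≤ S) (hkS : ∫⁻ z, ∫⁻ x, k z x ^ 2 ≤ ENNReal.ofReal S) {ι : Type*} [Fintype ι]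
    {v : ι → L2 X} (hv : Orthonormal ℂ v) : ∑ i, ‖A (v i)‖ ^ 2 ≤ S := by
  have hAv : ∀ᵐ z, ∀ i, A (v i) z = ∫ x, (((k z x).toReal : ℝ) : ℂ) * v i x :=
    ae_all_iff.2 fun i => (hA (v i)).mono fun z hz => hz.2
  rw [← ENNReal.ofReal_le_ofReal_iff hS, ENNReal.ofReal_sum_of_nonneg fun i _ => by positivity]
  simp_rw [ofReal_norm_sq_Lp_two]
  rw [← lintegral_finsetSum _ fun i _ => (measurable_L2 _).enorm.pow_const 2]
  refine (lintegral_mono_ae ?_).trans hkS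
  filter_upwards [hAv] with z hz
  simp_rw [hz]
  exact sum_enorm_sq_integral_orthonormal_le hk.of_uncurry_left hv

end IsKernelOp

end Kernels

/-! ### Gaussian kernels -/

section GaussKernel

open Module (finrank)
open Real (exp)

variable {V : Type*} [NormedAddCommGroup V] [InnerProductSpace ℝ V]

/-- The symmetric Gaussian kernel `c exp(-α (|u|² + |v|²) + 2 β u·v)`. -/
noncomputable def gaussKernel (c α β : ℝ) (u v : V) : ℝ :=
  c * exp (-α * (‖u‖ ^ 2 + ‖v‖ ^ 2) + 2 * β * inner ℝ u v)

theorem gaussKernel_comm (c α β : ℝ) (u v : V) : gaussKernel c α β u v = gaussKernel c α β v u := by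
  simp only [gaussKernel, real_inner_comm u v, add_comm (‖u‖ ^ 2)]

theorem gaussKernel_nonneg {c : ℝ} (hc : 0 ≤ c) (α β : ℝ) (u v : V) : 0 ≤ gaussKernel c α β u v :=
  mul_nonneg hc (Real.exp_pos _).le

theorem gaussKernel_mul_gaussKernel (c₁ α₁ β₁ c₂ α₂ β₂ : ℝ) (u v : V) :
    gaussKernel c₁ α₁ β₁ u v * gaussKernel c₂ α₂ β₂ u v =
      gaussKernel (c₁ * c₂) (α₁ + α₂) (β₁ + β₂) u v := by
  rw [gaussKernel, gaussKernel, gaussKernel, mul_mul_mul_comm, ← Real.exp_add]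
  ring_nf

theorem continuous_gaussKernel (c α β : ℝ) :
    Continuous (Function.uncurry (gaussKernel c α β : V → V → ℝ)) := by
  unfold gaussKernel
  fun_prop

variable [FiniteDimensional ℝ V] [MeasurableSpace V] [BorelSpace V]

theorem measurable_ofReal_gaussKernel (c α β : ℝ) :
    Measurable (Function.uncurry fun u v : V => ENNReal.ofReal (gaussKernel c α β u v)) :=
  (continuous_gaussKernel c α β).measurable.ennreal_ofReal

theorem lintegral_exp_neg_mul_sq_norm {b : ℝ} (hb : 0 < b) :
    ∫⁻ v : V, ENNReal.ofReal (exp (-b * ‖v‖ ^ 2)) =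
      ENNReal.ofReal ((Real.pi / b) ^ (finrank ℝ V / 2 : ℝ)) := by
  have hint : Integrable fun v : V => exp (-b * ‖v‖ ^ 2) := by
    refine (GaussianFourier.integrable_cexp_neg_mul_sq_norm_add (V := V) (b := (b : ℂ))
      (by simpa using hb) 0 0).norm.congr (.of_forall fun v => ?_)
    simp only [Complex.norm_exp, zero_mul, add_zero]
    norm_cast
  rw [← ofReal_integral_eq_lintegral_ofReal hint (.of_forall fun v => (Real.exp_pos _).le),
    GaussianFourier.integral_rexp_neg_mul_sq_norm hb]

theorem lintegral_exp_neg_mul_sq_norm_add_inner {b : ℝ} (hb : 0 < b) (w : V) :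
    ∫⁻ v : V, ENNReal.ofReal (exp (-b * ‖v‖ ^ 2 + 2 * inner ℝ w v)) =
      ENNReal.ofReal ((Real.pi / b) ^ (finrank ℝ V / 2 : ℝ) * exp (‖w‖ ^ 2 / b)) := by
  have complete_square (v : V) : ENNReal.ofReal (exp (-b * ‖v‖ ^ 2 + 2 * inner ℝ w v)) =
      ENNReal.ofReal (exp (‖w‖ ^ 2 / b)) * ENNReal.ofReal (exp (-b * ‖v - b⁻¹ • w‖ ^ 2)) := by
    rw [← ENNReal.ofReal_mul (Real.exp_pos _).le, ← Real.exp_add, norm_sub_sq_real, norm_smul,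
      inner_smul_right, real_inner_comm, Real.norm_eq_abs, mul_pow, sq_abs]
    congr 2
    field_simp
    ring
  simp_rw [complete_square]
  rw [lintegral_const_mul' _ _ ENNReal.ofReal_ne_top,
    lintegral_sub_right_eq_self (fun v : V => ENNReal.ofReal (exp (-b * ‖v‖ ^ 2))),
    lintegral_exp_neg_mul_sq_norm hb, ← ENNReal.ofReal_mul (Real.exp_pos _).le, mul_comm]

theorem lintegral_gaussKernel {c α : ℝ} (hc : 0 ≤ c) (hα : 0 < α) (β : ℝ) (u : V) :
    ∫⁻ v, ENNReal.ofReal (gaussKernel c α β u v) =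
      ENNReal.ofReal (c * (Real.pi / α) ^ (finrank ℝ V / 2 : ℝ) *
        exp (-((α ^ 2 - β ^ 2) / α) * ‖u‖ ^ 2)) := by
  have factor (v : V) : ENNReal.ofReal (gaussKernel c α β u v) =
      ENNReal.ofReal (c * exp (-α * ‖u‖ ^ 2)) *
        ENNReal.ofReal (exp (-α * ‖v‖ ^ 2 + 2 * inner ℝ (β • u) v)) := by
    rw [← ENNReal.ofReal_mul (by positivity), gaussKernel, mul_assoc c, ← Real.exp_add,
      real_inner_smul_left]
    ring_nf
  have exponent : exp (-((α ^ 2 - β ^ 2) / α) * ‖u‖ ^ 2) =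
      exp (-α * ‖u‖ ^ 2) * exp (‖β • u‖ ^ 2 / α) := by
    rw [← Real.exp_add, norm_smul, Real.norm_eq_abs, mul_pow, sq_abs]
    congr 1
    field_simp
    ring
  simp_rw [factor]
  rw [lintegral_const_mul' _ _ ENNReal.ofReal_ne_top, lintegral_exp_neg_mul_sq_norm_add_inner hα,
    ← ENNReal.ofReal_mul (by positivity), exponent]
  ring_nf

theorem lintegral_gaussKernel_le {c α β : ℝ} (hc : 0 ≤ c) (hα : 0 < α) (hβ : β ^ 2 ≤ α ^ 2)
    (u : V) : ∫⁻ v, ENNReal.ofReal (gaussKernel c α β u v) ≤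
      ENNReal.ofReal (c * (Real.pi / α) ^ (finrank ℝ V / 2 : ℝ)) := by
  rw [lintegral_gaussKernel hc hα, neg_mul]
  have hexp : 0 ≤ (α ^ 2 - β ^ 2) / α * ‖u‖ ^ 2 :=
    mul_nonneg (div_nonneg (sub_nonneg.2 hβ) hα.le) (sq_nonneg _)
  exact ENNReal.ofReal_le_ofReal <| mul_le_of_le_one_right (by positivity)
    (Real.exp_le_one_iff.2 (neg_nonpos.2 hexp))

theorem lintegral_gaussKernel_mul {c₁ α₁ β₁ c₂ α₂ β₂ c α β : ℝ} (hc₁ : 0 ≤ c₁) (hc₂ : 0 ≤ c₂)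
    (hα : 0 < α₁ + α₂) (hα₁ : α₁ - β₁ ^ 2 / (α₁ + α₂) = α) (hα₂ : α₂ - β₂ ^ 2 / (α₁ + α₂) = α)
    (hβ : β₁ * β₂ / (α₁ + α₂) = β)
    (hc : c₁ * c₂ * (Real.pi / (α₁ + α₂)) ^ (finrank ℝ V / 2 : ℝ) = c) (u w : V) :
    ∫⁻ v, ENNReal.ofReal (gaussKernel c₁ α₁ β₁ u v) * ENNReal.ofReal (gaussKernel c₂ α₂ β₂ v w) =
      ENNReal.ofReal (gaussKernel c α β u w) := by
  have factor (v : V) : ENNReal.ofReal (gaussKernel c₁ α₁ β₁ u v) *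
      ENNReal.ofReal (gaussKernel c₂ α₂ β₂ v w) =
      ENNReal.ofReal (c₁ * c₂ * exp (-α₁ * ‖u‖ ^ 2 - α₂ * ‖w‖ ^ 2)) *
        ENNReal.ofReal (exp (-(α₁ + α₂) * ‖v‖ ^ 2 + 2 * inner ℝ (β₁ • u + β₂ • w) v)) := by
    rw [← ENNReal.ofReal_mul (gaussKernel_nonneg hc₁ _ _ _ _), ← ENNReal.ofReal_mul (by positivity),
      gaussKernel, gaussKernel, mul_mul_mul_comm, ← Real.exp_add, mul_assoc (c₁ * c₂),
      ← Real.exp_add, inner_add_left, real_inner_smul_left, real_inner_smul_left,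
      real_inner_comm w v]
    ring_nf
  have exponent : exp (-α * (‖u‖ ^ 2 + ‖w‖ ^ 2) + 2 * β * inner ℝ u w) =
      exp (-α₁ * ‖u‖ ^ 2 - α₂ * ‖w‖ ^ 2) * exp (‖β₁ • u + β₂ • w‖ ^ 2 / (α₁ + α₂)) := by
    rw [← Real.exp_add, norm_add_sq_real, norm_smul, norm_smul, real_inner_smul_left,
      real_inner_smul_right, Real.norm_eq_abs, Real.norm_eq_abs, mul_pow, mul_pow, sq_abs, sq_abs,
      ← hβ]
    congr 1
    linear_combination ‖u‖ ^ 2 * hα₁ + ‖w‖ ^ 2 * hα₂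
  simp_rw [factor]
  rw [lintegral_const_mul' _ _ ENNReal.ofReal_ne_top, lintegral_exp_neg_mul_sq_norm_add_inner hα,
    ← ENNReal.ofReal_mul (by positivity), gaussKernel, exponent, ← hc]
  ring_nf

end GaussKernel

section Mehler

open Module (finrank)
open Real (exp sinh cosh)
open scoped NNReal

variable {V : Type*} [NormedAddCommGroup V] [InnerProductSpace ℝ V]

/-- The heat kernel of `-½ Δ` on the Euclidean space `V`. -/
noncomputable def freeHeatKernel (t : ℝ) (u v : V) : ℝ :=
  gaussKernel ((1 / (2 * Real.pi * t)) ^ (finrank ℝ V / 2 : ℝ)) (1 / (2 * t)) (1 / (2 * t)) u v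

/-- The Mehler kernel: the heat kernel at time `s / κ` of the oscillator `½ (-Δ + κ² |u|²)` on the
Euclidean space `V`. -/
noncomputable def mehlerKernel (κ s : ℝ) (u v : V) : ℝ :=
  gaussKernel ((κ / (2 * Real.pi * sinh s)) ^ (finrank ℝ V / 2 : ℝ))
    (κ / 2 * (cosh s / sinh s)) (κ / (2 * sinh s)) u v

theorem freeHeatKernel_comm (t : ℝ) (u v : V) : freeHeatKernel t u v = freeHeatKernel t v u :=
  gaussKernel_comm _ _ _ _ _

theorem freeHeatKernel_nonneg {t : ℝ} (ht : 0 < t) (u v : V) : 0 ≤ freeHeatKernel t u v :=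
  gaussKernel_nonneg (by positivity) _ _ _ _

theorem freeHeatKernel_eq (t : ℝ) (u v : V) :
    freeHeatKernel t u v = (1 / (2 * Real.pi * t)) ^ (finrank ℝ V / 2 : ℝ) *
      exp (-(1 / (2 * t)) * ‖u - v‖ ^ 2) := by
  rw [freeHeatKernel, gaussKernel, norm_sub_sq_real]
  ring_nf

theorem freeHeatKernel_le {t : ℝ} (ht : 0 < t) (u v : V) :
    freeHeatKernel t u v ≤ (1 / (2 * Real.pi * t)) ^ (finrank ℝ V / 2 : ℝ) := by
  rw [freeHeatKernel_eq, neg_mul]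
  have hexp : 0 ≤ 1 / (2 * t) * ‖u - v‖ ^ 2 := by positivity
  exact mul_le_of_le_one_right (by positivity) (Real.exp_le_one_iff.2 (neg_nonpos.2 hexp))

theorem mehlerKernel_comm (κ s : ℝ) (u v : V) : mehlerKernel κ s u v = mehlerKernel κ s v u :=
  gaussKernel_comm _ _ _ _ _

theorem mehlerKernel_nonneg {κ s : ℝ} (hκ : 0 < κ) (hs : 0 < s) (u v : V) :
    0 ≤ mehlerKernel κ s u v := by
  have := Real.sinh_pos_iff.2 hs
  exact gaussKernel_nonneg (by positivity) _ _ _ _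

theorem mehlerKernel_sq {κ s : ℝ} (hκ : 0 < κ) (hs : 0 < s) (u v : V) :
    mehlerKernel κ s u v ^ 2 = gaussKernel
      (((κ / (2 * Real.pi * sinh s)) ^ 2) ^ (finrank ℝ V / 2 : ℝ))
      (κ * (cosh s / sinh s)) (κ / sinh s) u v := by
  have := Real.sinh_pos_iff.2 hs
  rw [sq, mehlerKernel, gaussKernel_mul_gaussKernel, ← Real.mul_rpow (by positivity)
    (by positivity), ← sq]
  congr 1 <;> ring

theorem gaussKernel_eq_mul_mehlerKernel {α β : ℝ} (hβ : 0 < β) (hβα : β < α) (c : ℝ) (u v : V) :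
    gaussKernel c α β u v = c * (Real.pi / β) ^ (finrank ℝ V / 2 : ℝ) *
      mehlerKernel (2 * √(α ^ 2 - β ^ 2)) (Real.arsinh (√(α ^ 2 - β ^ 2) / β)) u v := by
  set r := √(α ^ 2 - β ^ 2)
  have hr_sq : 0 < α ^ 2 - β ^ 2 := by nlinarith
  have hr : 0 < r := Real.sqrt_pos.2 hr_sq
  have hcosh : cosh (Real.arsinh (r / β)) = α / β := by
    rw [Real.cosh_arsinh, Real.sqrt_eq_iff_mul_self_eq_of_pos (div_pos (hβ.trans hβα) hβ),
      div_pow, Real.sq_sqrt hr_sq.le]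
    field_simp
    ring
  have hprefactor : (Real.pi / β) ^ (finrank ℝ V / 2 : ℝ) *
      (2 * r / (2 * Real.pi * (r / β))) ^ (finrank ℝ V / 2 : ℝ) = 1 := by
    rw [← Real.mul_rpow (by positivity) (by positivity)]
    convert Real.one_rpow _ using 2
    field_simp
  have hα_eq : 2 * r / 2 * (α / β / (r / β)) = α := by field_simp
  have hβ_eq : 2 * r / (2 * (r / β)) = β := by field_simp
  rw [mehlerKernel, Real.sinh_arsinh, hcosh, hα_eq, hβ_eq, gaussKernel, gaussKernel]
  linear_combination (-c * exp (-α * (‖u‖ ^ 2 + ‖v‖ ^ 2) + 2 * β * inner ℝ u v)) * hprefactor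

variable [FiniteDimensional ℝ V] [MeasurableSpace V] [BorelSpace V]

theorem measurable_ofReal_freeHeatKernel (t : ℝ) :
    Measurable (Function.uncurry fun u v : V => ENNReal.ofReal (freeHeatKernel t u v)) :=
  measurable_ofReal_gaussKernel _ _ _

theorem measurable_ofReal_mehlerKernel (κ s : ℝ) :
    Measurable (Function.uncurry fun u v : V => ENNReal.ofReal (mehlerKernel κ s u v)) :=
  measurable_ofReal_gaussKernel _ _ _

theorem lintegral_freeHeatKernel {t : ℝ} (ht : 0 < t) (u : V) :
    ∫⁻ v, ENNReal.ofReal (freeHeatKernel t u v) = 1 := by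
  have hmass : 1 / (2 * Real.pi * t) * (Real.pi / (1 / (2 * t))) = 1 := by field_simp
  unfold freeHeatKernel
  rw [lintegral_gaussKernel (by positivity) (by positivity),
    ← Real.mul_rpow (by positivity) (by positivity), hmass]
  simp

theorem lintegral_freeHeatKernel_mul {s t : ℝ} (hs : 0 < s) (ht : 0 < t) (u w : V) :
    ∫⁻ v, ENNReal.ofReal (freeHeatKernel s u v) * ENNReal.ofReal (freeHeatKernel t v w) =
      ENNReal.ofReal (freeHeatKernel (s + t) u w) := by
  refine lintegral_gaussKernel_mul (by positivity) (by positivity) (by positivity) ?_ ?_ ?_ ?_ u w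
  · field_simp
    ring
  · field_simp
    ring
  · field_simp
    ring
  · rw [← Real.mul_rpow (by positivity) (by positivity),
      ← Real.mul_rpow (by positivity) (by positivity)]
    congr 1
    field_simp
    ring

theorem lintegral_mehlerKernel_mul {κ s t : ℝ} (hκ : 0 < κ) (hs : 0 < s) (ht : 0 < t) (u w : V) :
    ∫⁻ v, ENNReal.ofReal (mehlerKernel κ s u v) * ENNReal.ofReal (mehlerKernel κ t v w) =
      ENNReal.ofReal (mehlerKernel κ (s + t) u w) := by
  have := Real.sinh_pos_iff.2 hs
  have := Real.sinh_pos_iff.2 ht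
  have : 0 < sinh s * cosh t + cosh s * sinh t := by positivity
  have hα : κ / 2 * (cosh s / sinh s) + κ / 2 * (cosh t / sinh t) =
      κ * (sinh s * cosh t + cosh s * sinh t) / (2 * sinh s * sinh t) := by
    field_simp
    ring
  unfold mehlerKernel
  rw [Real.sinh_add, Real.cosh_add]
  refine lintegral_gaussKernel_mul (by positivity) (by positivity) (by positivity) ?_ ?_ ?_ ?_ u w
  all_goals rw [hα]
  · field_simp
    linear_combination sinh t * Real.cosh_sq s
  · field_simp
    linear_combination sinh s * Real.cosh_sq t
  · field_simp
  · rw [← Real.mul_rpow (by positivity) (by positivity),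
      ← Real.mul_rpow (by positivity) (by positivity)]
    congr 1
    field_simp

theorem lintegral_mehlerKernel_le {κ s : ℝ} (hκ : 0 < κ) (hs : 0 < s) (u : V) :
    ∫⁻ v, ENNReal.ofReal (mehlerKernel κ s u v) ≤
      ENNReal.ofReal ((1 / cosh s) ^ (finrank ℝ V / 2 : ℝ)) := by
  have := Real.sinh_pos_iff.2 hs
  have := Real.cosh_pos s
  have hmass : κ / (2 * Real.pi * sinh s) * (Real.pi / (κ / 2 * (cosh s / sinh s))) =
      1 / cosh s := by
    field_simp
  rw [← hmass, Real.mul_rpow (by positivity) (by positivity)]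
  refine lintegral_gaussKernel_le (by positivity) (by positivity) ?_ u
  have hle : κ / (2 * sinh s) ≤ κ / 2 * (cosh s / sinh s) := by
    rw [← div_div, ← mul_div_assoc]
    gcongr
    exact le_mul_of_one_le_right (by positivity) (Real.one_le_cosh s)
  gcongr

theorem lintegral_mehlerKernel_sq {κ s : ℝ} (hκ : 0 < κ) (hs : 0 < s) :
    ∫⁻ u : V, ∫⁻ v : V, ENNReal.ofReal (mehlerKernel κ s u v) ^ 2 =
      ENNReal.ofReal ((1 / (4 * sinh s ^ 2)) ^ (finrank ℝ V / 2 : ℝ)) := by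
  have := Real.sinh_pos_iff.2 hs
  have := Real.cosh_pos s
  have hdecay : ((κ * (cosh s / sinh s)) ^ 2 - (κ / sinh s) ^ 2) / (κ * (cosh s / sinh s)) =
      κ * (sinh s / cosh s) := by
    field_simp
    linear_combination Real.cosh_sq s
  have hmass : (κ / (2 * Real.pi * sinh s)) ^ 2 * (Real.pi / (κ * (cosh s / sinh s))) *
      (Real.pi / (κ * (sinh s / cosh s))) = 1 / (4 * sinh s ^ 2) := by
    field_simp
    ring
  have inner_integral (u : V) : ∫⁻ v : V, ENNReal.ofReal (mehlerKernel κ s u v) ^ 2 =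
      ENNReal.ofReal (((κ / (2 * Real.pi * sinh s)) ^ 2) ^ (finrank ℝ V / 2 : ℝ) *
        (Real.pi / (κ * (cosh s / sinh s))) ^ (finrank ℝ V / 2 : ℝ)) *
        ENNReal.ofReal (exp (-(κ * (sinh s / cosh s)) * ‖u‖ ^ 2)) := by
    simp_rw [← ENNReal.ofReal_pow (mehlerKernel_nonneg hκ hs _ _), mehlerKernel_sq hκ hs]
    rw [lintegral_gaussKernel (by positivity) (by positivity), hdecay,
      ENNReal.ofReal_mul (by positivity)]
  simp_rw [inner_integral]
  rw [lintegral_const_mul' _ _ ENNReal.ofReal_ne_top,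
    lintegral_exp_neg_mul_sq_norm (by positivity), ← ENNReal.ofReal_mul (by positivity),
    ← Real.mul_rpow (by positivity) (by positivity), ← Real.mul_rpow (by positivity)
    (by positivity), hmass]

theorem isL2Kernel_mehlerKernel {κ s : ℝ} (hκ : 0 < κ) (hs : 0 < s) :
    IsL2Kernel (fun u v : V => ENNReal.ofReal (mehlerKernel κ s u v)) 1 := by
  have hmass (u : V) : ∫⁻ v, ENNReal.ofReal (mehlerKernel κ s u v) ≤ (1 : ℝ≥0) := by
    refine (lintegral_mehlerKernel_le hκ hs u).trans ?_
    rw [ENNReal.coe_one, ENNReal.ofReal_le_one]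
    exact Real.rpow_le_one (by positivity)
      ((div_le_one (Real.cosh_pos s)).2 (Real.one_le_cosh s)) (by positivity)
  refine isL2Kernel_of_lintegral_le (C₁ := 1) (C₂ := 1) (measurable_ofReal_mehlerKernel κ s) hmass
    (fun v => ?_) (by simp)
  simp_rw [mehlerKernel_comm κ s _ v]
  exact hmass v

end Mehler

/-! ### The heat kernel of the free Hamiltonian -/

section HeatKernel

open scoped ENNReal
open Real (exp sinh cosh)

/-- The kernel of `exp (-t H₀)`: free motion in the first variable, and a harmonic oscillator with
zero ground state energy in the second. -/
noncomputable def heatKernel (ω t : ℝ) (z w : Config) : ℝ :=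
  freeHeatKernel t z.1 w.1 * (exp (ω * t) * mehlerKernel ω (ω * t) z.2 w.2)

theorem finrank_plane_div_two : (Module.finrank ℝ Plane / 2 : ℝ) = 1 := by
  simp

theorem heatKernel_comm (ω t : ℝ) (z w : Config) : heatKernel ω t z w = heatKernel ω t w z := by
  rw [heatKernel, heatKernel, mehlerKernel_comm, freeHeatKernel_comm]

theorem heatKernel_nonneg {ω t : ℝ} (hω : 0 < ω) (ht : 0 < t) (z w : Config) :
    0 ≤ heatKernel ω t z w :=
  mul_nonneg (freeHeatKernel_nonneg ht _ _)
    (mul_nonneg (Real.exp_pos _).le (mehlerKernel_nonneg hω (mul_pos hω ht) _ _))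

theorem measurable_heatKernel (ω : ℝ) :
    Measurable fun q : ℝ × Config × Config => heatKernel ω q.1 q.2.1 q.2.2 := by
  have : Measurable fun q : ℝ × Config × Config => sinh (ω * q.1) :=
    Real.measurable_sinh.comp (by fun_prop)
  have : Measurable fun q : ℝ × Config × Config => cosh (ω * q.1) :=
    Real.measurable_cosh.comp (by fun_prop)
  unfold heatKernel freeHeatKernel mehlerKernel gaussKernel
  simp only [finrank_plane_div_two, Real.rpow_one]
  fun_prop

theorem measurable_ofReal_heatKernel (ω t : ℝ) :
    Measurable (Function.uncurry fun z w : Config => ENNReal.ofReal (heatKernel ω t z w)) :=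
  ((measurable_heatKernel ω).comp (measurable_const.prodMk measurable_id)).ennreal_ofReal

theorem ofReal_heatKernel {ω t : ℝ} (ht : 0 < t) (z w : Config) :
    ENNReal.ofReal (heatKernel ω t z w) = ENNReal.ofReal (freeHeatKernel t z.1 w.1) *
      (ENNReal.ofReal (exp (ω * t)) * ENNReal.ofReal (mehlerKernel ω (ω * t) z.2 w.2)) := by
  rw [heatKernel, ENNReal.ofReal_mul (freeHeatKernel_nonneg ht _ _),
    ENNReal.ofReal_mul (Real.exp_pos _).le]

theorem lintegral_heatKernel_mul {ω s t : ℝ} (hω : 0 < ω) (hs : 0 < s) (ht : 0 < t)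
    (z w : Config) :
    ∫⁻ y, ENNReal.ofReal (heatKernel ω s z y) * ENNReal.ofReal (heatKernel ω t y w) =
      ENNReal.ofReal (heatKernel ω (s + t) z w) := by
  have separate (y : Config) :
      ENNReal.ofReal (heatKernel ω s z y) * ENNReal.ofReal (heatKernel ω t y w) =
      (ENNReal.ofReal (freeHeatKernel s z.1 y.1) * ENNReal.ofReal (freeHeatKernel t y.1 w.1)) *
      (ENNReal.ofReal (exp (ω * (s + t))) * (ENNReal.ofReal (mehlerKernel ω (ω * s) z.2 y.2) *
        ENNReal.ofReal (mehlerKernel ω (ω * t) y.2 w.2))) := by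
    rw [ofReal_heatKernel hs, ofReal_heatKernel ht, mul_add, Real.exp_add,
      ENNReal.ofReal_mul (Real.exp_pos _).le]
    ring
  have hfree : Measurable fun x =>
      ENNReal.ofReal (freeHeatKernel s z.1 x) * ENNReal.ofReal (freeHeatKernel t x w.1) :=
    (measurable_ofReal_freeHeatKernel s).of_uncurry_left.mul
      (measurable_ofReal_freeHeatKernel t).of_uncurry_right
  have hmehler : Measurable fun y => ENNReal.ofReal (exp (ω * (s + t))) *
      (ENNReal.ofReal (mehlerKernel ω (ω * s) z.2 y) *
        ENNReal.ofReal (mehlerKernel ω (ω * t) y w.2)) :=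
    ((measurable_ofReal_mehlerKernel ω _).of_uncurry_left.mul
      (measurable_ofReal_mehlerKernel ω _).of_uncurry_right).const_mul _
  simp_rw [separate]
  rw [Measure.volume_eq_prod, lintegral_prod_mul hfree.aemeasurable hmehler.aemeasurable,
    lintegral_freeHeatKernel_mul hs ht, lintegral_const_mul' _ _ ENNReal.ofReal_ne_top,
    lintegral_mehlerKernel_mul hω (mul_pos hω hs) (mul_pos hω ht), ← mul_add,
    ofReal_heatKernel (add_pos hs ht)]

theorem exp_div_cosh_le (x : ℝ) : exp x / cosh x ≤ 2 := by
  rw [div_le_iff₀ (Real.cosh_pos x), Real.cosh_eq]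
  linarith [Real.exp_pos (-x)]

theorem lintegral_exp_mul_mehlerKernel_le {ω t : ℝ} (hω : 0 < ω) (ht : 0 < t) (u : Plane) :
    ∫⁻ v, ENNReal.ofReal (exp (ω * t)) * ENNReal.ofReal (mehlerKernel ω (ω * t) u v) ≤ 2 := by
  have hmass := lintegral_mehlerKernel_le hω (mul_pos hω ht) u
  rw [finrank_plane_div_two, Real.rpow_one] at hmass
  rw [lintegral_const_mul' _ _ ENNReal.ofReal_ne_top]
  calc ENNReal.ofReal (exp (ω * t)) * ∫⁻ v, ENNReal.ofReal (mehlerKernel ω (ω * t) u v)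
      ≤ ENNReal.ofReal (exp (ω * t)) * ENNReal.ofReal (1 / cosh (ω * t)) := by gcongr
    _ = ENNReal.ofReal (exp (ω * t) / cosh (ω * t)) := by
        rw [← ENNReal.ofReal_mul (Real.exp_pos _).le, mul_one_div]
    _ ≤ ENNReal.ofReal 2 := ENNReal.ofReal_le_ofReal (exp_div_cosh_le _)
    _ = 2 := by norm_num

theorem lintegral_heatKernel_le {ω t : ℝ} (hω : 0 < ω) (ht : 0 < t) (z : Config) :
    ∫⁻ w, ENNReal.ofReal (heatKernel ω t z w) ≤ 2 := by
  simp_rw [ofReal_heatKernel ht]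
  rw [Measure.volume_eq_prod, lintegral_prod_mul
    ((measurable_ofReal_freeHeatKernel t).of_uncurry_left (x := z.1)).aemeasurable
    (((measurable_ofReal_mehlerKernel ω (ω * t)).of_uncurry_left (x := z.2)).const_mul
      (ENNReal.ofReal (exp (ω * t)))).aemeasurable, lintegral_freeHeatKernel ht, one_mul]
  exact lintegral_exp_mul_mehlerKernel_le hω ht _

theorem lintegral_heatKernel_diag_le {ω t : ℝ} (hω : 0 < ω) (ht : 0 < t) (z : Config) :
    ∫⁻ u : Plane, ENNReal.ofReal (heatKernel ω t z (u, u)) ≤ ENNReal.ofReal (1 / t) := by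
  have hfree (u : Plane) : freeHeatKernel t z.1 u ≤ 1 / (2 * Real.pi * t) := by
    simpa only [finrank_plane_div_two, Real.rpow_one] using freeHeatKernel_le ht z.1 u
  have hpi : 1 / (2 * Real.pi * t) * 2 ≤ 1 / t := by
    rw [div_mul_eq_mul_div, div_le_div_iff₀ (by positivity) ht]
    nlinarith [Real.pi_gt_three]
  calc ∫⁻ u : Plane, ENNReal.ofReal (heatKernel ω t z (u, u))
      ≤ ∫⁻ u : Plane, ENNReal.ofReal (1 / (2 * Real.pi * t)) *
        (ENNReal.ofReal (exp (ω * t)) * ENNReal.ofReal (mehlerKernel ω (ω * t) z.2 u)) := by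
        refine lintegral_mono fun u => ?_
        rw [ofReal_heatKernel ht]
        gcongr
        exact hfree u
    _ ≤ ENNReal.ofReal (1 / (2 * Real.pi * t)) * 2 := by
        rw [lintegral_const_mul' _ _ ENNReal.ofReal_ne_top]
        gcongr
        exact lintegral_exp_mul_mehlerKernel_le hω ht _
    _ = ENNReal.ofReal (1 / (2 * Real.pi * t) * 2) := by
        rw [ENNReal.ofReal_mul (by positivity), ENNReal.ofReal_ofNat]
    _ ≤ ENNReal.ofReal (1 / t) := ENNReal.ofReal_le_ofReal hpi

theorem heatKernel_diag_eq_gaussKernel (ω t : ℝ) (u v : Plane) :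
    heatKernel ω t (u, u) (v, v) =
      gaussKernel (1 / (2 * Real.pi * t) * (exp (ω * t) * (ω / (2 * Real.pi * sinh (ω * t)))))
        (1 / (2 * t) + ω / 2 * (cosh (ω * t) / sinh (ω * t)))
        (1 / (2 * t) + ω / (2 * sinh (ω * t))) u v := by
  simp only [heatKernel, freeHeatKernel, mehlerKernel, finrank_plane_div_two, Real.rpow_one]
  rw [mul_left_comm, gaussKernel_mul_gaussKernel, gaussKernel, gaussKernel]
  ring

theorem sq_le_diagRate_sq_sub_sq {ω t : ℝ} (hω : 0 < ω) (ht : 0 < t) :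
    (ω / 2) ^ 2 ≤ (1 / (2 * t) + ω / 2 * (cosh (ω * t) / sinh (ω * t))) ^ 2 -
      (1 / (2 * t) + ω / (2 * sinh (ω * t))) ^ 2 := by
  have hsinh := Real.sinh_pos_iff.2 (mul_pos hω ht)
  have hexpand : (1 / (2 * t) + ω / 2 * (cosh (ω * t) / sinh (ω * t))) ^ 2 -
      (1 / (2 * t) + ω / (2 * sinh (ω * t))) ^ 2 =
      (ω / 2) ^ 2 + ω / (2 * t * sinh (ω * t)) * (cosh (ω * t) - 1) := by
    have hcosh_sq := Real.cosh_sq (ω * t)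
    generalize sinh (ω * t) = S, cosh (ω * t) = C at hsinh hcosh_sq
    field_simp
    linear_combination (t ^ 2 * ω ^ 2) * hcosh_sq
  rw [hexpand]
  exact le_add_of_nonneg_right
    (mul_nonneg (by positivity) (sub_nonneg.2 (Real.one_le_cosh _)))

theorem exists_heatKernel_diag_eq_mul_mehlerKernel {ω t : ℝ} (hω : 0 < ω) (ht : 0 < t) :
    ∃ c κ s : ℝ, 0 ≤ c ∧ 0 < κ ∧ 0 < s ∧ c ≤ exp (ω * t) / t ∧ ω * t / 2 ≤ sinh s ∧
      ∀ u v : Plane, heatKernel ω t (u, u) (v, v) = c * mehlerKernel κ s u v := by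
  have hsinh := Real.sinh_pos_iff.2 (mul_pos hω ht)
  have hsinh_le : ω / sinh (ω * t) ≤ 1 / t := by
    rw [div_le_div_iff₀ hsinh ht, one_mul]
    exact Real.self_le_sinh_iff.2 (mul_pos hω ht).le
  set α : ℝ := 1 / (2 * t) + ω / 2 * (cosh (ω * t) / sinh (ω * t))
  set β : ℝ := 1 / (2 * t) + ω / (2 * sinh (ω * t)) with hβ
  have hβ_pos : 0 < β := by positivity
  have hβ_ge : 1 / (2 * t) ≤ β := le_add_of_nonneg_right (by positivity)
  have hβ_le : β ≤ 1 / t := by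
    calc β = (1 / t + ω / sinh (ω * t)) / 2 := by rw [hβ]; ring
      _ ≤ (1 / t + 1 / t) / 2 := by gcongr
      _ = 1 / t := by ring
  have hr_ge : ω / 2 ≤ √(α ^ 2 - β ^ 2) := Real.le_sqrt_of_sq_le (sq_le_diagRate_sq_sub_sq hω ht)
  have hr_pos : 0 < √(α ^ 2 - β ^ 2) := (half_pos hω).trans_le hr_ge
  have hβα : β < α := lt_of_pow_lt_pow_left₀ 2 (by positivity) (sub_pos.1 (Real.sqrt_pos.1 hr_pos))
  refine ⟨1 / (2 * Real.pi * t) * (exp (ω * t) * (ω / (2 * Real.pi * sinh (ω * t)))) *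
    (Real.pi / β), 2 * √(α ^ 2 - β ^ 2), Real.arsinh (√(α ^ 2 - β ^ 2) / β), by positivity,
    by positivity, Real.arsinh_pos_iff.2 (by positivity), ?_, ?_, fun u v => ?_⟩
  · calc 1 / (2 * Real.pi * t) * (exp (ω * t) * (ω / (2 * Real.pi * sinh (ω * t)))) *
          (Real.pi / β)
        = exp (ω * t) / (4 * Real.pi * t) * (ω / sinh (ω * t)) * (1 / β) := by
          field_simp
          ring
      _ ≤ exp (ω * t) / (4 * Real.pi * t) * (1 / t) * (1 / (1 / (2 * t))) := by gcongr
      _ = exp (ω * t) / t * (1 / (2 * Real.pi)) := by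
          field_simp
          ring
      _ ≤ exp (ω * t) / t := by
          refine mul_le_of_le_one_right (by positivity) ((div_le_one (by positivity)).2 ?_)
          linarith [Real.pi_gt_three]
  · rw [Real.sinh_arsinh]
    calc ω * t / 2 = ω / 2 / (1 / t) := by field_simp
      _ ≤ √(α ^ 2 - β ^ 2) / β := by gcongr
  · rw [heatKernel_diag_eq_gaussKernel, gaussKernel_eq_mul_mehlerKernel hβ_pos hβα,
      finrank_plane_div_two, Real.rpow_one]

end HeatKernel

/-! ### Superpositions of heat kernels in time -/

section TimeKernel

open scoped ENNReal NNReal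
open Real (exp)

attribute [local irreducible] heatKernel

/-- The kernel of `∫₀^∞ φ(t) exp(-t H₀) dt`. -/
noncomputable def timeKernel (ω : ℝ) (φ : ℝ → ℝ≥0∞) (z w : Config) : ℝ≥0∞ :=
  ∫⁻ t in Set.Ioi (0 : ℝ), φ t * ENNReal.ofReal (heatKernel ω t z w)

/-- The restriction of `timeKernel` to sources on the plane of coincidence. -/
noncomputable def diagKernel (ω : ℝ) (φ : ℝ → ℝ≥0∞) (z : Config) (u : Plane) : ℝ≥0∞ :=
  timeKernel ω φ z (u, u)

theorem timeKernel_comm (ω : ℝ) (φ : ℝ → ℝ≥0∞) (z w : Config) :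
    timeKernel ω φ z w = timeKernel ω φ w z := by
  simp only [timeKernel, heatKernel_comm ω _ z w]

theorem measurable_mul_heatKernel (ω : ℝ) {φ : ℝ → ℝ≥0∞} (hφ : Measurable φ) :
    Measurable fun q : (Config × Config) × ℝ =>
      φ q.2 * ENNReal.ofReal (heatKernel ω q.2 q.1.1 q.1.2) :=
  (hφ.comp measurable_snd).mul
    ((measurable_heatKernel ω).comp (measurable_snd.prodMk measurable_fst)).ennreal_ofReal

theorem measurable_heatKernel_time (ω : ℝ) (z w : Config) :
    Measurable fun t : ℝ => heatKernel ω t z w :=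
  (measurable_heatKernel ω).comp (measurable_id.prodMk (measurable_const (a := (z, w))))

theorem measurable_timeKernel (ω : ℝ) {φ : ℝ → ℝ≥0∞} (hφ : Measurable φ) :
    Measurable (Function.uncurry (timeKernel ω φ)) :=
  (measurable_mul_heatKernel ω hφ).lintegral_prod_right'

theorem measurable_diagKernel (ω : ℝ) {φ : ℝ → ℝ≥0∞} (hφ : Measurable φ) :
    Measurable (Function.uncurry (diagKernel ω φ)) :=
  (measurable_timeKernel ω hφ).comp
    (measurable_fst.prodMk (measurable_snd.prodMk measurable_snd))

theorem lintegral_timeKernel_le {ω : ℝ} (hω : 0 < ω) {φ : ℝ → ℝ≥0∞} (hφ : Measurable φ)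
    (z : Config) : ∫⁻ w, timeKernel ω φ z w ≤ 2 * ∫⁻ t in Set.Ioi (0 : ℝ), φ t := by
  have hmeas : Measurable (Function.uncurry fun (w : Config) (t : ℝ) =>
      φ t * ENNReal.ofReal (heatKernel ω t z w)) :=
    (measurable_mul_heatKernel ω hφ).comp
      ((measurable_const.prodMk measurable_fst).prodMk measurable_snd)
  unfold timeKernel
  rw [lintegral_lintegral_swap hmeas.aemeasurable, ← lintegral_const_mul _ hφ]
  refine setLIntegral_mono' measurableSet_Ioi fun t ht => ?_
  rw [lintegral_const_mul _ (measurable_ofReal_heatKernel ω t).of_uncurry_left, mul_comm 2]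
  gcongr
  exact lintegral_heatKernel_le hω ht z

theorem lintegral_diagKernel_le {ω : ℝ} (hω : 0 < ω) {φ : ℝ → ℝ≥0∞} (hφ : Measurable φ)
    (z : Config) : ∫⁻ u, diagKernel ω φ z u ≤
      ∫⁻ t in Set.Ioi (0 : ℝ), φ t * ENNReal.ofReal (1 / t) := by
  have hmeas : Measurable (Function.uncurry fun (u : Plane) (t : ℝ) =>
      φ t * ENNReal.ofReal (heatKernel ω t z (u, u))) :=
    (measurable_mul_heatKernel ω hφ).comp
      ((measurable_const.prodMk (measurable_fst.prodMk measurable_fst)).prodMk measurable_snd)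
  have hheat (t : ℝ) : Measurable fun u : Plane => ENNReal.ofReal (heatKernel ω t z (u, u)) :=
    (measurable_ofReal_heatKernel ω t).comp
      (measurable_const.prodMk (measurable_id.prodMk measurable_id))
  unfold diagKernel timeKernel
  rw [lintegral_lintegral_swap hmeas.aemeasurable]
  refine setLIntegral_mono' measurableSet_Ioi fun t ht => ?_
  rw [lintegral_const_mul _ (hheat t)]
  gcongr
  exact lintegral_heatKernel_diag_le hω ht z

theorem isL2Kernel_timeKernel {ω : ℝ} (hω : 0 < ω) {φ : ℝ → ℝ≥0∞} (hφ : Measurable φ) {C : ℝ≥0}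
    (hC : 2 * ∫⁻ t in Set.Ioi (0 : ℝ), φ t ≤ C) : IsL2Kernel (timeKernel ω φ) C := by
  have hmass (z : Config) : ∫⁻ w, timeKernel ω φ z w ≤ C :=
    (lintegral_timeKernel_le hω hφ z).trans hC
  refine isL2Kernel_of_lintegral_le (measurable_timeKernel ω hφ) hmass (fun w => ?_) (sq C).ge
  simp_rw [timeKernel_comm ω φ _ w]
  exact hmass w

theorem ofReal_sqrt_mul_ofReal_one_div_sqrt {t : ℝ} (ht : 0 < t) :
    ENNReal.ofReal √t * ENNReal.ofReal (1 / √t) = 1 := by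
  rw [← ENNReal.ofReal_mul (Real.sqrt_nonneg t), mul_one_div_cancel (Real.sqrt_pos.2 ht).ne',
    ENNReal.ofReal_one]

theorem diagKernel_sq_le (ω : ℝ) {φ : ℝ → ℝ≥0∞} (hφ : Measurable φ) (z : Config) (u : Plane) :
    diagKernel ω φ z u ^ 2 ≤ diagKernel ω (fun t => φ t * ENNReal.ofReal √t) z u *
      diagKernel ω (fun t => φ t * ENNReal.ofReal (1 / √t)) z u := by
  have hheat := (measurable_heatKernel_time ω z (u, u)).ennreal_ofReal
  refine sq_lintegral_le_of_sq_le_mul (Measurable.aemeasurable (by fun_prop))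
    (Measurable.aemeasurable (by fun_prop)) ?_
  filter_upwards [ae_restrict_mem measurableSet_Ioi] with t ht
  refine le_of_eq ?_
  calc (φ t * ENNReal.ofReal (heatKernel ω t z (u, u))) ^ 2
      = (φ t * ENNReal.ofReal (heatKernel ω t z (u, u))) ^ 2 *
          (ENNReal.ofReal √t * ENNReal.ofReal (1 / √t)) := by
        rw [ofReal_sqrt_mul_ofReal_one_div_sqrt ht, mul_one]
    _ = φ t * ENNReal.ofReal √t * ENNReal.ofReal (heatKernel ω t z (u, u)) *
          (φ t * ENNReal.ofReal (1 / √t) * ENNReal.ofReal (heatKernel ω t z (u, u))) := by ring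

/-- Schur's test with the weights `√t` and `1 / √t`: integrating `exp (-t H₀)` over the plane of
coincidence costs a factor `1 / t`, over all configurations nothing. -/
theorem isL2Kernel_diagKernel {ω : ℝ} (hω : 0 < ω) {φ : ℝ → ℝ≥0∞} (hφ : Measurable φ) {C : ℝ≥0}
    (hC : 2 * ∫⁻ t in Set.Ioi (0 : ℝ), φ t * ENNReal.ofReal (1 / √t) ≤ C) :
    IsL2Kernel (diagKernel ω φ) C := by
  have hmeas_mul : Measurable fun t => φ t * ENNReal.ofReal √t := by fun_prop
  have hmeas_div : Measurable fun t => φ t * ENNReal.ofReal (1 / √t) := by fun_prop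
  refine isL2Kernel_of_schur (C₁ := C) (C₂ := C) (measurable_diagKernel ω hφ)
    (measurable_diagKernel ω hmeas_mul) (measurable_diagKernel ω hmeas_div)
    (diagKernel_sq_le ω hφ) (fun z => ?_) (fun u => ?_) (sq C).ge
  · have hweight : Set.EqOn (fun t => φ t * ENNReal.ofReal √t * ENNReal.ofReal (1 / t))
        (fun t => φ t * ENNReal.ofReal (1 / √t)) (Set.Ioi 0) := fun t _ => by
      dsimp only
      rw [mul_assoc, ← ENNReal.ofReal_mul (Real.sqrt_nonneg t), mul_one_div, Real.sqrt_div_self']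
    calc ∫⁻ u, diagKernel ω (fun t => φ t * ENNReal.ofReal √t) z u
        ≤ ∫⁻ t in Set.Ioi (0 : ℝ), φ t * ENNReal.ofReal (1 / √t) :=
          (lintegral_diagKernel_le hω hmeas_mul z).trans_eq
            (setLIntegral_congr_fun measurableSet_Ioi hweight)
      _ ≤ 2 * ∫⁻ t in Set.Ioi (0 : ℝ), φ t * ENNReal.ofReal (1 / √t) :=
          le_mul_of_one_le_left' one_le_two
      _ ≤ C := hC
  · simp only [diagKernel, timeKernel_comm ω _ _ (u, u)]
    exact (lintegral_timeKernel_le hω hmeas_div (u, u)).trans hC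

theorem setLIntegral_Ioi_add (f : ℝ → ℝ≥0∞) (a : ℝ) :
    ∫⁻ s in Set.Ioi (0 : ℝ), f (s + a) = ∫⁻ t in Set.Ioi a, f t := by
  rw [← lintegral_indicator measurableSet_Ioi, ← lintegral_indicator measurableSet_Ioi,
    ← lintegral_add_right_eq_self ((Set.Ioi a).indicator f) a]
  simp [Set.indicator]

theorem setLIntegral_Ioi_mul_setLIntegral_Ioi_add {φ ψ F : ℝ → ℝ≥0∞} (hφ : Measurable φ)
    (hψ : Measurable ψ) (hF : Measurable F) :
    ∫⁻ t in Set.Ioi (0 : ℝ), ψ t * ∫⁻ s in Set.Ioi (0 : ℝ), φ s * F (s + t) =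
      ∫⁻ u in Set.Ioi (0 : ℝ), (∫⁻ t in Set.Ioo 0 u, φ (u - t) * ψ t) * F u := by
  have hmeas : Measurable fun q : ℝ × ℝ => φ (q.2 - q.1) * ψ q.1 * F q.2 := by fun_prop
  have hlt : MeasurableSet {q : ℝ × ℝ | q.1 < q.2} := measurableSet_lt measurable_fst measurable_snd
  calc ∫⁻ t in Set.Ioi (0 : ℝ), ψ t * ∫⁻ s in Set.Ioi (0 : ℝ), φ s * F (s + t)
      = ∫⁻ t in Set.Ioi (0 : ℝ), ∫⁻ u in Set.Ioi (0 : ℝ),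
          {q : ℝ × ℝ | q.1 < q.2}.indicator (fun q => φ (q.2 - q.1) * ψ q.1 * F q.2) (t, u) := by
        refine setLIntegral_congr_fun measurableSet_Ioi fun t (ht : 0 < t) => ?_
        have hshift := setLIntegral_Ioi_add (fun u => φ (u - t) * ψ t * F u) t
        have hinter : Set.Ioi t ∩ Set.Ioi 0 = Set.Ioi t :=
          Set.inter_eq_left.2 (Set.Ioi_subset_Ioi ht.le)
        simp only [add_sub_cancel_right] at hshift
        change _ = ∫⁻ u in Set.Ioi (0 : ℝ), (Set.Ioi t).indicator (fun u => φ (u - t) * ψ t * F u) u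
        rw [setLIntegral_indicator measurableSet_Ioi, hinter, ← hshift,
          ← lintegral_const_mul _ (by fun_prop)]
        simp only [mul_left_comm, mul_assoc]
    _ = ∫⁻ u in Set.Ioi (0 : ℝ), ∫⁻ t in Set.Ioi (0 : ℝ),
          {q : ℝ × ℝ | q.1 < q.2}.indicator (fun q => φ (q.2 - q.1) * ψ q.1 * F q.2) (t, u) :=
        lintegral_lintegral_swap (hmeas.indicator hlt).aemeasurable
    _ = ∫⁻ u in Set.Ioi (0 : ℝ), (∫⁻ t in Set.Ioo 0 u, φ (u - t) * ψ t) * F u := by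
        refine lintegral_congr fun u => ?_
        change ∫⁻ t in Set.Ioi (0 : ℝ), (Set.Iio u).indicator (fun t => φ (u - t) * ψ t * F u) t = _
        rw [setLIntegral_indicator measurableSet_Iio, Set.Iio_inter_Ioi,
          lintegral_mul_const _ (by fun_prop)]

theorem lintegral_timeKernel_mul_heatKernel {ω : ℝ} (hω : 0 < ω) {φ : ℝ → ℝ≥0∞}
    (hφ : Measurable φ) {t : ℝ} (ht : 0 < t) (z w : Config) :
    ∫⁻ y, timeKernel ω φ z y * ENNReal.ofReal (heatKernel ω t y w) =
      ∫⁻ s in Set.Ioi (0 : ℝ), φ s * ENNReal.ofReal (heatKernel ω (s + t) z w) := by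
  have hmeas : Measurable fun q : Config × ℝ => φ q.2 * ENNReal.ofReal (heatKernel ω q.2 z q.1) :=
    (measurable_mul_heatKernel ω hφ).comp
      ((measurable_const.prodMk measurable_fst).prodMk measurable_snd)
  have hheat : Measurable fun y => ENNReal.ofReal (heatKernel ω t y w) :=
    (measurable_ofReal_heatKernel ω t).of_uncurry_right
  calc ∫⁻ y, timeKernel ω φ z y * ENNReal.ofReal (heatKernel ω t y w)
      = ∫⁻ y, ∫⁻ s in Set.Ioi (0 : ℝ), φ s * ENNReal.ofReal (heatKernel ω s z y) *
          ENNReal.ofReal (heatKernel ω t y w) := by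
        refine lintegral_congr fun y => ?_
        rw [timeKernel, lintegral_mul_const' _ _ ENNReal.ofReal_ne_top]
    _ = ∫⁻ s in Set.Ioi (0 : ℝ), ∫⁻ y, φ s * ENNReal.ofReal (heatKernel ω s z y) *
          ENNReal.ofReal (heatKernel ω t y w) :=
        lintegral_lintegral_swap (hmeas.mul (hheat.comp measurable_fst)).aemeasurable
    _ = ∫⁻ s in Set.Ioi (0 : ℝ), φ s * ENNReal.ofReal (heatKernel ω (s + t) z w) := by
        refine setLIntegral_congr_fun measurableSet_Ioi fun s hs => ?_
        simp only [mul_assoc]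
        rw [lintegral_const_mul _
          ((measurable_ofReal_heatKernel ω s).of_uncurry_left.fun_mul hheat),
          lintegral_heatKernel_mul hω hs ht]

theorem lintegral_timeKernel_mul {ω : ℝ} (hω : 0 < ω) {φ ψ χ : ℝ → ℝ≥0∞}
    (hφ : Measurable φ) (hψ : Measurable ψ)
    (hχ : ∀ u > 0, ∫⁻ t in Set.Ioo 0 u, φ (u - t) * ψ t = χ u) (z w : Config) :
    ∫⁻ y, timeKernel ω φ z y * timeKernel ω ψ y w = timeKernel ω χ z w := by
  have hφ_kernel : Measurable fun y => timeKernel ω φ z y :=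
    (measurable_timeKernel ω hφ).of_uncurry_left
  have hψ_heat : Measurable fun q : Config × ℝ =>
      ψ q.2 * ENNReal.ofReal (heatKernel ω q.2 q.1 w) :=
    (measurable_mul_heatKernel ω hψ).comp
      ((measurable_fst.prodMk measurable_const).prodMk measurable_snd)
  calc ∫⁻ y, timeKernel ω φ z y * timeKernel ω ψ y w
      = ∫⁻ y, ∫⁻ t in Set.Ioi (0 : ℝ), timeKernel ω φ z y *
          (ψ t * ENNReal.ofReal (heatKernel ω t y w)) := by
        refine lintegral_congr fun y => ?_
        rw [lintegral_const_mul _ (hψ.fun_mul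
          (measurable_heatKernel_time ω y w).ennreal_ofReal), ← timeKernel]
    _ = ∫⁻ t in Set.Ioi (0 : ℝ), ∫⁻ y, timeKernel ω φ z y *
          (ψ t * ENNReal.ofReal (heatKernel ω t y w)) :=
        lintegral_lintegral_swap ((hφ_kernel.comp measurable_fst).mul hψ_heat).aemeasurable
    _ = ∫⁻ t in Set.Ioi (0 : ℝ), ψ t *
          ∫⁻ s in Set.Ioi (0 : ℝ), φ s * ENNReal.ofReal (heatKernel ω (s + t) z w) := by
        refine setLIntegral_congr_fun measurableSet_Ioi fun t ht => ?_
        simp only [mul_left_comm _ (ψ t)]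
        rw [lintegral_const_mul _ (hφ_kernel.fun_mul
          (measurable_ofReal_heatKernel ω t).of_uncurry_right),
          lintegral_timeKernel_mul_heatKernel hω hφ ht]
    _ = ∫⁻ u in Set.Ioi (0 : ℝ), (∫⁻ t in Set.Ioo 0 u, φ (u - t) * ψ t) *
          ENNReal.ofReal (heatKernel ω u z w) :=
        setLIntegral_Ioi_mul_setLIntegral_Ioi_add hφ hψ
          (measurable_heatKernel_time ω z w).ennreal_ofReal
    _ = timeKernel ω χ z w :=
        setLIntegral_congr_fun measurableSet_Ioi fun u hu => by simp only [hχ u hu]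

/-- The weight `t^k e^{-λt} / k!`, which represents `(H₀ + λ)^{-(k+1)}` as a superposition of the
operators `exp (-t H₀)`. -/
noncomputable def timeWeight (lam : ℝ) (k : ℕ) (t : ℝ) : ℝ≥0∞ :=
  ENNReal.ofReal (t ^ k / k.factorial * exp (-lam * t))

theorem measurable_timeWeight (lam : ℝ) (k : ℕ) : Measurable (timeWeight lam k) := by
  unfold timeWeight
  fun_prop

theorem timeWeight_zero_mul_timeWeight (lam : ℝ) (k : ℕ) (t u : ℝ) :
    timeWeight lam 0 (u - t) * timeWeight lam k t =
      ENNReal.ofReal (exp (-lam * u) / k.factorial * t ^ k) := by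
  have hexp : exp (-lam * u) = exp (-lam * (u - t)) * exp (-lam * t) := by
    rw [← Real.exp_add]
    ring_nf
  rw [timeWeight, timeWeight, ← ENNReal.ofReal_mul (by positivity), hexp, pow_zero,
    Nat.factorial_zero, Nat.cast_one]
  ring_nf

theorem timeWeight_convolution (lam : ℝ) (k : ℕ) {u : ℝ} (hu : 0 < u) :
    ∫⁻ t in Set.Ioo 0 u, timeWeight lam 0 (u - t) * timeWeight lam k t =
      timeWeight lam (k + 1) u := by
  have hcont : Continuous fun t : ℝ => exp (-lam * u) / k.factorial * t ^ k := by fun_prop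
  have hnonneg : ∀ᵐ t ∂volume.restrict (Set.Ioo 0 u),
      0 ≤ exp (-lam * u) / k.factorial * t ^ k := by
    filter_upwards [ae_restrict_mem measurableSet_Ioo] with t ht
    have := ht.1.le
    positivity
  rw [setLIntegral_congr_fun measurableSet_Ioo
    fun t _ => timeWeight_zero_mul_timeWeight lam k t u,
    ← ofReal_integral_eq_lintegral_ofReal
      ((hcont.integrableOn_Icc (a := 0) (b := u)).mono_set Set.Ioo_subset_Icc_self) hnonneg,
    integral_const_mul, ← integral_Ioc_eq_integral_Ioo,
    ← intervalIntegral.integral_of_le hu.le, integral_pow, timeWeight, Nat.factorial_succ]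
  congr 1
  push_cast
  field_simp
  simp

theorem lintegral_timeWeight_mul_rpow_lt_top {lam : ℝ} (hlam : 0 < lam) (k : ℕ) {a : ℝ}
    (ha : -1 < k + a) :
    ∫⁻ t in Set.Ioi (0 : ℝ), timeWeight lam k t * ENNReal.ofReal (t ^ a) < ∞ := by
  refine (setLIntegral_mono' measurableSet_Ioi fun t (ht : 0 < t) => ?_).trans_lt
    (integrableOn_rpow_mul_exp_neg_mul_rpow (p := 1) ha one_pos hlam).2
  have hpos : 0 ≤ t ^ (k + a) * exp (-lam * t ^ (1 : ℝ)) := by positivity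
  rw [timeWeight, ← ENNReal.ofReal_mul (by positivity), ← ofReal_norm, Real.norm_of_nonneg hpos,
    Real.rpow_one, Real.rpow_add ht, Real.rpow_natCast, mul_right_comm]
  gcongr
  exact div_le_self (by positivity) (by exact_mod_cast k.factorial_pos)

theorem lintegral_timeWeight_lt_top {lam : ℝ} (hlam : 0 < lam) (k : ℕ) :
    ∫⁻ t in Set.Ioi (0 : ℝ), timeWeight lam k t < ∞ := by
  have hk : (-1 : ℝ) < k + 0 := by linarith [k.cast_nonneg (α := ℝ)]
  simpa using lintegral_timeWeight_mul_rpow_lt_top hlam k hk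

theorem one_div_sqrt_eq_rpow {t : ℝ} (ht : 0 ≤ t) : 1 / √t = t ^ (-1 / 2 : ℝ) := by
  rw [Real.sqrt_eq_rpow, neg_div, Real.rpow_neg ht, one_div]

theorem lintegral_timeWeight_div_sqrt_lt_top {lam : ℝ} (hlam : 0 < lam) (k : ℕ) :
    ∫⁻ t in Set.Ioi (0 : ℝ), timeWeight lam k t * ENNReal.ofReal (1 / √t) < ∞ := by
  have hk : (-1 : ℝ) < k + -1 / 2 := by linarith [k.cast_nonneg (α := ℝ)]
  rw [setLIntegral_congr_fun measurableSet_Ioi fun t (ht : 0 < t) => by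
    rw [one_div_sqrt_eq_rpow ht.le]]
  exact lintegral_timeWeight_mul_rpow_lt_top hlam k hk

theorem timeWeight_le {lam : ℝ} (hlam : 0 ≤ lam) (k : ℕ) {t : ℝ} (ht : 0 ≤ t) :
    timeWeight lam k t ≤ ENNReal.ofReal (t ^ k) := by
  refine ENNReal.ofReal_le_ofReal ?_
  calc t ^ k / k.factorial * exp (-lam * t) ≤ t ^ k * 1 := by
        gcongr
        · exact div_le_self (by positivity) (by exact_mod_cast k.factorial_pos)
        · exact Real.exp_le_one_iff.2 (by nlinarith)
    _ = t ^ k := mul_one _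

theorem lintegral_timeWeight_div_sqrt_Ioc_le {lam : ℝ} (hlam : 0 ≤ lam) (k : ℕ) {δ : ℝ}
    (hδ : 0 < δ) :
    ∫⁻ t in Set.Ioc 0 δ, timeWeight lam k t * ENNReal.ofReal (1 / √t) ≤
      ENNReal.ofReal (2 * δ ^ (k + 1 / 2 : ℝ)) := by
  have hint : IntegrableOn (fun t : ℝ => δ ^ k * t ^ (-1 / 2 : ℝ)) (Set.Ioc 0 δ) := by
    rw [← intervalIntegrable_iff_integrableOn_Ioc_of_le hδ.le]
    exact (intervalIntegral.intervalIntegrable_rpow' (by norm_num)).const_mul _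
  have hnonneg : ∀ᵐ t ∂volume.restrict (Set.Ioc 0 δ), 0 ≤ δ ^ k * t ^ (-1 / 2 : ℝ) := by
    filter_upwards [ae_restrict_mem measurableSet_Ioc] with t ht
    have := ht.1.le
    positivity
  calc ∫⁻ t in Set.Ioc 0 δ, timeWeight lam k t * ENNReal.ofReal (1 / √t)
      ≤ ∫⁻ t in Set.Ioc 0 δ, ENNReal.ofReal (δ ^ k * t ^ (-1 / 2 : ℝ)) := by
        refine setLIntegral_mono' measurableSet_Ioc fun t ht => ?_
        have := ht.1.le
        rw [one_div_sqrt_eq_rpow ht.1.le, ENNReal.ofReal_mul (by positivity)]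
        gcongr
        refine (timeWeight_le hlam k ht.1.le).trans ?_
        gcongr
        exact ht.2
    _ = ENNReal.ofReal (2 * δ ^ (k + 1 / 2 : ℝ)) := by
        rw [← ofReal_integral_eq_lintegral_ofReal hint hnonneg, integral_const_mul,
          ← intervalIntegral.integral_of_le hδ.le, integral_rpow (Or.inl (by norm_num)),
          Real.rpow_add hδ (k : ℝ), Real.rpow_natCast]
        congr 1
        norm_num
        ring

end TimeKernel

/-! ### Traces of the heat semigroup on the plane of coincidence -/

section MehlerOperator

open scoped ENNReal
open Module (finrank)
open Real (sinh)

variable {V : Type*} [NormedAddCommGroup V] [InnerProductSpace ℝ V] [FiniteDimensional ℝ V]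
  [MeasurableSpace V] [BorelSpace V] {κ s : ℝ} {M : L2 V →L[ℂ] L2 V}

theorem isKernelOp_mehlerKernel_pow (hκ : 0 < κ) (hs : 0 < s)
    (hM : IsKernelOp (fun u v => ENNReal.ofReal (mehlerKernel κ s u v)) M) {n : ℕ} (hn : 1 ≤ n) :
    IsKernelOp (fun u v => ENNReal.ofReal (mehlerKernel κ (n * s) u v)) (M ^ n) := by
  induction n, hn using Nat.le_induction with
  | base => simpa using hM
  | succ n hn ih =>
    have hns : 0 < n * s := mul_pos (by exact_mod_cast hn) hs
    have hcomp := ih.comp (isL2Kernel_mehlerKernel hκ hns)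
      (isL2Kernel_mehlerKernel hκ hs) hM
    simp only [lintegral_mehlerKernel_mul hκ hns hs] at hcomp
    rwa [Nat.cast_succ, add_one_mul]

theorem adjoint_eq_self_of_mehlerKernel (hκ : 0 < κ) (hs : 0 < s)
    (hM : IsKernelOp (fun u v => ENNReal.ofReal (mehlerKernel κ s u v)) M) :
    ContinuousLinearMap.adjoint M = M :=
  hM.adjoint_eq (isL2Kernel_mehlerKernel hκ hs) (by simpa only [mehlerKernel_comm κ s] using hM)

theorem gelfandLE_of_mehlerKernel (hκ : 0 < κ) (hs : 0 < s)
    (hM : IsKernelOp (fun u v => ENNReal.ofReal (mehlerKernel κ s u v)) M) {ε : ℝ} (hε : 0 < ε) :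
    GelfandLE M ⌊(1 / (4 * sinh s ^ 2)) ^ (finrank ℝ V / 2 : ℝ) / ε ^ 2⌋₊ ε :=
  gelfandLE_of_hilbertSchmidt hε fun _ _ hv =>
    hM.sum_norm_sq_le (measurable_ofReal_mehlerKernel κ s) (by positivity)
      (lintegral_mehlerKernel_sq hκ hs).le hv

end MehlerOperator

section Trace

open scoped ENNReal NNReal
open Real (exp sinh)

attribute [local irreducible] heatKernel

/-- The kernel of `exp (-t H₀)` with sources on the plane of coincidence. -/
noncomputable def traceKernel (ω t : ℝ) (z : Config) (u : Plane) : ℝ≥0∞ :=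
  ENNReal.ofReal (heatKernel ω t z (u, u))

theorem measurable_traceKernel (ω t : ℝ) : Measurable (Function.uncurry (traceKernel ω t)) :=
  (measurable_ofReal_heatKernel ω t).comp
    (measurable_fst.prodMk (measurable_snd.prodMk measurable_snd))

theorem lintegral_traceKernel_left_le {ω t : ℝ} (hω : 0 < ω) (ht : 0 < t) (u : Plane) :
    ∫⁻ z, traceKernel ω t z u ≤ 2 := by
  simp only [traceKernel, heatKernel_comm ω t _ (u, u)]
  exact lintegral_heatKernel_le hω ht (u, u)

theorem isL2Kernel_traceKernel {ω t : ℝ} (hω : 0 < ω) (ht : 0 < t) :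
    IsL2Kernel (traceKernel ω t) ((1 / t).toNNReal + 2) :=
  isL2Kernel_of_lintegral_le (measurable_traceKernel ω t)
    (lintegral_heatKernel_diag_le hω ht) (lintegral_traceKernel_left_le hω ht)
    (by rw [sq]; gcongr <;> simp)

theorem isL2Kernel_traceKernel_swap {ω t : ℝ} (hω : 0 < ω) (ht : 0 < t) :
    IsL2Kernel (fun u z => traceKernel ω t z u) ((1 / t).toNNReal + 2) :=
  isL2Kernel_of_lintegral_le ((measurable_traceKernel ω t).comp measurable_swap)
    (lintegral_traceKernel_left_le hω ht) (lintegral_heatKernel_diag_le hω ht)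
    (by rw [sq, mul_comm]; gcongr <;> simp)

theorem lintegral_traceKernel_mul {ω t : ℝ} (hω : 0 < ω) (ht : 0 < t) (u v : Plane) :
    ∫⁻ z, traceKernel ω t z u * traceKernel ω t z v =
      ENNReal.ofReal (heatKernel ω (t + t) (u, u) (v, v)) := by
  simp only [traceKernel, heatKernel_comm ω t _ (u, u)]
  exact lintegral_heatKernel_mul hω ht ht (u, u) (v, v)

theorem norm_sq_of_adjoint_comp_eq_smul_pow {𝕜 H K : Type*} [RCLike 𝕜] [NormedAddCommGroup H]
    [InnerProductSpace 𝕜 H] [CompleteSpace H] [NormedAddCommGroup K] [InnerProductSpace 𝕜 K]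
    [CompleteSpace K] {R : H →L[𝕜] K} {M : H →L[𝕜] H} {c : ℝ} {m : ℕ}
    (hM : ContinuousLinearMap.adjoint M = M)
    (hR : ContinuousLinearMap.adjoint R ∘L R = (c : 𝕜) • M ^ (m + m)) (f : H) :
    ‖R f‖ ^ 2 = c * ‖(M ^ m) f‖ ^ 2 := by
  have hMm : ContinuousLinearMap.adjoint (M ^ m) = M ^ m := by
    rw [← ContinuousLinearMap.star_eq_adjoint] at hM ⊢
    rw [star_pow, hM]
  calc ‖R f‖ ^ 2 = RCLike.re (inner 𝕜 f ((ContinuousLinearMap.adjoint R ∘L R) f)) := by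
        rw [ContinuousLinearMap.comp_apply, ContinuousLinearMap.adjoint_inner_right,
          inner_self_eq_norm_sq (𝕜 := 𝕜)]
    _ = c * RCLike.re (inner 𝕜 f ((M ^ (m + m)) f)) := by
        rw [hR, smul_apply, inner_smul_right, RCLike.re_ofReal_mul]
    _ = c * ‖(M ^ m) f‖ ^ 2 := by
        rw [pow_add, mul_apply_eq_comp, ← ContinuousLinearMap.adjoint_inner_left, hMm,
          inner_self_eq_norm_sq (𝕜 := 𝕜)]

/-- The kernel of `R* R` is that of `exp (-2δ H₀)` on the plane of coincidence, which is a multiple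
of a Mehler kernel, and Mehler kernels form a semigroup: hence `R* R = c M^(2m)`. -/
theorem exists_norm_sq_eq_mul_norm_mehlerOp_pow {ω δ : ℝ} (hω : 0 < ω) (hδ : 0 < δ) {m : ℕ}
    (hm : m ≠ 0) {R : L2Plane →L[ℂ] L2Config} (hR : IsKernelOp (traceKernel ω δ) R) :
    ∃ (c κ s : ℝ) (M : L2Plane →L[ℂ] L2Plane), 0 < κ ∧ 0 < s ∧
      c ≤ exp (ω * (δ + δ)) / (δ + δ) ∧ ω * δ ≤ sinh s ∧
      IsKernelOp (fun u v => ENNReal.ofReal (mehlerKernel κ (s / (2 * m)) u v)) M ∧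
      ∀ f, ‖R f‖ ^ 2 = c * ‖(M ^ m) f‖ ^ 2 := by
  obtain ⟨c, κ, s, hc, hκ, hs, hc_le, hs_le, hdiag⟩ :=
    exists_heatKernel_diag_eq_mul_mehlerKernel hω (add_pos hδ hδ)
  have hms : 0 < s / (2 * m) := by positivity
  obtain ⟨M, hM⟩ := (isL2Kernel_mehlerKernel (V := Plane) hκ hms).exists_isKernelOp
  obtain ⟨R', hR'⟩ := (isL2Kernel_traceKernel_swap hω hδ).exists_isKernelOp
  have hadjoint := hR.adjoint_eq (isL2Kernel_traceKernel hω hδ) hR'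
  have hcomp := hR'.comp (isL2Kernel_traceKernel_swap hω hδ) (isL2Kernel_traceKernel hω hδ) hR
  simp only [lintegral_traceKernel_mul hω hδ, hdiag, ENNReal.ofReal_mul hc] at hcomp
  have hpow := isKernelOp_mehlerKernel_pow hκ hms hM (n := m + m) (by omega)
  have htime : ((m + m : ℕ) : ℝ) * (s / (2 * m)) = s := by
    push_cast
    field_simp
    ring
  rw [htime] at hpow
  refine ⟨c, κ, s, M, hκ, hs, hc_le, by linarith, hM, fun f =>
    norm_sq_of_adjoint_comp_eq_smul_pow (adjoint_eq_self_of_mehlerKernel hκ hms hM) ?_ f⟩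
  rw [hadjoint]
  exact IsIntegralOperator.unique hcomp (hpow.const_smul hc)

theorem sinh_le_two_mul {s : ℝ} (hs : 0 ≤ s) (hs₁ : s ≤ 1) : sinh s ≤ 2 * s := by
  have hexp := (abs_le.1 (Real.abs_exp_sub_one_sub_id_le (by rwa [abs_of_nonneg hs]))).2
  have hexp_neg := Real.add_one_le_exp (-s)
  rw [Real.sinh_eq]
  nlinarith

theorem min_mul_le_of_le_sinh {ω δ s : ℝ} (hδ : 0 ≤ δ) (hδ₁ : δ ≤ 1) (hs : 0 ≤ s)
    (h : ω * δ ≤ sinh s) : min 1 (ω / 2) * δ ≤ s := by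
  rcases le_total s 1 with hs₁ | hs₁
  · calc min 1 (ω / 2) * δ ≤ ω / 2 * δ := by gcongr; exact min_le_right _ _
      _ ≤ s := by linarith [sinh_le_two_mul hs hs₁]
  · calc min 1 (ω / 2) * δ ≤ 1 * 1 := by gcongr; exact min_le_left _ _
      _ ≤ s := by linarith

theorem sqrt_exp_div_le {ω δ : ℝ} (hω : 0 ≤ ω) (hδ : 0 < δ) (hδ₁ : δ ≤ 1) :
    √(exp (ω * (δ + δ)) / (δ + δ)) ≤ exp ω * δ ^ (-1 / 2 : ℝ) := by
  rw [← one_div_sqrt_eq_rpow hδ.le, Real.sqrt_le_iff, mul_pow, one_div_pow, Real.sq_sqrt hδ.le,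
    ← Real.exp_nat_mul]
  have hexponent : ω * (δ + δ) ≤ (2 : ℕ) * ω := by
    push_cast
    nlinarith
  refine ⟨by positivity, ?_⟩
  rw [mul_one_div]
  gcongr
  linarith

theorem exists_gelfandLE_of_traceKernel {ω δ ε : ℝ} (hω : 0 < ω) (hδ : 0 < δ) (hδ₁ : δ ≤ 1)
    (hε : 0 < ε) {m : ℕ} (hm : m ≠ 0) {R : L2Plane →L[ℂ] L2Config}
    (hR : IsKernelOp (traceKernel ω δ) R) :
    ∃ n : ℕ, GelfandLE R n (exp ω * δ ^ (-1 / 2 : ℝ) * ε ^ m) ∧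
      (n : ℝ) ≤ m ^ 3 / min 1 (ω / 2) ^ 2 * (δ ^ 2 * ε ^ 2)⁻¹ := by
  obtain ⟨c, κ, s, M, hκ, hs, hc_le, hs_le, hM, hRM⟩ :=
    exists_norm_sq_eq_mul_norm_mehlerOp_pow hω hδ hm hR
  have hms : 0 < s / (2 * m) := by positivity
  have : 0 < min 1 (ω / 2) := by positivity
  have hR_le (f : L2Plane) : ‖R f‖ ≤ exp ω * δ ^ (-1 / 2 : ℝ) * ‖(M ^ m) f‖ :=
    calc ‖R f‖ = √c * ‖(M ^ m) f‖ := by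
          rw [← Real.sqrt_sq (norm_nonneg (R f)), hRM, Real.sqrt_mul' _ (sq_nonneg _),
            Real.sqrt_sq (norm_nonneg _)]
      _ ≤ exp ω * δ ^ (-1 / 2 : ℝ) * ‖(M ^ m) f‖ := by
          gcongr
          exact (Real.sqrt_le_sqrt hc_le).trans (sqrt_exp_div_le hω.le hδ hδ₁)
  have hsinh : min 1 (ω / 2) * δ / (2 * m) ≤ sinh (s / (2 * m)) :=
    calc min 1 (ω / 2) * δ / (2 * m) ≤ s / (2 * m) := by
          gcongr
          exact min_mul_le_of_le_sinh hδ.le hδ₁ hs.le hs_le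
      _ ≤ sinh (s / (2 * m)) := Real.self_le_sinh_iff.2 hms.le
  have hgelfand := gelfandLE_of_mehlerKernel hκ hms hM hε
  simp only [finrank_plane_div_two, Real.rpow_one] at hgelfand
  refine ⟨_, (hgelfand.pow hε.le m).of_norm_apply_le (by positivity) hR_le, ?_⟩
  rw [Nat.cast_mul]
  calc (m : ℝ) * (⌊1 / (4 * sinh (s / (2 * m)) ^ 2) / ε ^ 2⌋₊ : ℝ)
      ≤ m * (1 / (4 * sinh (s / (2 * m)) ^ 2) / ε ^ 2) := by
        gcongr
        exact Nat.floor_le (by positivity)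
    _ ≤ m * (1 / (4 * (min 1 (ω / 2) * δ / (2 * m)) ^ 2) / ε ^ 2) := by gcongr
    _ = m ^ 3 / min 1 (ω / 2) ^ 2 * (δ ^ 2 * ε ^ 2)⁻¹ := by
        field_simp
        ring

/-- With `ε = δ^((k+1)/m)` the approximation error is of order `δ^(k+1/2)`, and for large `m` the
rank is of order almost `δ^(-2)`. -/
theorem exists_forall_gelfandLE_of_traceKernel {ω : ℝ} (hω : 0 < ω) (k : ℕ) {τ : ℝ} (hτ : 0 < τ) :
    ∃ C : ℝ, 0 < C ∧ ∀ δ : ℝ, 0 < δ → δ ≤ 1 → ∀ R : L2Plane →L[ℂ] L2Config,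
      IsKernelOp (traceKernel ω δ) R →
      ∃ n : ℕ, GelfandLE R n (C * δ ^ (k + 1 / 2 : ℝ)) ∧ (n : ℝ) ≤ C * δ ^ (-(2 + τ)) := by
  obtain ⟨m, hm⟩ := exists_nat_gt (2 * (k + 1) / τ)
  have hm_pos : (0 : ℝ) < m := lt_of_le_of_lt (by positivity) hm
  have : 0 < min 1 (ω / 2) := by positivity
  refine ⟨max (exp ω) (m ^ 3 / min 1 (ω / 2) ^ 2), by positivity, fun δ hδ hδ₁ R hR => ?_⟩
  obtain ⟨n, hgelfand, hn⟩ := exists_gelfandLE_of_traceKernel hω hδ hδ₁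
    (ε := δ ^ ((k + 1) / m : ℝ)) (by positivity) (m := m) (by exact_mod_cast hm_pos.ne') hR
  refine ⟨n, hgelfand.mono le_rfl ?_, hn.trans ?_⟩
  · calc exp ω * δ ^ (-1 / 2 : ℝ) * (δ ^ ((k + 1) / m : ℝ)) ^ m
        = exp ω * δ ^ (k + 1 / 2 : ℝ) := by
          rw [← Real.rpow_mul_natCast hδ.le, div_mul_cancel₀ _ hm_pos.ne', mul_assoc,
            ← Real.rpow_add hδ]
          ring_nf
      _ ≤ _ := by gcongr; exact le_max_left _ _
  · have hexponent : 2 + 2 * (k + 1) / m ≤ 2 + τ := by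
      have : 2 * ((k : ℝ) + 1) / m < τ := (div_lt_comm₀ hτ hm_pos).1 hm
      linarith
    calc m ^ 3 / min 1 (ω / 2) ^ 2 * (δ ^ 2 * (δ ^ ((k + 1) / m : ℝ)) ^ 2)⁻¹
        = m ^ 3 / min 1 (ω / 2) ^ 2 * δ ^ (-(2 + 2 * (k + 1) / m : ℝ)) := by
          rw [← Real.rpow_mul_natCast hδ.le, ← Real.rpow_natCast δ 2, ← Real.rpow_add hδ,
            ← Real.rpow_neg hδ.le]
          push_cast
          ring_nf
      _ ≤ m ^ 3 / min 1 (ω / 2) ^ 2 * δ ^ (-(2 + τ)) := by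
          gcongr ?_ * ?_
          exact Real.rpow_le_rpow_of_exponent_ge hδ hδ₁ (neg_le_neg hexponent)
      _ ≤ _ := by gcongr; exact le_max_right _ _

end Trace

section Schatten

open scoped ENNReal NNReal

attribute [local irreducible] heatKernel

theorem diagKernel_indicator_Ioi {ω : ℝ} (hω : 0 < ω) {φ : ℝ → ℝ≥0∞} (hφ : Measurable φ)
    {δ : ℝ} (hδ : 0 < δ) (z : Config) (u : Plane) :
    diagKernel ω ((Set.Ioi δ).indicator φ) z u =
      ∫⁻ y, timeKernel ω (fun s => φ (s + δ)) z y * traceKernel ω δ y u := by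
  have hinter : Set.Ioi δ ∩ Set.Ioi 0 = Set.Ioi δ :=
    Set.inter_eq_left.2 (Set.Ioi_subset_Ioi hδ.le)
  have hφδ : Measurable fun s => φ (s + δ) := by fun_prop
  simp only [traceKernel, lintegral_timeKernel_mul_heatKernel hω hφδ hδ]
  rw [setLIntegral_Ioi_add fun t => φ t * ENNReal.ofReal (heatKernel ω t z (u, u)), diagKernel,
    timeKernel]
  simp only [← Set.indicator_mul_left _ _ fun t => ENNReal.ofReal (heatKernel ω t z (u, u))]
  rw [setLIntegral_indicator measurableSet_Ioi, hinter]

theorem diagKernel_eq_indicator_Ioi_add_indicator_Iic (ω : ℝ) {φ : ℝ → ℝ≥0∞} (hφ : Measurable φ)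
    (δ : ℝ) (z : Config) (u : Plane) :
    diagKernel ω φ z u = diagKernel ω ((Set.Ioi δ).indicator φ) z u +
      diagKernel ω ((Set.Iic δ).indicator φ) z u := by
  have hmeas : Measurable fun t => (Set.Ioi δ).indicator φ t *
      ENNReal.ofReal (heatKernel ω t z (u, u)) :=
    (hφ.indicator measurableSet_Ioi).mul (measurable_heatKernel_time ω z (u, u)).ennreal_ofReal
  rw [diagKernel, diagKernel, diagKernel, timeKernel, timeKernel, timeKernel,
    ← lintegral_add_left hmeas]
  refine lintegral_congr fun t => ?_
  rw [← add_mul, ← Set.compl_Ioi, Set.indicator_self_add_compl_apply]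

theorem isL2Kernel_diagKernel_indicator_Iic {ω : ℝ} (hω : 0 < ω) {φ : ℝ → ℝ≥0∞}
    (hφ : Measurable φ) {δ : ℝ} {C : ℝ≥0}
    (hC : 2 * ∫⁻ t in Set.Ioc 0 δ, φ t * ENNReal.ofReal (1 / √t) ≤ C) :
    IsL2Kernel (diagKernel ω ((Set.Iic δ).indicator φ)) C := by
  refine isL2Kernel_diagKernel hω (hφ.indicator measurableSet_Iic) ?_
  simp only [← Set.indicator_mul_left _ _ fun t => ENNReal.ofReal (1 / √t)]
  rwa [setLIntegral_indicator measurableSet_Iic, Set.Iic_inter_Ioi]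

theorem exists_diagOp_eq_comp_traceOp_add {ω : ℝ} (hω : 0 < ω) {φ : ℝ → ℝ≥0∞} (hφ : Measurable φ)
    {δ : ℝ} (hδ : 0 < δ) {C D : ℝ≥0} (hC : 2 * ∫⁻ t in Set.Ioi (0 : ℝ), φ t ≤ C)
    (hD : 2 * ∫⁻ t in Set.Ioc 0 δ, φ t * ENNReal.ofReal (1 / √t) ≤ D)
    {Q : L2Plane →L[ℂ] L2Config} (hQ : IsKernelOp (diagKernel ω φ) Q) :
    ∃ (B : L2Config →L[ℂ] L2Config) (R S : L2Plane →L[ℂ] L2Config),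
      IsKernelOp (traceKernel ω δ) R ∧ ‖B‖ ≤ C ∧ ‖S‖ ≤ D ∧ Q = B ∘L R + S := by
  have hB_kernel : IsL2Kernel (timeKernel ω fun s => φ (s + δ)) C := by
    refine isL2Kernel_timeKernel hω (by fun_prop) (le_trans ?_ hC)
    rw [setLIntegral_Ioi_add φ]
    gcongr
  have hR_kernel := isL2Kernel_traceKernel hω hδ
  have hS_kernel := isL2Kernel_diagKernel_indicator_Iic hω hφ hD
  obtain ⟨B, hB⟩ := hB_kernel.exists_isKernelOp
  obtain ⟨R, hR⟩ := hR_kernel.exists_isKernelOp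
  obtain ⟨S, hS⟩ := hS_kernel.exists_isKernelOp
  have hsum := (hB.comp hB_kernel hR_kernel hR).add (hB_kernel.comp hR_kernel) hS_kernel hS
  simp only [← diagKernel_indicator_Ioi hω hφ hδ,
    ← diagKernel_eq_indicator_Ioi_add_indicator_Iic ω hφ] at hsum
  exact ⟨B, R, S, hR, hB.opNorm_le hB_kernel, hS.opNorm_le hS_kernel, hQ.unique hsum⟩

theorem exists_forall_gelfandLE_of_diagKernel {ω lam : ℝ} (hω : 0 < ω) (hlam : 0 < lam) (k : ℕ)
    {τ : ℝ} (hτ : 0 < τ) {Q : L2Plane →L[ℂ] L2Config}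
    (hQ : IsKernelOp (diagKernel ω (timeWeight lam k)) Q) :
    ∃ C : ℝ, 0 < C ∧ ∀ δ : ℝ, 0 < δ → δ ≤ 1 →
      ∃ n : ℕ, GelfandLE Q n (C * δ ^ (k + 1 / 2 : ℝ)) ∧ (n : ℝ) ≤ C * δ ^ (-(2 + τ)) := by
  obtain ⟨C, hC, hgelfand⟩ := exists_forall_gelfandLE_of_traceKernel hω k hτ
  obtain ⟨W, hW⟩ : ∃ W : ℝ≥0, 2 * ∫⁻ t in Set.Ioi (0 : ℝ), timeWeight lam k t ≤ W :=
    ⟨_, (ENNReal.coe_toNNReal (ENNReal.mul_ne_top ENNReal.ofNat_ne_top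
      (lintegral_timeWeight_lt_top hlam k).ne)).ge⟩
  refine ⟨W * C + 4 + C, by positivity, fun δ hδ hδ₁ => ?_⟩
  have hsmall : 2 * ∫⁻ t in Set.Ioc 0 δ, timeWeight lam k t * ENNReal.ofReal (1 / √t) ≤
      ((4 * δ ^ (k + 1 / 2 : ℝ)).toNNReal : ℝ≥0) :=
    calc 2 * ∫⁻ t in Set.Ioc 0 δ, timeWeight lam k t * ENNReal.ofReal (1 / √t)
        ≤ 2 * ENNReal.ofReal (2 * δ ^ (k + 1 / 2 : ℝ)) := by
          gcongr
          exact lintegral_timeWeight_div_sqrt_Ioc_le hlam.le k hδ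
      _ = ((4 * δ ^ (k + 1 / 2 : ℝ)).toNNReal : ℝ≥0) := by
          rw [← ENNReal.ofReal_ofNat 2, ← ENNReal.ofReal_mul zero_le_two, ← mul_assoc]
          norm_num [ENNReal.ofReal]
  obtain ⟨B, R, S, hR, hB, hS, rfl⟩ :=
    exists_diagOp_eq_comp_traceOp_add hω (measurable_timeWeight lam k) hδ hW hsmall hQ
  rw [Real.coe_toNNReal _ (by positivity)] at hS
  obtain ⟨n, hR_gelfand, hn⟩ := hgelfand δ hδ hδ₁ R hR
  have hBR : GelfandLE (B ∘L R) n (W * (C * δ ^ (k + 1 / 2 : ℝ))) :=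
    hR_gelfand.of_norm_apply_le W.2 fun x => B.le_of_opNorm_le hB (R x)
  refine ⟨n, (hBR.add_of_opNorm_le hS).mono le_rfl ?_, hn.trans ?_⟩
  · calc W * (C * δ ^ (k + 1 / 2 : ℝ)) + 4 * δ ^ (k + 1 / 2 : ℝ)
        = (W * C + 4) * δ ^ (k + 1 / 2 : ℝ) := by ring
      _ ≤ (W * C + 4 + C) * δ ^ (k + 1 / 2 : ℝ) := by
          gcongr ?_ * _
          exact le_add_of_nonneg_right hC.le
  · gcongr
    exact le_add_of_nonneg_left (by positivity)

theorem exists_isL2Kernel_timeKernel_timeWeight {ω lam : ℝ} (hω : 0 < ω) (hlam : 0 < lam)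
    (k : ℕ) : ∃ C, IsL2Kernel (timeKernel ω (timeWeight lam k)) C :=
  ⟨_, isL2Kernel_timeKernel hω (measurable_timeWeight lam k) (ENNReal.coe_toNNReal
    (ENNReal.mul_ne_top ENNReal.ofNat_ne_top (lintegral_timeWeight_lt_top hlam k).ne)).ge⟩

theorem exists_isL2Kernel_diagKernel_timeWeight {ω lam : ℝ} (hω : 0 < ω) (hlam : 0 < lam)
    (k : ℕ) : ∃ C, IsL2Kernel (diagKernel ω (timeWeight lam k)) C :=
  ⟨_, isL2Kernel_diagKernel hω (measurable_timeWeight lam k) (ENNReal.coe_toNNReal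
    (ENNReal.mul_ne_top ENNReal.ofNat_ne_top
      (lintegral_timeWeight_div_sqrt_lt_top hlam k).ne)).ge⟩

theorem isKernelOp_pow_comp {ω lam : ℝ} (hω : 0 < ω) (hlam : 0 < lam)
    {G : L2Config →L[ℂ] L2Config} {Pot : L2Plane →L[ℂ] L2Config}
    (hG : IsKernelOp (timeKernel ω (timeWeight lam 0)) G)
    (hPot : IsKernelOp (diagKernel ω (timeWeight lam 0)) Pot) (k : ℕ) :
    IsKernelOp (diagKernel ω (timeWeight lam k)) ((G ^ k) ∘L Pot) := by
  induction k with
  | zero => exact hPot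
  | succ k ih =>
    obtain ⟨C, hC⟩ := exists_isL2Kernel_timeKernel_timeWeight hω hlam 0
    obtain ⟨D, hD⟩ := exists_isL2Kernel_diagKernel_timeWeight hω hlam k
    have hcomp := hG.comp hC hD ih
    simp only [diagKernel, lintegral_timeKernel_mul hω (measurable_timeWeight lam 0)
      (measurable_timeWeight lam k) fun _ hu => timeWeight_convolution lam k hu] at hcomp
    rw [pow_succ']
    exact hcomp

/-- The approximation errors `δ^(1/2)` and `δ^(k+1/2)` of `Pot` and `G^k Pot` multiply to
`δ^(k+1)`, at a rank of order almost `δ^(-2)`: this is where the exponent `2 / (k + 1)` comes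
from. -/
theorem isSchatten_adjoint_comp_pow_comp {ω lam : ℝ} (hω : 0 < ω) (hlam : 0 < lam)
    {G : L2Config →L[ℂ] L2Config} {Pot : L2Plane →L[ℂ] L2Config}
    (hG : IsKernelOp (timeKernel ω (timeWeight lam 0)) G)
    (hPot : IsKernelOp (diagKernel ω (timeWeight lam 0)) Pot) (k : ℕ) {p : ℝ}
    (hp : 2 / ((k : ℝ) + 1) < p) :
    IsSchatten p (ContinuousLinearMap.adjoint Pot ∘L (G ^ k) ∘L Pot) := by
  have hk : (0 : ℝ) < k + 1 := by positivity
  obtain ⟨q, hqk, hqp⟩ := exists_between hp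
  have hτ : 0 < q * (k + 1) - 2 := sub_pos.2 ((div_lt_iff₀ hk).1 hqk)
  obtain ⟨C₀, hC₀, hPot_gelfand⟩ := exists_forall_gelfandLE_of_diagKernel hω hlam 0 hτ hPot
  obtain ⟨C₁, hC₁, hpow_gelfand⟩ :=
    exists_forall_gelfandLE_of_diagKernel hω hlam k hτ (isKernelOp_pow_comp hω hlam hG hPot k)
  rw [add_sub_cancel] at hPot_gelfand hpow_gelfand
  set D : ℝ := max (C₀ * C₁) 1
  have hD : 0 < D := by positivity
  have hp_nonneg : 0 ≤ p := (by positivity : (0 : ℝ) ≤ 2 / (k + 1)).trans hp.le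
  refine isSchatten_of_gelfandLE (C := (C₀ + C₁) * D ^ q) hp_nonneg hqp fun ε hε hε₁ => ?_
  have hεD : 0 < ε / D := by positivity
  have hεD₁ : ε / D ≤ 1 := (div_le_one hD).2 (hε₁.trans (le_max_right _ _))
  obtain ⟨δ, hδ, hδ₁, hδ_pow⟩ : ∃ δ : ℝ, 0 < δ ∧ δ ≤ 1 ∧ δ ^ (k + 1 : ℝ) = ε / D :=
    ⟨(ε / D) ^ (k + 1 : ℝ)⁻¹, by positivity,
      Real.rpow_le_one hεD.le hεD₁ (by positivity), Real.rpow_inv_rpow hεD.le hk.ne'⟩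
  obtain ⟨n₀, hn₀_gelfand, hn₀⟩ := hPot_gelfand δ hδ hδ₁
  obtain ⟨n₁, hn₁_gelfand, hn₁⟩ := hpow_gelfand δ hδ hδ₁
  refine ⟨n₀ + n₁,
    (hn₀_gelfand.adjoint_comp (by positivity) (by positivity) hn₁_gelfand).mono le_rfl ?_, ?_⟩
  · calc C₀ * δ ^ ((0 : ℕ) + 1 / 2 : ℝ) * (C₁ * δ ^ (k + 1 / 2 : ℝ))
        = C₀ * C₁ * δ ^ (k + 1 : ℝ) := by
          rw [mul_mul_mul_comm, ← Real.rpow_add hδ]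
          congr 2
          push_cast
          ring
      _ ≤ D * (ε / D) := by
          rw [hδ_pow]
          gcongr
          exact le_max_left _ _
      _ = ε := mul_div_cancel₀ _ hD.ne'
  · have hrank : δ ^ (-(q * (k + 1))) = D ^ q * ε ^ (-q) := by
      rw [← neg_mul, mul_comm, Real.rpow_mul hδ.le, hδ_pow, Real.div_rpow hε.le hD.le,
        Real.rpow_neg hD.le q, div_inv_eq_mul, mul_comm]
    rw [hrank] at hn₀ hn₁
    push_cast
    linarith

end Schatten

/-! ### The Green function as a Laplace transform -/

section Green

open scoped ENNReal
open Real (exp sinh cosh)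

theorem mehlerKernel_eq {V : Type*} [NormedAddCommGroup V] [InnerProductSpace ℝ V]
    (κ s : ℝ) (u v : V) :
    mehlerKernel κ s u v = (κ / (2 * Real.pi * sinh s)) ^ (Module.finrank ℝ V / 2 : ℝ) *
      exp (-(κ / 2 * ((cosh s - 1) / sinh s)) * (‖u‖ ^ 2 + ‖v‖ ^ 2)
        - κ / (2 * sinh s) * ‖u - v‖ ^ 2) := by
  rw [mehlerKernel, gaussKernel, norm_sub_sq_real]
  congr 2
  ring

theorem image_exp_neg_mul_Ioi {ω : ℝ} (hω : 0 < ω) :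
    (fun t : ℝ => exp (-ω * t)) '' Set.Ioi 0 = Set.Ioo 0 1 := by
  ext ν
  constructor
  · rintro ⟨t, ht, rfl⟩
    exact ⟨Real.exp_pos _, Real.exp_lt_one_iff.2 (mul_neg_of_neg_of_pos (neg_neg_of_pos hω) ht)⟩
  · rintro ⟨hν_pos, hν_lt⟩
    refine ⟨-Real.log ν / ω, div_pos (neg_pos.2 (Real.log_neg hν_pos hν_lt)) hω, ?_⟩
    have : -ω * (-Real.log ν / ω) = Real.log ν := by field_simp
    simp only [this, Real.exp_log hν_pos]

theorem sinh_eq_of_exp_neg {s ν : ℝ} (hν : exp (-s) = ν) : sinh s = (1 - ν ^ 2) / (2 * ν) := by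
  subst hν
  rw [Real.sinh_eq, Real.exp_neg]
  field_simp

theorem cosh_eq_of_exp_neg {s ν : ℝ} (hν : exp (-s) = ν) : cosh s = (1 + ν ^ 2) / (2 * ν) := by
  subst hν
  rw [Real.cosh_eq, Real.exp_neg]
  field_simp

theorem mehlerKernel_eq_of_exp_neg {V : Type*} [NormedAddCommGroup V] [InnerProductSpace ℝ V]
    {κ s ν : ℝ} (hs : 0 < s) (hν : exp (-s) = ν) (u v : V) :
    mehlerKernel κ s u v =
      (κ * ν / (Real.pi * (1 - ν ^ 2))) ^ (Module.finrank ℝ V / 2 : ℝ) *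
        exp (-(κ / 2) * ((1 - ν) / (1 + ν)) * (‖u‖ ^ 2 + ‖v‖ ^ 2)
          - κ * ν / (1 - ν ^ 2) * ‖u - v‖ ^ 2) := by
  have hν_pos : 0 < ν := hν ▸ Real.exp_pos _
  have hν_lt : ν < 1 := hν ▸ Real.exp_lt_one_iff.2 (neg_neg_of_pos hs)
  have : 0 < 1 - ν ^ 2 := by nlinarith
  have hratio : ((1 + ν ^ 2) / (2 * ν) - 1) / ((1 - ν ^ 2) / (2 * ν)) = (1 - ν) / (1 + ν) := by
    rw [div_eq_div_iff (by positivity) (by positivity)]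
    field_simp
    ring
  rw [mehlerKernel_eq, sinh_eq_of_exp_neg hν, cosh_eq_of_exp_neg hν, hratio]
  congr 2 <;> field_simp

/-- The substitution `ν = exp (-ω t)` in the integrand of `greenKernel`. -/
theorem greenKernel_integrand_eq {ω t ν : ℝ} (hω : 0 < ω) (ht : 0 < t) (hν : exp (-ω * t) = ν)
    (lam : ℝ) (z w : Config) :
    ω / (2 * Real.pi ^ 2) * (ν * ω * (ν ^ (lam / ω - 1) / ((1 - ν ^ 2) * Real.log (1 / ν)) *
      exp (-(ω / 2) * ((1 - ν) / (1 + ν)) * (‖z.2‖ ^ 2 + ‖w.2‖ ^ 2)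
        - ω / (2 * Real.log (1 / ν)) * ‖z.1 - w.1‖ ^ 2
        - ω * ν / (1 - ν ^ 2) * ‖z.2 - w.2‖ ^ 2))) =
      exp (-lam * t) * heatKernel ω t z w := by
  have hν_pos : 0 < ν := hν ▸ Real.exp_pos _
  have hν_lt : ν < 1 := hν ▸ Real.exp_lt_one_iff.2 (mul_neg_of_neg_of_pos (neg_neg_of_pos hω) ht)
  have : 0 < 1 - ν ^ 2 := by nlinarith
  have hlog : Real.log (1 / ν) = ω * t := by
    rw [one_div, Real.log_inv, ← hν, Real.log_exp, neg_mul, neg_neg]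
  have hpow : ν ^ (lam / ω - 1) = exp (-lam * t) / ν := by
    rw [Real.rpow_sub_one hν_pos.ne', ← hν, ← Real.exp_mul]
    congr 2
    field_simp
  have hinv : exp (ω * t) = ν⁻¹ := by
    rw [← hν, ← Real.exp_neg, neg_mul, neg_neg]
  rw [heatKernel, freeHeatKernel_eq,
    mehlerKernel_eq_of_exp_neg (mul_pos hω ht) ((neg_mul ω t).symm ▸ hν), hlog, hpow, hinv,
    finrank_plane_div_two, Real.rpow_one, Real.rpow_one,
    show ω / (2 * (ω * t)) = 1 / (2 * t) by field_simp, sub_right_comm, sub_eq_add_neg _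
      (1 / (2 * t) * _), ← neg_mul, Real.exp_add]
  field_simp

theorem greenKernel_eq_integral {ω : ℝ} (hω : 0 < ω) (lam : ℝ) (z w : Config) :
    greenKernel ω lam z w = ∫ t in Set.Ioi (0 : ℝ), exp (-lam * t) * heatKernel ω t z w := by
  have hderiv (t : ℝ) : HasDerivAt (fun t => exp (-ω * t)) (exp (-ω * t) * -ω) t := by
    simpa only [id, mul_one] using ((hasDerivAt_id t).const_mul (-ω)).exp
  have hinj : Set.InjOn (fun t => exp (-ω * t)) (Set.Ioi 0) := fun s _ t _ hst =>
    mul_left_cancel₀ (neg_ne_zero.2 hω.ne') (Real.exp_injective hst)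
  rw [greenKernel, ← image_exp_neg_mul_Ioi hω, integral_image_eq_integral_abs_deriv_smul
    measurableSet_Ioi (fun t _ => (hderiv t).hasDerivWithinAt) hinj, ← integral_const_mul]
  refine setIntegral_congr_fun measurableSet_Ioi fun t ht => ?_
  rw [← greenKernel_integrand_eq hω ht rfl, abs_mul, abs_neg, Real.abs_exp, abs_of_pos hω,
    smul_eq_mul]

theorem timeWeight_zero (lam t : ℝ) : timeWeight lam 0 t = ENNReal.ofReal (exp (-lam * t)) := by
  simp [timeWeight]

theorem greenKernel_eq_toReal {ω : ℝ} (hω : 0 < ω) (lam : ℝ) (z w : Config) :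
    greenKernel ω lam z w = (timeKernel ω (timeWeight lam 0) z w).toReal := by
  have hmeas : Measurable fun t => exp (-lam * t) * heatKernel ω t z w :=
    Measurable.fun_mul (by fun_prop) (measurable_heatKernel_time ω z w)
  have hnonneg :
      0 ≤ᵐ[volume.restrict (Set.Ioi 0)] fun t => exp (-lam * t) * heatKernel ω t z w := by
    filter_upwards [ae_restrict_mem measurableSet_Ioi] with t ht
    exact mul_nonneg (Real.exp_pos _).le (heatKernel_nonneg hω ht z w)
  rw [greenKernel_eq_integral hω, timeKernel,
    integral_eq_lintegral_of_nonneg_ae hnonneg hmeas.aestronglyMeasurable]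
  simp only [timeWeight_zero, ENNReal.ofReal_mul (Real.exp_pos _).le]

end Green

/-! ### Formal self-adjointness of the free Hamiltonian -/

section SecondDeriv

variable {E F : Type*} [NormedAddCommGroup E] [NormedSpace ℝ E] [NormedAddCommGroup F]
  [NormedSpace ℝ F] {φ : E → F}

/-- The second derivative of `φ` at `z` in the direction `v`. -/
noncomputable def secondDeriv (φ : E → F) (v z : E) : F :=
  fderiv ℝ (fun y => fderiv ℝ φ y v) z v

theorem contDiff_fderiv_apply (hφ : ContDiff ℝ 2 φ) (v : E) :
    ContDiff ℝ 1 fun y => fderiv ℝ φ y v :=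
  (hφ.fderiv_right (by norm_num)).clm_apply contDiff_const

theorem continuous_secondDeriv (hφ : ContDiff ℝ 2 φ) (v : E) : Continuous (secondDeriv φ v) :=
  ((contDiff_fderiv_apply hφ v).continuous_fderiv one_ne_zero).clm_apply continuous_const

theorem hasCompactSupport_secondDeriv (hsupp : HasCompactSupport φ) (v : E) :
    HasCompactSupport (secondDeriv φ v) :=
  (hsupp.fderiv_apply ℝ v).fderiv_apply ℝ v

theorem secondDeriv_comp {E' : Type*} [NormedAddCommGroup E'] [NormedSpace ℝ E'] {h : E' → E}
    {L : E' →L[ℝ] E} (hφ : ContDiff ℝ 2 φ) (hh : ∀ x, HasFDerivAt h L x) (v x : E') :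
    secondDeriv (fun x => φ (h x)) v x = secondDeriv φ (L v) (h x) := by
  have fderiv_comp_apply {g : E → F} (hg : Differentiable ℝ g) (y : E') :
      fderiv ℝ (fun x => g (h x)) y v = fderiv ℝ g (h y) (L v) := by
    have hcomp : HasFDerivAt (fun x => g (h x)) _ y := (hg (h y)).hasFDerivAt.comp y (hh y)
    rw [hcomp.fderiv, ContinuousLinearMap.comp_apply]
  simp only [secondDeriv, fderiv_comp_apply (hφ.differentiable two_ne_zero)]
  exact fderiv_comp_apply ((contDiff_fderiv_apply hφ _).differentiable one_ne_zero) x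

theorem laplacian_eq_sum_secondDeriv {V ι : Type*} [NormedAddCommGroup V] [InnerProductSpace ℝ V]
    [FiniteDimensional ℝ V] [Fintype ι] (b : OrthonormalBasis ι ℝ V) {f : V → F}
    (hf : ContDiff ℝ 2 f) (u : V) :
    Laplacian.laplacian f u = ∑ i, secondDeriv f (b i) u := by
  have hdiff : DifferentiableAt ℝ (fderiv ℝ f) u :=
    (hf.fderiv_right (m := 1) (by norm_num)).differentiable one_ne_zero u
  rw [InnerProductSpace.laplacian_eq_iteratedFDeriv_orthonormalBasis f b]
  refine Finset.sum_congr rfl fun i _ => ?_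
  rw [secondDeriv, iteratedFDeriv_two_apply, fderiv_clm_apply hdiff (differentiableAt_const _)]
  simp

variable {𝕜 : Type*} [RCLike 𝕜] [MeasurableSpace E] [BorelSpace E] {μ : Measure E}
  [μ.IsAddHaarMeasure] {f g : E → 𝕜}

theorem integrable_mul_secondDeriv (hf : Continuous f) (hg : ContDiff ℝ 2 g)
    (hsupp : HasCompactSupport g) (v : E) : Integrable (fun z => f z * secondDeriv g v z) μ :=
  (hf.mul (continuous_secondDeriv hg v)).integrable_of_hasCompactSupport
    (hasCompactSupport_secondDeriv hsupp v).mul_left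

theorem integrable_secondDeriv_mul (hf : ContDiff ℝ 2 f) (hg : Continuous g)
    (hsupp : HasCompactSupport g) (v : E) : Integrable (fun z => secondDeriv f v z * g z) μ :=
  ((continuous_secondDeriv hf v).mul hg).integrable_of_hasCompactSupport hsupp.mul_left

theorem integral_mul_secondDeriv [FiniteDimensional ℝ E] (hf : ContDiff ℝ 2 f)
    (hg : ContDiff ℝ 2 g) (hsupp : HasCompactSupport g) (v : E) :
    ∫ z, f z * secondDeriv g v z ∂μ = ∫ z, secondDeriv f v z * g z ∂μ := by
  have hf' := contDiff_fderiv_apply hf v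
  have hg' := contDiff_fderiv_apply hg v
  have hg'_supp : HasCompactSupport fun z => fderiv ℝ g z v := hsupp.fderiv_apply ℝ v
  have hf'g' : Integrable (fun z => fderiv ℝ f z v * fderiv ℝ g z v) μ :=
    (hf'.continuous.mul hg'.continuous).integrable_of_hasCompactSupport hg'_supp.mul_left
  have hfg' : Integrable (fun z => f z * fderiv ℝ g z v) μ :=
    (hf.continuous.mul hg'.continuous).integrable_of_hasCompactSupport hg'_supp.mul_left
  have hf'g : Integrable (fun z => fderiv ℝ f z v * g z) μ :=
    (hf'.continuous.mul hg.continuous).integrable_of_hasCompactSupport hsupp.mul_left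
  calc ∫ z, f z * secondDeriv g v z ∂μ
      = -∫ z, fderiv ℝ f z v * fderiv ℝ g z v ∂μ :=
        integral_mul_fderiv_eq_neg_fderiv_mul_of_integrable hf'g'
          (integrable_mul_secondDeriv hf.continuous hg hsupp v) hfg'
          (fun z _ => hf.differentiable two_ne_zero z)
          (fun z _ => hg'.differentiable one_ne_zero z)
    _ = ∫ z, secondDeriv f v z * g z ∂μ := by
        rw [integral_mul_fderiv_eq_neg_fderiv_mul_of_integrable
          (integrable_secondDeriv_mul hf hg.continuous hsupp v) hf'g' hf'g
          (fun z _ => hf'.differentiable one_ne_zero z)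
          (fun z _ => hg.differentiable two_ne_zero z), neg_neg]
        rfl

end SecondDeriv

section FreeHamiltonian

variable {f φ : Config → ℂ}

instance isAddHaarMeasure_volume_config : (volume : Measure Config).IsAddHaarMeasure :=
  inferInstanceAs ((volume : Measure Plane).prod (volume : Measure Plane)).IsAddHaarMeasure

/-- The four coordinate directions of the configuration space, those of the first plane first. -/
noncomputable def coordDir : Fin 2 ⊕ Fin 2 → Config :=
  Sum.elim (fun i => (EuclideanSpace.basisFun (Fin 2) ℝ i, 0))
    (fun i => (0, EuclideanSpace.basisFun (Fin 2) ℝ i))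

theorem freeHamiltonian_eq (ω : ℝ) (hφ : ContDiff ℝ 2 φ) (z : Config) :
    freeHamiltonian ω φ z = -(1 / 2 : ℂ) * ∑ j, secondDeriv φ (coordDir j) z +
      ((ω ^ 2 * ‖z.2‖ ^ 2 / 2 - ω : ℝ) : ℂ) * φ z := by
  have hslice₁ : ContDiff ℝ 2 fun x => φ (x, z.2) := hφ.comp (contDiff_prodMk_left z.2)
  have hslice₂ : ContDiff ℝ 2 fun y => φ (z.1, y) := hφ.comp (contDiff_prodMk_right z.1)
  rw [freeHamiltonian, laplacian_eq_sum_secondDeriv (EuclideanSpace.basisFun (Fin 2) ℝ) hslice₁,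
    laplacian_eq_sum_secondDeriv (EuclideanSpace.basisFun (Fin 2) ℝ) hslice₂]
  simp only [secondDeriv_comp hφ (fun x => hasFDerivAt_prodMk_left x z.2),
    secondDeriv_comp hφ (fun y => hasFDerivAt_prodMk_right z.1 y), Fintype.sum_sum_type, coordDir,
    Sum.elim_inl, Sum.elim_inr, ContinuousLinearMap.inl_apply, ContinuousLinearMap.inr_apply]
  ring

theorem continuous_freeHamiltonian (ω : ℝ) (hφ : ContDiff ℝ 2 φ) :
    Continuous (freeHamiltonian ω φ) := by
  have := continuous_secondDeriv hφ
  have := hφ.continuous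
  rw [funext (freeHamiltonian_eq ω hφ)]
  fun_prop

theorem hasCompactSupport_freeHamiltonian (ω : ℝ) (hφ : ContDiff ℝ 2 φ)
    (hsupp : HasCompactSupport φ) : HasCompactSupport (freeHamiltonian ω φ) := by
  have hsum : HasCompactSupport fun z => ∑ j, secondDeriv φ (coordDir j) z := by
    simpa only [Finset.sum_apply, Finset.sum_fn] using
      HasCompactSupport.finset_sum fun j _ => hasCompactSupport_secondDeriv hsupp (coordDir j)
  rw [funext (freeHamiltonian_eq ω hφ)]
  exact hsum.mul_left.add hsupp.mul_left

theorem integral_mul_freeHamiltonian (ω : ℝ) (hf : ContDiff ℝ 2 f) (hφ : ContDiff ℝ 2 φ)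
    (hsupp : HasCompactSupport φ) :
    ∫ z, f z * freeHamiltonian ω φ z = ∫ z, freeHamiltonian ω f z * φ z := by
  have hf_mul : Integrable fun z => f z * freeHamiltonian ω φ z :=
    (hf.continuous.mul (continuous_freeHamiltonian ω hφ)).integrable_of_hasCompactSupport
      (hasCompactSupport_freeHamiltonian ω hφ hsupp).mul_left
  have hmul_φ : Integrable fun z => freeHamiltonian ω f z * φ z :=
    ((continuous_freeHamiltonian ω hf).mul hφ.continuous).integrable_of_hasCompactSupport
      hsupp.mul_left
  have hdirection (v : Config) :
      Integrable fun z => f z * secondDeriv φ v z - secondDeriv f v z * φ z :=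
    (integrable_mul_secondDeriv hf.continuous hφ hsupp v).sub
      (integrable_secondDeriv_mul hf hφ.continuous hsupp v)
  have hdiff (z : Config) : f z * freeHamiltonian ω φ z - freeHamiltonian ω f z * φ z =
      -(1 / 2 : ℂ) * ∑ j, (f z * secondDeriv φ (coordDir j) z -
        secondDeriv f (coordDir j) z * φ z) := by
    rw [freeHamiltonian_eq ω hφ, freeHamiltonian_eq ω hf, Finset.sum_sub_distrib,
      ← Finset.mul_sum, ← Finset.sum_mul]
    ring
  rw [← sub_eq_zero, ← integral_sub hf_mul hmul_φ]
  simp only [hdiff]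
  rw [integral_const_mul, integral_finsetSum _ fun j _ => hdirection _,
    Finset.sum_eq_zero, mul_zero]
  intro j _
  rw [integral_sub (integrable_mul_secondDeriv hf.continuous hφ hsupp _)
    (integrable_secondDeriv_mul hf hφ.continuous hsupp _),
    integral_mul_secondDeriv hf hφ hsupp, sub_self]

end FreeHamiltonian

/-! ### The heat equation -/

section HeatEquation

open Module (finrank)
open Real (exp sinh cosh)

variable {V : Type*} [NormedAddCommGroup V] [InnerProductSpace ℝ V]

theorem contDiffOn_gaussKernel {E : Type*} [NormedAddCommGroup E] [NormedSpace ℝ E]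
    {n : WithTop ℕ∞} {s : Set E} {c α β : E → ℝ} {f : E → V} (hc : ContDiffOn ℝ n c s)
    (hα : ContDiffOn ℝ n α s) (hβ : ContDiffOn ℝ n β s) (hf : ContDiffOn ℝ n f s) (v : V) :
    ContDiffOn ℝ n (fun q => gaussKernel (c q) (α q) (β q) (f q) v) s :=
  hc.mul ((hα.neg.mul ((hf.norm_sq ℝ).add contDiffOn_const)).add
    ((contDiffOn_const.mul hβ).mul (hf.inner ℝ contDiffOn_const))).exp

theorem contDiff_gaussKernel {n : WithTop ℕ∞} (c α β : ℝ) (v : V) :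
    ContDiff ℝ n fun u => gaussKernel c α β u v :=
  contDiffOn_univ.1 (contDiffOn_gaussKernel contDiffOn_const contDiffOn_const contDiffOn_const
    contDiffOn_id v)

theorem fderiv_gaussKernel_apply (c α β : ℝ) (u v e : V) :
    fderiv ℝ (fun u => gaussKernel c α β u v) u e =
      gaussKernel c α β u v * inner ℝ ((2 * β) • v - (2 * α) • u) e := by
  have hexponent := ((((hasFDerivAt_id u).norm_sq).add_const (‖v‖ ^ 2)).const_mul (-α)).add
    (((hasFDerivAt_id u).inner ℝ (hasFDerivAt_const v u)).const_mul (2 * β))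
  have hderiv : HasFDerivAt (fun u => gaussKernel c α β u v) _ u := hexponent.exp.const_mul c
  rw [hderiv.fderiv, gaussKernel, inner_sub_left, real_inner_smul_left, real_inner_smul_left,
    real_inner_comm e v]
  simp
  ring

theorem secondDeriv_gaussKernel (c α β : ℝ) (u v e : V) :
    secondDeriv (fun u => gaussKernel c α β u v) e u =
      gaussKernel c α β u v * (inner ℝ ((2 * β) • v - (2 * α) • u) e ^ 2 - 2 * α * ‖e‖ ^ 2) := by
  have hkernel : DifferentiableAt ℝ (fun u => gaussKernel c α β u v) u :=
    (contDiff_gaussKernel (n := 1) c α β v).differentiable one_ne_zero u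
  have hinner : HasFDerivAt (fun u => inner ℝ ((2 * β) • v - (2 * α) • u) e) _ u :=
    (((hasFDerivAt_id u).const_smul (2 * α)).const_sub _).inner ℝ (hasFDerivAt_const e u)
  simp only [secondDeriv, fderiv_gaussKernel_apply]
  rw [fderiv_fun_mul hkernel hinner.differentiableAt, hinner.fderiv]
  simp [fderiv_gaussKernel_apply, real_inner_smul_left]
  ring

theorem laplacian_gaussKernel [FiniteDimensional ℝ V] (c α β : ℝ) (u v : V) :
    Laplacian.laplacian (fun u => gaussKernel c α β u v) u =
      gaussKernel c α β u v * (‖(2 * β) • v - (2 * α) • u‖ ^ 2 - 2 * α * finrank ℝ V) := by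
  rw [laplacian_eq_sum_secondDeriv (stdOrthonormalBasis ℝ V) (contDiff_gaussKernel c α β v)]
  simp only [secondDeriv_gaussKernel, OrthonormalBasis.norm_eq_one, ← Finset.mul_sum,
    Finset.sum_sub_distrib, OrthonormalBasis.sum_sq_inner_left]
  simp [mul_comm]

theorem hasDerivAt_gaussKernel {c α β : ℝ → ℝ} {γ α' β' t : ℝ}
    (hc : HasDerivAt c (c t * γ) t) (hα : HasDerivAt α α' t) (hβ : HasDerivAt β β' t) (u v : V) :
    HasDerivAt (fun t => gaussKernel (c t) (α t) (β t) u v)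
      (gaussKernel (c t) (α t) (β t) u v *
        (γ - α' * (‖u‖ ^ 2 + ‖v‖ ^ 2) + 2 * β' * inner ℝ u v)) t := by
  have hexponent := (hα.neg.mul_const (‖u‖ ^ 2 + ‖v‖ ^ 2)).add
    ((hβ.const_mul 2).mul_const (inner ℝ u v))
  have hderiv : HasDerivAt (fun t => gaussKernel (c t) (α t) (β t) u v) _ t :=
    hc.mul hexponent.exp
  convert! hderiv using 1
  simp only [gaussKernel, Pi.add_apply, Pi.neg_apply]
  ring

theorem hasDerivAt_rpow_const_of_pos {f : ℝ → ℝ} {f' t : ℝ} (hf : HasDerivAt f f' t)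
    (hpos : 0 < f t) (p : ℝ) :
    HasDerivAt (fun t => f t ^ p) (f t ^ p * (p * (f' / f t))) t := by
  convert! hf.rpow_const (p := p) (.inl hpos.ne') using 1
  rw [Real.rpow_sub_one hpos.ne']
  ring

theorem hasDerivAt_freeHeatKernel [FiniteDimensional ℝ V] {t : ℝ} (ht : 0 < t) (u v : V) :
    HasDerivAt (fun t => freeHeatKernel t u v)
      (1 / 2 * Laplacian.laplacian (fun u => freeHeatKernel t u v) u) t := by
  have hmul : HasDerivAt (fun t : ℝ => 2 * Real.pi * t) (2 * Real.pi) t := by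
    simpa using (hasDerivAt_id t).const_mul (2 * Real.pi)
  have hprefactor : HasDerivAt (fun t : ℝ => 1 / (2 * Real.pi * t))
      (-(2 * Real.pi) / (2 * Real.pi * t) ^ 2) t := by
    simpa using hmul.fun_inv (by positivity)
  have hrate : HasDerivAt (fun t : ℝ => 1 / (2 * t)) (-2 / (2 * t) ^ 2) t := by
    simpa using ((hasDerivAt_id t).const_mul 2).fun_inv (by simp [ht.ne'])
  have hderiv := hasDerivAt_gaussKernel
    (hasDerivAt_rpow_const_of_pos hprefactor (by positivity) (finrank ℝ V / 2)) hrate hrate u v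
  convert! hderiv using 1
  simp only [freeHeatKernel, laplacian_gaussKernel]
  rw [norm_sub_sq_real, norm_smul, norm_smul, mul_pow, mul_pow, real_inner_smul_left,
    real_inner_smul_right, real_inner_comm, Real.norm_eq_abs, sq_abs]
  field_simp
  ring

theorem hasDerivAt_mehlerKernel [FiniteDimensional ℝ V] {κ s : ℝ} (hκ : 0 < κ) (hs : 0 < s)
    (u v : V) :
    HasDerivAt (fun s => mehlerKernel κ s u v)
      (1 / (2 * κ) * Laplacian.laplacian (fun u => mehlerKernel κ s u v) u -
        κ / 2 * ‖u‖ ^ 2 * mehlerKernel κ s u v) s := by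
  have hsinh : 0 < sinh s := Real.sinh_pos_iff.2 hs
  have hprefactor : HasDerivAt (fun s : ℝ => κ / (2 * Real.pi * sinh s))
      (-(κ * (2 * Real.pi * cosh s)) / (2 * Real.pi * sinh s) ^ 2) s := by
    simpa using (hasDerivAt_const s κ).fun_div
      ((Real.hasDerivAt_sinh s).const_mul (2 * Real.pi)) (by positivity)
  have hα : HasDerivAt (fun s : ℝ => κ / 2 * (cosh s / sinh s)) (-(κ / 2) / sinh s ^ 2) s := by
    convert! ((Real.hasDerivAt_cosh s).fun_div (Real.hasDerivAt_sinh s)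
      hsinh.ne').const_mul (κ / 2) using 1
    rw [show sinh s * sinh s - cosh s * cosh s = -1 by linarith [Real.cosh_sq s]]
    ring
  have hβ : HasDerivAt (fun s : ℝ => κ / (2 * sinh s))
      (-(κ * (2 * cosh s)) / (2 * sinh s) ^ 2) s := by
    simpa using (hasDerivAt_const s κ).fun_div
      ((Real.hasDerivAt_sinh s).const_mul 2) (by positivity)
  have hderiv := hasDerivAt_gaussKernel
    (hasDerivAt_rpow_const_of_pos hprefactor (by positivity) (finrank ℝ V / 2)) hα hβ u v
  convert! hderiv using 1
  simp only [mehlerKernel, laplacian_gaussKernel]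
  rw [norm_sub_sq_real, norm_smul, norm_smul, mul_pow, mul_pow, real_inner_smul_left,
    real_inner_smul_right, real_inner_comm, Real.norm_eq_abs, Real.norm_eq_abs, sq_abs, sq_abs]
  field_simp
  rw [Real.cosh_sq]
  ring

theorem laplacian_ofReal_mul_const [FiniteDimensional ℝ V] {g : V → ℝ} {u : V}
    (hg : ContDiffAt ℝ 2 g u) (a : ℝ) :
    Laplacian.laplacian (fun x => ((g x * a : ℝ) : ℂ)) u =
      ((Laplacian.laplacian g u * a : ℝ) : ℂ) := by
  have hcomp : (fun x => ((g x * a : ℝ) : ℂ)) = (a • Complex.ofRealCLM) ∘ g := by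
    ext x
    simp [mul_comm]
  rw [hcomp, hg.laplacian_CLM_comp_left]
  simp [mul_comm]

theorem contDiff_heatKernel {n : WithTop ℕ∞} (ω t : ℝ) (w : Config) :
    ContDiff ℝ n fun z => heatKernel ω t z w :=
  ((contDiff_gaussKernel _ _ _ w.1).comp contDiff_fst).mul
    (contDiff_const.mul ((contDiff_gaussKernel _ _ _ w.2).comp contDiff_snd))

theorem hasDerivAt_heatKernel {ω t : ℝ} (hω : 0 < ω) (ht : 0 < t) (z w : Config) :
    HasDerivAt (fun t => (heatKernel ω t z w : ℂ))
      (-freeHamiltonian ω (fun z => (heatKernel ω t z w : ℂ)) z) t := by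
  have hωt : HasDerivAt (fun t => ω * t) ω t := by
    simpa using (hasDerivAt_id t).const_mul ω
  have hderiv := (hasDerivAt_freeHeatKernel ht z.1 w.1).mul
    (hωt.exp.mul ((hasDerivAt_mehlerKernel hω (mul_pos hω ht) z.2 w.2).comp t hωt))
  have hslice₁ := laplacian_ofReal_mul_const (u := z.1)
    (g := fun x => freeHeatKernel t x w.1) (contDiff_gaussKernel _ _ _ w.1).contDiffAt
    (exp (ω * t) * mehlerKernel ω (ω * t) z.2 w.2)
  have hslice₂ := laplacian_ofReal_mul_const (u := z.2)
    (g := fun y => mehlerKernel ω (ω * t) y w.2) (contDiff_gaussKernel _ _ _ w.2).contDiffAt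
    (freeHeatKernel t z.1 w.1 * exp (ω * t))
  have hrearrange (y : Plane) : heatKernel ω t (z.1, y) w =
      mehlerKernel ω (ω * t) y w.2 * (freeHeatKernel t z.1 w.1 * exp (ω * t)) := by
    rw [heatKernel]
    ring
  have hω_ne : (ω : ℂ) ≠ 0 := Complex.ofReal_ne_zero.2 hω.ne'
  convert! hderiv.ofReal_comp using 1
  simp only [freeHamiltonian, hrearrange]
  rw [hslice₂]
  simp only [heatKernel, hslice₁, Pi.mul_apply, Function.comp_apply]
  push_cast
  field_simp
  ring

theorem contDiffOn_heatKernel {ω : ℝ} (hω : 0 < ω) (w : Config) :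
    ContDiffOn ℝ 1 (fun q : ℝ × Config => heatKernel ω q.1 q.2 w) (Set.Ioi 0 ×ˢ Set.univ) := by
  have hsinh_ne (q : ℝ × Config) (hq : q ∈ Set.Ioi (0 : ℝ) ×ˢ Set.univ) : sinh (ω * q.1) ≠ 0 :=
    (Real.sinh_pos_iff.2 (mul_pos hω hq.1)).ne'
  have : ContDiffOn ℝ 1 (fun q : ℝ × Config => q.1⁻¹) (Set.Ioi 0 ×ˢ Set.univ) :=
    contDiffOn_fst.inv fun q hq => ne_of_gt hq.1
  have : ContDiffOn ℝ 1 (fun q : ℝ × Config => (sinh (ω * q.1))⁻¹)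
      (Set.Ioi 0 ×ˢ Set.univ) := ContDiffOn.inv (by fun_prop) hsinh_ne
  simp only [heatKernel, freeHeatKernel, mehlerKernel, finrank_plane_div_two, Real.rpow_one]
  simp only [div_eq_mul_inv, mul_inv]
  refine (contDiffOn_gaussKernel ?_ ?_ ?_ ?_ _).mul
    (ContDiffOn.mul ?_ (contDiffOn_gaussKernel ?_ ?_ ?_ ?_ _)) <;> fun_prop

end HeatEquation

/-! ### The heat flow -/

section Rescaling

open Module (finrank)
open Real (exp sinh cosh)

variable {V W F : Type*} [NormedAddCommGroup V] [InnerProductSpace ℝ V]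

theorem freeHeatKernel_add_sqrt_smul {t : ℝ} (ht : 0 < t) (u v : V) :
    freeHeatKernel t (v + √t • u) v = |(√t ^ finrank ℝ V)⁻¹| * freeHeatKernel 1 u 0 := by
  have hprefactor : (1 / (2 * Real.pi * t)) ^ (finrank ℝ V / 2 : ℝ) =
      |(√t ^ finrank ℝ V)⁻¹| * (1 / (2 * Real.pi * 1)) ^ (finrank ℝ V / 2 : ℝ) := by
    rw [abs_of_pos (by positivity), Real.sqrt_eq_rpow, ← Real.rpow_mul_natCast ht.le,
      ← Real.rpow_neg ht.le, one_div, one_div, mul_inv, mul_one,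
      Real.mul_rpow (by positivity) (by positivity), Real.inv_rpow ht.le, ← Real.rpow_neg ht.le]
    ring_nf
  rw [freeHeatKernel_eq, freeHeatKernel_eq, hprefactor, add_sub_cancel_left, norm_smul, mul_pow,
    Real.norm_eq_abs, sq_abs, Real.sq_sqrt ht.le, sub_zero, mul_assoc]
  field_simp

variable [FiniteDimensional ℝ V] [MeasurableSpace V] [BorelSpace V]

theorem integrable_freeHeatKernel {t : ℝ} (ht : 0 < t) (v : V) :
    Integrable fun u => freeHeatKernel t u v := by
  have hcont : Continuous fun u => freeHeatKernel t u v :=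
    (continuous_gaussKernel _ _ _).comp (Continuous.prodMk_left v)
  refine ⟨hcont.aestronglyMeasurable, ?_⟩
  rw [hasFiniteIntegral_iff_ofReal (.of_forall fun u => freeHeatKernel_nonneg ht u v)]
  simp only [freeHeatKernel_comm t _ v, lintegral_freeHeatKernel ht, ENNReal.one_lt_top]

theorem integral_freeHeatKernel {t : ℝ} (ht : 0 < t) (v : V) :
    ∫ u, freeHeatKernel t u v = 1 := by
  rw [integral_eq_lintegral_of_nonneg_ae (.of_forall fun u => freeHeatKernel_nonneg ht u v)
    (integrable_freeHeatKernel ht v).aestronglyMeasurable]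
  simp only [freeHeatKernel_comm t _ v, lintegral_freeHeatKernel ht, ENNReal.toReal_one]

variable [NormedAddCommGroup W] [InnerProductSpace ℝ W] [FiniteDimensional ℝ W]
  [MeasurableSpace W] [BorelSpace W] [NormedAddCommGroup F] [NormedSpace ℝ F]

theorem integral_prod_comp_smul {a b : ℝ} (ha : a ≠ 0) (hb : b ≠ 0) (f : V × W → F) :
    ∫ z : V × W, f (a • z.1, b • z.2) =
      (|(a ^ finrank ℝ V)⁻¹| * |(b ^ finrank ℝ W)⁻¹|) • ∫ z, f z := by
  have hmap : Measure.map (Prod.map (fun x : V => a • x) fun y : W => b • y) volume =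
      ENNReal.ofReal |(a ^ finrank ℝ V)⁻¹| • ENNReal.ofReal |(b ^ finrank ℝ W)⁻¹| • volume := by
    rw [Measure.volume_eq_prod, ← Measure.map_prod_map _ _ (measurable_const_smul a)
      (measurable_const_smul b), Measure.map_addHaar_smul _ ha, Measure.map_addHaar_smul _ hb,
      Measure.prod_smul_left, Measure.prod_smul_right]
  have hemb : MeasurableEmbedding (Prod.map (fun x : V => a • x) fun y : W => b • y) :=
    ((Homeomorph.smulOfNeZero a ha).prodCongr (Homeomorph.smulOfNeZero b hb)).measurableEmbedding
  have hintegral := hemb.integral_map (μ := volume) f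
  rw [hmap, integral_smul_measure, integral_smul_measure, ENNReal.toReal_ofReal (abs_nonneg _),
    ENNReal.toReal_ofReal (abs_nonneg _), smul_smul] at hintegral
  exact hintegral.symm

theorem integral_freeHeatKernel_mul_freeHeatKernel_smul {s t : ℝ} (hs : 0 < s) (ht : 0 < t)
    (v : V × W) (f : V × W → F) :
    ∫ z : V × W, (freeHeatKernel s z.1 v.1 * freeHeatKernel t z.2 v.2) • f z =
      ∫ ζ : V × W, (freeHeatKernel 1 ζ.1 0 * freeHeatKernel 1 ζ.2 0) •
        f (v + (√s • ζ.1, √t • ζ.2)) := by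
  have hscale_pos : 0 < |(√s ^ finrank ℝ V)⁻¹| * |(√t ^ finrank ℝ W)⁻¹| := by positivity
  have hrescaled := integral_prod_comp_smul (Real.sqrt_ne_zero'.2 hs) (Real.sqrt_ne_zero'.2 ht)
    fun z : V × W => (freeHeatKernel s (v + z).1 v.1 * freeHeatKernel t (v + z).2 v.2) • f (v + z)
  simp only [Prod.fst_add, Prod.snd_add, freeHeatKernel_add_sqrt_smul hs,
    freeHeatKernel_add_sqrt_smul ht, mul_mul_mul_comm, mul_smul _ _ (f _), integral_smul]
    at hrescaled
  rw [smul_right_injective F hscale_pos.ne' |>.eq_iff] at hrescaled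
  have : (volume : Measure (V × W)).IsAddLeftInvariant :=
    inferInstanceAs ((volume : Measure V).prod (volume : Measure W)).IsAddLeftInvariant
  simp only [mul_smul]
  rw [hrescaled, ← integral_add_left_eq_self _ v]
  simp only [Prod.fst_add, Prod.snd_add]

end Rescaling

section HeatFlow

open scoped Topology ENNReal
open Filter (Tendsto)
open Real (exp sinh cosh)

variable {ω t : ℝ} {φ ψ : Config → ℂ}

theorem cosh_sub_one_div_sinh (s : ℝ) : (cosh s - 1) / sinh s = sinh s / (cosh s + 1) := by
  have : 0 < cosh s := Real.cosh_pos s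
  rcases eq_or_ne (sinh s) 0 with hsinh | hsinh
  · simp [hsinh]
  · rw [div_eq_div_iff hsinh (by positivity)]
    linear_combination Real.cosh_sq s

theorem heatKernel_eq (hω : 0 < ω) (ht : 0 < t) (z w : Config) :
    heatKernel ω t z w = freeHeatKernel t z.1 w.1 * freeHeatKernel (sinh (ω * t) / ω) z.2 w.2 *
      exp (ω * t - ω / 2 * (sinh (ω * t) / (cosh (ω * t) + 1)) * (‖z.2‖ ^ 2 + ‖w.2‖ ^ 2)) := by
  have : 0 < sinh (ω * t) := Real.sinh_pos_iff.2 (mul_pos hω ht)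
  rw [heatKernel, mehlerKernel_eq, freeHeatKernel_eq (sinh (ω * t) / ω), finrank_plane_div_two,
    Real.rpow_one, Real.rpow_one, cosh_sub_one_div_sinh]
  simp only [Real.exp_sub, neg_mul, Real.exp_neg]
  field_simp

/-- The value at `w` of the heat flow `exp (-t H₀) φ`. -/
noncomputable def heatFlow (ω : ℝ) (φ : Config → ℂ) (w : Config) (t : ℝ) : ℂ :=
  ∫ z, (heatKernel ω t z w : ℂ) * φ z

theorem lintegral_enorm_heatKernel_mul_le (hω : 0 < ω) (ht : 0 < t) {M : ℝ} (hM : ∀ z, ‖φ z‖ ≤ M)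
    (w : Config) : ∫⁻ z, ‖(heatKernel ω t z w : ℂ) * φ z‖ₑ ≤ ENNReal.ofReal (2 * M) := by
  have henorm (z : Config) : ‖(heatKernel ω t z w : ℂ) * φ z‖ₑ ≤
      ENNReal.ofReal (heatKernel ω t w z) * ENNReal.ofReal M := by
    rw [← ofReal_norm, norm_mul, Complex.norm_of_nonneg (heatKernel_nonneg hω ht _ _),
      heatKernel_comm, ENNReal.ofReal_mul (heatKernel_nonneg hω ht _ _)]
    gcongr
    exact hM z
  calc ∫⁻ z, ‖(heatKernel ω t z w : ℂ) * φ z‖ₑ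
      ≤ (∫⁻ z, ENNReal.ofReal (heatKernel ω t w z)) * ENNReal.ofReal M :=
        (lintegral_mono henorm).trans_eq (lintegral_mul_const' _ _ ENNReal.ofReal_ne_top)
    _ ≤ 2 * ENNReal.ofReal M := by
        gcongr
        exact lintegral_heatKernel_le hω ht w
    _ = ENNReal.ofReal (2 * M) := by
        rw [ENNReal.ofReal_mul zero_le_two, ENNReal.ofReal_ofNat]

theorem norm_heatFlow_le (hω : 0 < ω) (ht : 0 < t) {M : ℝ} (hM : ∀ z, ‖φ z‖ ≤ M) (w : Config) :
    ‖heatFlow ω φ w t‖ ≤ 2 * M := by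
  have hM_nonneg : 0 ≤ M := (norm_nonneg _).trans (hM 0)
  have h := (enorm_integral_le_lintegral_enorm _).trans
    (lintegral_enorm_heatKernel_mul_le hω ht hM w)
  rw [← ofReal_norm] at h
  exact (ENNReal.ofReal_le_ofReal_iff (by positivity)).1 h

theorem integrable_heatKernel_mul (ω t : ℝ) (w : Config) (hφ : Continuous φ)
    (hsupp : HasCompactSupport φ) : Integrable fun z => (heatKernel ω t z w : ℂ) * φ z :=
  ((Complex.continuous_ofReal.comp (contDiff_heatKernel (n := 0) ω t w).continuous).mul
    hφ).integrable_of_hasCompactSupport hsupp.mul_left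

theorem heatFlow_eq_integral_rescaled (hω : 0 < ω) (ht : 0 < t) (φ : Config → ℂ) (w : Config) :
    heatFlow ω φ w t = ∫ ζ : Config, (freeHeatKernel 1 ζ.1 0 * freeHeatKernel 1 ζ.2 0) •
      exp (ω * t - ω / 2 * (sinh (ω * t) / (cosh (ω * t) + 1)) *
        (‖w.2 + √(sinh (ω * t) / ω) • ζ.2‖ ^ 2 + ‖w.2‖ ^ 2)) •
      φ (w + (√t • ζ.1, √(sinh (ω * t) / ω) • ζ.2)) := by
  have hsinh : 0 < sinh (ω * t) := Real.sinh_pos_iff.2 (mul_pos hω ht)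
  have hrescaled := integral_freeHeatKernel_mul_freeHeatKernel_smul ht (div_pos hsinh hω) w
    fun z : Config => exp (ω * t - ω / 2 * (sinh (ω * t) / (cosh (ω * t) + 1)) *
      (‖z.2‖ ^ 2 + ‖w.2‖ ^ 2)) • φ z
  simp only [Prod.snd_add, Complex.real_smul, ← mul_assoc, ← Complex.ofReal_mul] at hrescaled ⊢
  simpa only [heatFlow, heatKernel_eq hω ht] using hrescaled

theorem tendsto_integral_smul_of_bounded {X E : Type*} [TopologicalSpace X] [MeasurableSpace X]
    [OpensMeasurableSpace X] [SecondCountableTopology X] [NormedAddCommGroup E] [NormedSpace ℝ E]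
    {μ : Measure X} {weight : X → ℝ} (hweight_nonneg : ∀ x, 0 ≤ weight x)
    (hweight : Integrable weight μ) {F : ℝ → X → E} (hF : Continuous (Function.uncurry F)) {C : ℝ}
    (hC : ∀ t ∈ Set.Ioo (0 : ℝ) 1, ∀ x, ‖F t x‖ ≤ C) :
    Tendsto (fun t => ∫ x, weight x • F t x ∂μ) (𝓝[>] 0) (𝓝 (∫ x, weight x • F 0 x ∂μ)) := by
  refine tendsto_integral_filter_of_dominated_convergence (fun x => weight x * C)
    (.of_forall fun t => ?_) ?_ (hweight.mul_const _) (.of_forall fun x => ?_)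
  · exact hweight.aestronglyMeasurable.smul
      (hF.comp (Continuous.prodMk_right t)).aestronglyMeasurable
  · filter_upwards [Ioo_mem_nhdsGT one_pos] with t ht
    refine .of_forall fun x => ?_
    rw [norm_smul, Real.norm_of_nonneg (hweight_nonneg x)]
    exact mul_le_mul_of_nonneg_left (hC t ht x) (hweight_nonneg x)
  · have hcont : Continuous fun t => F t x := hF.comp (Continuous.prodMk_left x)
    exact ((hcont.tendsto 0).mono_left nhdsWithin_le_nhds).const_smul _

theorem continuous_sinh_div_cosh_add_one (ω : ℝ) :
    Continuous fun t => sinh (ω * t) / (cosh (ω * t) + 1) :=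
  (Real.continuous_sinh.comp (by fun_prop)).div
    ((Real.continuous_cosh.comp (by fun_prop)).add continuous_const) fun t =>
      (add_pos (Real.cosh_pos _) one_pos).ne'

theorem tendsto_heatFlow (hω : 0 < ω) (hφ : Continuous φ) {M : ℝ} (hM : ∀ z, ‖φ z‖ ≤ M)
    (w : Config) : Tendsto (heatFlow ω φ w) (𝓝[>] 0) (𝓝 (φ w)) := by
  set weight : Config → ℝ := fun ζ => freeHeatKernel 1 ζ.1 0 * freeHeatKernel 1 ζ.2 0
  set F : ℝ → Config → ℂ := fun t ζ => exp (ω * t - ω / 2 * (sinh (ω * t) / (cosh (ω * t) + 1)) *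
    (‖w.2 + √(sinh (ω * t) / ω) • ζ.2‖ ^ 2 + ‖w.2‖ ^ 2)) •
      φ (w + (√t • ζ.1, √(sinh (ω * t) / ω) • ζ.2)) with hF
  have hweight_nonneg (ζ : Config) : 0 ≤ weight ζ :=
    mul_nonneg (freeHeatKernel_nonneg one_pos _ _) (freeHeatKernel_nonneg one_pos _ _)
  have hweight_integrable : Integrable weight :=
    (integrable_freeHeatKernel one_pos 0).mul_prod (integrable_freeHeatKernel one_pos 0)
  have hweight_integral : ∫ ζ, weight ζ = 1 := by
    rw [Measure.volume_eq_prod, integral_prod_mul (fun x : Plane => freeHeatKernel 1 x 0)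
      (fun y : Plane => freeHeatKernel 1 y 0), integral_freeHeatKernel one_pos, mul_one]
  have hF_le : ∀ t ∈ Set.Ioo (0 : ℝ) 1, ∀ ζ, ‖F t ζ‖ ≤ exp ω * M := fun t ht ζ => by
    have : 0 < sinh (ω * t) := Real.sinh_pos_iff.2 (mul_pos hω ht.1)
    have : 0 < cosh (ω * t) := Real.cosh_pos _
    have hdecay : 0 ≤ ω / 2 * (sinh (ω * t) / (cosh (ω * t) + 1)) *
      (‖w.2 + √(sinh (ω * t) / ω) • ζ.2‖ ^ 2 + ‖w.2‖ ^ 2) := by positivity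
    rw [hF, norm_smul, Real.norm_eq_abs, Real.abs_exp]
    gcongr
    · linarith [mul_lt_of_lt_one_right hω ht.2]
    · exact hM _
  have hF_zero (ζ : Config) : F 0 ζ = φ w := by
    simp [hF, ← Prod.zero_eq_mk]
  have hF_cont : Continuous (Function.uncurry F) := by
    have : Continuous fun q : ℝ × Config => sinh (ω * q.1) :=
      Real.continuous_sinh.comp (by fun_prop)
    have : Continuous fun q : ℝ × Config => sinh (ω * q.1) / (cosh (ω * q.1) + 1) :=
      (continuous_sinh_div_cosh_add_one ω).comp continuous_fst
    simp only [hF]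
    fun_prop
  have hlim := tendsto_integral_smul_of_bounded hweight_nonneg hweight_integrable hF_cont hF_le
  simp only [hF_zero] at hlim
  rw [integral_smul_const, hweight_integral, one_smul] at hlim
  refine hlim.congr' ?_
  filter_upwards [self_mem_nhdsWithin] with t ht
  rw [heatFlow_eq_integral_rescaled hω ht]

theorem exists_norm_freeHamiltonian_heatKernel_le (hω : 0 < ω) {a b : ℝ} (ha : 0 < a)
    (w : Config) {K : Set Config} (hK : IsCompact K) : ∃ M : ℝ, ∀ t ∈ Set.Icc a b, ∀ z ∈ K,
      ‖freeHamiltonian ω (fun z => (heatKernel ω t z w : ℂ)) z‖ ≤ M := by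
  set Φ : ℝ × Config → ℝ := fun q => heatKernel ω q.1 q.2 w
  have hopen : IsOpen (Set.Ioi (0 : ℝ) ×ˢ (Set.univ : Set Config)) := isOpen_Ioi.prod isOpen_univ
  have hsubset : Set.Icc a b ×ˢ K ⊆ Set.Ioi (0 : ℝ) ×ˢ Set.univ := fun q hq =>
    ⟨ha.trans_le hq.1.1, Set.mem_univ _⟩
  have hsmooth : ContDiffOn ℝ 1 Φ (Set.Ioi (0 : ℝ) ×ˢ Set.univ) := contDiffOn_heatKernel hω w
  obtain ⟨M, hM⟩ := (isCompact_Icc.prod hK).exists_bound_of_continuousOn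
    ((hsmooth.continuousOn_fderiv_of_isOpen hopen le_rfl).mono hsubset)
  refine ⟨M * ‖((1 : ℝ), (0 : Config))‖, fun t ht z hz => ?_⟩
  have hmem : (t, z) ∈ Set.Ioi (0 : ℝ) ×ˢ Set.univ := hsubset ⟨ht, hz⟩
  have hdiff : HasFDerivAt Φ (fderiv ℝ Φ (t, z)) (t, z) :=
    ((hsmooth.differentiableOn one_ne_zero).differentiableAt (hopen.mem_nhds hmem)).hasFDerivAt
  have hpath : HasDerivAt (fun t => (t, z)) ((1 : ℝ), (0 : Config)) t :=
    (hasDerivAt_id t).prodMk (hasDerivAt_const t z)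
  have hdiff_time : HasDerivAt (fun t => heatKernel ω t z w) (fderiv ℝ Φ (t, z) (1, 0)) t :=
    HasFDerivAt.comp_hasDerivAt (f := fun t => (t, z)) t hdiff hpath
  have heq : -freeHamiltonian ω (fun z => (heatKernel ω t z w : ℂ)) z =
      (fderiv ℝ Φ (t, z) (1, 0) : ℂ) :=
    (hasDerivAt_heatKernel hω hmem.1 z w).unique hdiff_time.ofReal_comp
  rw [← norm_neg, heq, Complex.norm_real]
  exact (ContinuousLinearMap.le_opNorm _ _).trans
    (mul_le_mul_of_nonneg_right (hM _ ⟨ht, hz⟩) (norm_nonneg _))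

theorem hasDerivAt_heatFlow (hω : 0 < ω) (ht : 0 < t) (hφ : ContDiff ℝ 2 φ)
    (hsupp : HasCompactSupport φ) (w : Config) :
    HasDerivAt (heatFlow ω φ w) (-heatFlow ω (freeHamiltonian ω φ) w t) t := by
  have hheat (s : ℝ) : ContDiff ℝ 2 fun z => (heatKernel ω s z w : ℂ) :=
    Complex.ofRealCLM.contDiff.comp (contDiff_heatKernel ω s w)
  obtain ⟨M, hM⟩ := exists_norm_freeHamiltonian_heatKernel_le (b := 2 * t) hω (half_pos ht) w
    hsupp.isCompact
  have hderiv := (hasDerivAt_integral_of_dominated_loc_of_deriv_le (μ := volume)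
    (F := fun s z => (heatKernel ω s z w : ℂ) * φ z) (bound := fun z => M * ‖φ z‖)
    (F' := fun s z => -freeHamiltonian ω (fun z => (heatKernel ω s z w : ℂ)) z * φ z)
    (Ioo_mem_nhds (half_lt_self ht) (by linarith : t < 2 * t))
    (.of_forall fun s => ((hheat s).continuous.mul hφ.continuous).aestronglyMeasurable)
    (integrable_heatKernel_mul ω t w hφ.continuous hsupp)
    ((continuous_freeHamiltonian ω (hheat t)).neg.mul hφ.continuous).aestronglyMeasurable
    (.of_forall fun z s hs => ?_)
    ((hφ.continuous.integrable_of_hasCompactSupport hsupp).norm.const_mul _)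
    (.of_forall fun z s hs =>
      (hasDerivAt_heatKernel hω ((half_pos ht).trans hs.1) z w).mul_const (φ z))).2
  · simp only [neg_mul, integral_neg, ← integral_mul_freeHamiltonian ω (hheat t) hφ hsupp]
      at hderiv
    exact hderiv
  · by_cases hz : z ∈ tsupport φ
    · rw [norm_mul, norm_neg]
      gcongr
      exact hM s (Set.Ioo_subset_Icc_self hs) z hz
    · simp [image_eq_zero_of_notMem_tsupport hz]

end HeatFlow

/-! ### The resolvent -/

section Resolvent

open scoped Topology ENNReal
open Filter (Tendsto)
open Real (exp)

attribute [local irreducible] heatKernel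

variable {ω lam : ℝ} {φ ψ : Config → ℂ}

theorem integrable_exp_mul_heatKernel_mul (hω : 0 < ω) (hlam : 0 < lam) (hψ : Continuous ψ)
    {M : ℝ} (hM : ∀ z, ‖ψ z‖ ≤ M) (w : Config) :
    Integrable (Function.uncurry fun (t : ℝ) (z : Config) =>
      (exp (-lam * t) : ℂ) * ((heatKernel ω t z w : ℂ) * ψ z))
      ((volume.restrict (Set.Ioi 0)).prod volume) := by
  have hmeas : Measurable (Function.uncurry fun (t : ℝ) (z : Config) =>
      (exp (-lam * t) : ℂ) * ((heatKernel ω t z w : ℂ) * ψ z)) := by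
    have : Measurable fun q : ℝ × Config => heatKernel ω q.1 q.2 w :=
      (measurable_heatKernel ω).comp
        (g := fun q : ℝ × Config × Config => heatKernel ω q.1 q.2.1 q.2.2)
        (measurable_fst.prodMk (measurable_snd.prodMk measurable_const))
    have := hψ.measurable
    simp only [Function.uncurry_def]
    fun_prop
  refine ⟨hmeas.aestronglyMeasurable, ?_⟩
  rw [HasFiniteIntegral, lintegral_prod _ hmeas.enorm.aemeasurable]
  simp only [Function.uncurry_apply_pair]
  calc ∫⁻ t in Set.Ioi (0 : ℝ), ∫⁻ z,
          ‖(exp (-lam * t) : ℂ) * ((heatKernel ω t z w : ℂ) * ψ z)‖ₑ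
      ≤ ∫⁻ t in Set.Ioi 0, timeWeight lam 0 t * ENNReal.ofReal (2 * M) := by
        refine setLIntegral_mono' measurableSet_Ioi fun t ht => ?_
        simp only [enorm_mul (exp (-lam * t) : ℂ)]
        rw [lintegral_const_mul' _ _ enorm_ne_top, timeWeight_zero, ← ofReal_norm,
          Complex.norm_of_nonneg (Real.exp_pos _).le]
        gcongr
        exact lintegral_enorm_heatKernel_mul_le hω ht hM w
    _ = (∫⁻ t in Set.Ioi 0, timeWeight lam 0 t) * ENNReal.ofReal (2 * M) :=
        lintegral_mul_const _ (measurable_timeWeight lam 0)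
    _ < ∞ := ENNReal.mul_lt_top (lintegral_timeWeight_lt_top hlam 0) ENNReal.ofReal_lt_top

theorem integrableOn_exp_mul_heatFlow (hω : 0 < ω) (hlam : 0 < lam) (hψ : Continuous ψ)
    {M : ℝ} (hM : ∀ z, ‖ψ z‖ ≤ M) (w : Config) :
    IntegrableOn (fun t => (exp (-lam * t) : ℂ) * heatFlow ω ψ w t) (Set.Ioi 0) := by
  have h := (integrable_exp_mul_heatKernel_mul hω hlam hψ hM w).integral_prod_left
  simp only [Function.uncurry_apply_pair, integral_const_mul] at h
  exact h

theorem integral_greenKernel_mul (hω : 0 < ω) (hlam : 0 < lam) (hψ : Continuous ψ)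
    {M : ℝ} (hM : ∀ z, ‖ψ z‖ ≤ M) (w : Config) :
    ∫ z, (greenKernel ω lam z w : ℂ) * ψ z =
      ∫ t in Set.Ioi 0, (exp (-lam * t) : ℂ) * heatFlow ω ψ w t := by
  simp only [heatFlow, ← integral_const_mul]
  rw [integral_integral_swap (integrable_exp_mul_heatKernel_mul hω hlam hψ hM w)]
  simp only [greenKernel_eq_integral hω, ← mul_assoc, ← Complex.ofReal_mul, integral_mul_const,
    integral_complex_ofReal]

theorem heatFlow_add_const_mul (hφ : Continuous φ) (hφ_supp : HasCompactSupport φ)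
    (hψ : Continuous ψ) (hψ_supp : HasCompactSupport ψ) (c : ℂ) (w : Config) (t : ℝ) :
    heatFlow ω (fun z => φ z + c * ψ z) w t = heatFlow ω φ w t + c * heatFlow ω ψ w t := by
  simp only [heatFlow, mul_add, mul_left_comm _ c]
  rw [integral_add (integrable_heatKernel_mul ω t w hφ hφ_supp)
    ((integrable_heatKernel_mul ω t w hψ hψ_supp).const_mul c), integral_const_mul]

theorem tendsto_exp_mul_heatFlow_atTop (hω : 0 < ω) (hlam : 0 < lam) {M : ℝ}
    (hM : ∀ z, ‖φ z‖ ≤ M) (w : Config) :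
    Tendsto (fun t => (exp (-lam * t) : ℂ) * heatFlow ω φ w t) Filter.atTop (𝓝 0) := by
  have hexp : Tendsto (fun t : ℝ => exp (-lam * t)) Filter.atTop (𝓝 0) :=
    Real.tendsto_exp_atBot.comp (Filter.tendsto_id.const_mul_atTop_of_neg (neg_lt_zero.2 hlam))
  have hbound : Tendsto (fun t => exp (-lam * t) * (2 * M)) Filter.atTop (𝓝 0) := by
    simpa only [zero_mul] using hexp.mul_const (2 * M)
  refine squeeze_zero_norm' ?_ hbound
  filter_upwards [Filter.eventually_gt_atTop 0] with t ht
  rw [norm_mul, Complex.norm_of_nonneg (Real.exp_pos _).le]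
  gcongr
  exact norm_heatFlow_le hω ht hM w

theorem integral_greenKernel_mul_freeHamiltonian (hω : 0 < ω) (hlam : 0 < lam)
    (hφ : ContDiff ℝ 2 φ) (hsupp : HasCompactSupport φ) (w : Config) :
    ∫ z, (greenKernel ω lam z w : ℂ) * (freeHamiltonian ω φ z + lam * φ z) = φ w := by
  have hHφ := continuous_freeHamiltonian ω hφ
  have hHφ_supp := hasCompactSupport_freeHamiltonian ω hφ hsupp
  have hψ : Continuous fun z => freeHamiltonian ω φ z + lam * φ z :=
    hHφ.add (continuous_const.mul hφ.continuous)
  have hψ_supp : HasCompactSupport fun z => freeHamiltonian ω φ z + lam * φ z :=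
    hHφ_supp.add hsupp.mul_left
  obtain ⟨M, hM⟩ := hsupp.exists_bound_of_continuous hφ.continuous
  obtain ⟨N, hN⟩ := hψ_supp.exists_bound_of_continuous hψ
  set u : ℝ → ℂ := fun t => exp (-lam * t)
  have hu (t : ℝ) : HasDerivAt u (-lam * u t) t := by
    have h : HasDerivAt (fun t => exp (-lam * t)) (-lam * exp (-lam * t)) t := by
      simpa [mul_comm] using ((hasDerivAt_id t).const_mul (-lam)).exp
    simpa only [Complex.ofReal_mul, Complex.ofReal_neg] using h.ofReal_comp
  have hu_zero : Tendsto u (𝓝[>] 0) (𝓝 1) := by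
    simpa [u] using (hu 0).continuousAt.tendsto.mono_left nhdsWithin_le_nhds
  have hintegrand (t : ℝ) :
      -lam * u t * heatFlow ω φ w t + u t * -heatFlow ω (freeHamiltonian ω φ) w t =
        -(u t * heatFlow ω (fun z => freeHamiltonian ω φ z + lam * φ z) w t) := by
    rw [heatFlow_add_const_mul hHφ hHφ_supp hφ.continuous hsupp]
    ring
  have hparts := integral_Ioi_deriv_mul_eq_sub (fun t _ => hu t)
    (fun t ht => hasDerivAt_heatFlow hω ht hφ hsupp w)
    (((integrableOn_exp_mul_heatFlow hω hlam hψ hN w).neg).congr_fun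
      (fun t _ => (hintegrand t).symm) measurableSet_Ioi)
    (hu_zero.mul (tendsto_heatFlow hω hφ.continuous hM w))
    (tendsto_exp_mul_heatFlow_atTop hω hlam hM w)
  simp only [hintegrand, integral_neg, zero_sub, one_mul, neg_inj] at hparts
  rw [integral_greenKernel_mul hω hlam hψ hN, hparts]

theorem isFreeResolvent_of_isKernelOp (hω : 0 < ω) (hlam : 0 < lam)
    {G : L2Config →L[ℂ] L2Config} (hG : IsKernelOp (timeKernel ω (timeWeight lam 0)) G) :
    IsFreeResolvent ω lam G := by
  intro f φ hφ hsupp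
  have hφ_two : ContDiff ℝ 2 φ := mod_cast contDiff_infty.1 hφ 2
  have hψ : Continuous fun z => freeHamiltonian ω φ z + (lam : ℂ) * φ z :=
    (continuous_freeHamiltonian ω hφ_two).add (continuous_const.mul hφ.continuous)
  have hψ_supp : HasCompactSupport fun z => freeHamiltonian ω φ z + (lam : ℂ) * φ z :=
    (hasCompactSupport_freeHamiltonian ω hφ_two hsupp).add hsupp.mul_left
  obtain ⟨C, hC⟩ := exists_isL2Kernel_timeKernel_timeWeight hω hlam 0
  have hcomm := hC.integral_mul_comm (measurable_L2 f) (Lp.memLp f) hψ.measurable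
    (hψ.memLp_of_hasCompactSupport hψ_supp)
  calc ∫ z, G f z * (freeHamiltonian ω φ z + lam * φ z)
      = ∫ z, (freeHamiltonian ω φ z + lam * φ z) *
          ∫ w, ((timeKernel ω (timeWeight lam 0) z w).toReal : ℂ) * f w := by
        refine integral_congr_ae ?_
        filter_upwards [hG f] with z hz
        rw [hz.2, mul_comm]
    _ = ∫ w, (∫ z, (greenKernel ω lam z w : ℂ) * (freeHamiltonian ω φ z + lam * φ z)) * f w := by
        rw [hcomm]
        simp only [← greenKernel_eq_toReal hω, mul_comm]
    _ = ∫ w, f w * φ w := by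
        simp only [integral_greenKernel_mul_freeHamiltonian hω hlam hφ_two hsupp]
        simp only [mul_comm]

end Resolvent

end ZeroRange

theorem mainTheorem11_general (ω lam : ℝ) (hω : 0 < ω) (hlam : 0 < lam) :
    ∃ (G : ZeroRange.L2Config →L[ℂ] ZeroRange.L2Config)
      (Pot : ZeroRange.L2Plane →L[ℂ] ZeroRange.L2Config),
      ZeroRange.IsFreeResolvent ω lam G ∧
      ZeroRange.IsIntegralOperator (ZeroRange.greenKernel ω lam) G ∧
      ZeroRange.IsIntegralOperator (ZeroRange.potentialKernel ω lam) Pot ∧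
      ∀ k : ℕ, ∀ p : ℝ, 2 / ((k : ℝ) + 1) < p →
        ZeroRange.IsSchatten p (ContinuousLinearMap.adjoint Pot ∘L (G ^ k) ∘L Pot) := by
  obtain ⟨_, hkernel⟩ := ZeroRange.exists_isL2Kernel_timeKernel_timeWeight hω hlam 0
  obtain ⟨_, hdiag⟩ := ZeroRange.exists_isL2Kernel_diagKernel_timeWeight hω hlam 0
  obtain ⟨G, hG⟩ := hkernel.exists_isKernelOp
  obtain ⟨Pot, hPot⟩ := hdiag.exists_isKernelOp
  have hgreen : ZeroRange.greenKernel ω lam = fun z w =>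
      (ZeroRange.timeKernel ω (ZeroRange.timeWeight lam 0) z w).toReal :=
    funext₂ (ZeroRange.greenKernel_eq_toReal hω lam)
  have hpotential : ZeroRange.potentialKernel ω lam = fun z u =>
      (ZeroRange.diagKernel ω (ZeroRange.timeWeight lam 0) z u).toReal :=
    funext₂ fun z u => ZeroRange.greenKernel_eq_toReal hω lam z (u, u)
  exact ⟨G, Pot, ZeroRange.isFreeResolvent_of_isKernelOp hω hlam hG, hgreen ▸ hG, hpotential ▸ hPot,
    fun k p hp => ZeroRange.isSchatten_adjoint_comp_pow_comp hω hlam hG hPot k hp⟩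

theorem mainTheorem11 (ω lam : ℝ) (hω : 0 < ω) (hlam : 0 < lam) :
    ∃ (G : ZeroRange.L2Config →L[ℂ] ZeroRange.L2Config)
      (Pot : ZeroRange.L2Plane →L[ℂ] ZeroRange.L2Config),
      ZeroRange.IsFreeResolvent ω lam G ∧
      ZeroRange.IsIntegralOperator (ZeroRange.greenKernel ω lam) G ∧
      ZeroRange.IsIntegralOperator (ZeroRange.potentialKernel ω lam) Pot ∧
      ∀ k : ℕ, (k : ℝ) < lam → ∀ p : ℝ, 2 / ((k : ℝ) + 1) < p →
        ZeroRange.IsSchatten p (ContinuousLinearMap.adjoint Pot ∘L (G ^ k) ∘L Pot) := by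
  obtain ⟨G, Pot, hres, hgreen, hpot, hschatten⟩ := mainTheorem11_general ω lam hω hlam
  exact ⟨G, Pot, hres, hgreen, hpot, fun k _ => hschatten k⟩
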